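/- **Syntax.** There are four syntactic classes: $\mathsf{Ty}$, $\mathsf{Tm}$ (the object classes), $\mathsf{EqTy}$ and $\mathsf{EqTm}$. A *signature* assigns to each symbol $\mathsf S$ an arity $(c,[(c_1,n_1),\dots,(c_k,n_k)])$ with $c$ an object class, $c_i$ classes and $n_i\in\mathbb N$. *Type expressions* are $\mathsf S(e_1,\dots,e_k)$ and $\mathsf M(t_1,\dots,t_n)$; *term expressions* are free variables $\mathsf a$, bound variables $x$, and again $\mathsf S(\vec e)$, $\mathsf M(\vec t)$; *arguments* are types, terms, dummies $\star_{\mathsf{EqTy}},\star_{\mathsf{EqTm}}$, and abstractions $\{x\}e$. The argument $\{x_1\}\cdots\{x_n\}e$, with $e$ of class $c$ and not abstracted, has arity $(c,n)$. A *judgement thesis* is $A\ \mathsf{type}$, $t:A$, $A\equiv B$ or $s\equiv t:A$; a *boundary thesis* $b$ is $\Box\ \mathsf{type}$, $\Box:A$ (object boundaries), $A\equiv B\ \mathsf{by}\ \Box$ or $s\equiv t:A\ \mathsf{by}\ \Box$ (equality boundaries). Abstracted judgements $\mathcal J$ and boundaries $\mathcal B$ are obtained by prefixing $\{x_1:A_1\}\cdots\{x_m:A_m\}$,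 and the arity of $\{x_1:A_1\}\cdots\{x_m:A_m\}\,b$ is (class of $b$, $m$). If $e$ has the arity of $\mathcal B$, then $\mathcal B[e]$ is the judgement obtained by filling $\Box$ with $e$ (a dummy in the case of equations); if $\mathcal B$ is an object boundary, then $\mathcal B[e\equiv e']$ is the corresponding equation, e.g. $(\{x:A\}\,\Box:B)[\{x\}s\equiv\{x\}t]=\{x:A\}\,s\equiv t:B$. A *metavariable context* $\Theta=[\mathsf M_1:\mathcal B_1,\dots,\mathsf M_n:\mathcal B_n]$ has distinct $\mathsf M_i$ and closed boundaries $\mathcal B_i$ over the preceding entries; a *variable context* $\Gamma=[\mathsf a_1:A_1,\dots,\mathsf a_n:A_n]$ over $\Theta$ has distinct $\mathsf a_i$ and types $A_i$ over $\Theta$ and the preceding entries. All entities are required to be syntactically valid: arities are respected (with $\mathsf M_i$ having the arity of $\mathcal B_i$, and only object metavariables occurring in expressions), free variables and metavariables are declared in the context, and bound variables are bound. Hypothetical judgements $\Theta;\Gamma\vdash\mathcal J$ and hypothetical boundaries $\Theta;\Gamma\vdash\mathcal B$ are such valid entities. **Instantiations.** An *instantiation* of $\Xi=[\mathsf M_1:\mathcal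 B_1,\dots,\mathsf M_n:\mathcal B_n]$ over $\Theta;\Gamma$ is a list $I=\langle\mathsf M_1\mapsto e_1,\dots,\mathsf M_n\mapsto e_n\rangle$ of arguments over $\Theta;\Gamma$ such that $e_i$ has the arity of $\mathcal B_i$; put $I_{(k)}=\langle\mathsf M_1\mapsto e_1,\dots,\mathsf M_{k-1}\mapsto e_{k-1}\rangle$. It acts on expressions, judgements and boundaries homomorphically, with $I_*(\mathsf M(\vec t))=e[I_*\vec t/\vec x]$ if $I(\mathsf M)=\{\vec x\}e$. **Type theories.** A *raw rule* $\Xi\Rightarrow b[e]$ is a hypothetical judgement $\Xi;[\,]\vdash b[e]$ with $b$ a boundary thesis; it is an object rule if $b$ is an object boundary. A *raw type theory* $T$ is a family of raw rules, its specific rules. Derivability in $T$ of hypothetical judgements and boundaries is generated by the following closure rules, where premises and conclusions are over $\Theta;\Gamma$ unless shown otherwise. * Variables: $\mathsf a:A$ whenever $(\mathsf a:A)\in\Gamma$. * Metavariables, for $\Theta(\mathsf M)=\{x_1:A_1\}\cdots\{x_m:A_m\}\,b$: from $t_j:A_j[t_1/x_1,\dots,t_{j-1}/x_{j-1}]$ for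 all $j$ and $b[\vec t/\vec x]$, infer $b[\vec t/\vec x]$ filled with $\mathsf M(\vec t)$ (with the dummy if $b$ is an equality boundary). * Metavariable congruence, if moreover $b$ is an object boundary: from $s_j:A_j[\vec s_{<j}/\vec x_{<j}]$, $t_j:A_j[\vec t_{<j}/\vec x_{<j}]$ and $s_j\equiv t_j:A_j[\vec s_{<j}/\vec x_{<j}]$ for all $j$, and $C[\vec s/\vec x]\equiv C[\vec t/\vec x]$ if $b=(\Box:C)$, infer $b[\vec s/\vec x]$ filled with $\mathsf M(\vec s)\equiv\mathsf M(\vec t)$. * Abstraction: from $A\ \mathsf{type}$ and $\Theta;\Gamma,\mathsf a:A\vdash\mathcal J[\mathsf a/x]$ with $\mathsf a\notin|\Gamma|$, infer $\{x:A\}\,\mathcal J$; likewise for a boundary in place of $\mathcal J$. * Equality: reflexivity, symmetry and transitivity of equality of types and of equality of terms at a type; from $A\equiv B$ together with $t:A$ (resp. $s\equiv t:A$), infer $t:B$ (resp. $s\equiv t:B$). * Boundaries: $\Box\ \mathsf{type}$, without premises; $\Box:A$ from $A\ \mathsf{type}$; $A\equiv B\ \mathsf{by}\ \Box$ from $A\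 \mathsf{type}$ and $B\ \mathsf{type}$; $s\equiv t:A\ \mathsf{by}\ \Box$ from $A\ \mathsf{type}$, $s:A$ and $t:A$. * Specific rules: for each specific rule $[\mathsf M_1:\mathcal B_1,\dots,\mathsf M_n:\mathcal B_n]\Rightarrow b[e]$ and each instantiation $I=\langle\mathsf M_i\mapsto f_i\rangle_i$ of its metavariable context, from $(I_{(i)*}\mathcal B_i)[f_i]$ for all $i$ and $I_*b$, infer $I_*(b[e])$. * Congruence: for each such rule with $b$ an object boundary and instantiations $I=\langle\mathsf M_i\mapsto f_i\rangle_i$ and $J=\langle\mathsf M_i\mapsto g_i\rangle_i$, from $(I_{(i)*}\mathcal B_i)[f_i]$ and $(J_{(i)*}\mathcal B_i)[g_i]$ for all $i$, $(I_{(i)*}\mathcal B_i)[f_i\equiv g_i]$ for all $i$ with $\mathcal B_i$ an object boundary, and $I_*B\equiv J_*B$ if $b=(\Box:B)$, infer $(I_*b)[I_*e\equiv J_*e]$. The judgement $\vdash\Xi\ \mathsf{mctx}$ ($\Xi$ is well formed) means that the metavariables of $\Xi$ are distinct and each $\Xi_{(i)};[\,]\vdash\mathcal B_i$ is derivable, where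 $\Xi_{(i)}$ consists of the entries before the $i$-th. The judgement $\Theta\vdash\Gamma\ \mathsf{vctx}$ means that $\vdash\Theta\ \mathsf{mctx}$, the variables of $\Gamma$ are distinct, and each $\Theta;\Gamma_{(i)}\vdash A_i\ \mathsf{type}$ is derivable. A raw type theory is *finitary* when for each of its specific rules $\Xi\Rightarrow b[e]$ both $\vdash\Xi\ \mathsf{mctx}$ and $\Xi;[\,]\vdash b$ are derivable in the theory itself. **Proposition.** In a finitary type theory, let $I=\langle\mathsf M_1\mapsto e_1,\dots,\mathsf M_n\mapsto e_n\rangle$ and $J=\langle\mathsf M_1\mapsto f_1,\dots,\mathsf M_n\mapsto f_n\rangle$ be instantiations of $\Xi=[\mathsf M_1:\mathcal B_1,\dots,\mathsf M_n:\mathcal B_n]$ over $\Theta;\Gamma$, where $\vdash\Xi\ \mathsf{mctx}$ and $\Theta\vdash\Gamma\ \mathsf{vctx}$. Suppose that $I$ is derivable, i.e. $\Theta;\Gamma\vdash(I_{(k)*}\mathcal B_k)[e_k]$ is derivable for $k=1,\dots,n$, and that $I$ and $J$ are judgementally equal, i.e. $\Theta;\Gamma\vdash(I_{(k)*}\mathcal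 B_k)[e_k\equiv f_k]$ is derivable for each $k$ such that $\mathcal B_k$ is an object boundary. Then $J$ is derivable, i.e. $\Theta;\Gamma\vdash(J_{(k)*}\mathcal B_k)[f_k]$ is derivable for $k=1,\dots,n$. -/

import Mathlib

universe u v

namespace FTT

/-! ### Signatures and raw expressions -/

/-- The four judgement forms, which are also the syntactic classes:
types, terms, type equations, term equations. -/
inductive SynClass
  | ty | tm | eqTy | eqTm

/-- The object classes are those of types and terms. -/
def SynClass.IsObject : SynClass → Prop
  | .ty => True
  | .tm => True
  | .eqTy => False
  | .eqTm => False

/-- A signature assigns to each primitive symbol its arity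
`(c, [(c₁, n₁), …, (cₖ, nₖ)])` with `c` an object class. -/
structure Signature where
  Sym : Type u
  cls : Sym → SynClass
  cls_isObject : ∀ s, (cls s).IsObject
  args : Sym → List (SynClass × ℕ)

/-- Names of free variables. -/
abbrev Name := ℕ

/-- Names of metavariables. -/
abbrev MVar := ℕ

/-- Raw expressions and arguments, in locally nameless form: free variables are names, bound
variables are de Bruijn indices. Validity with respect to a context is `Expr.Valid` below. -/
inductive Expr (S : Signature.{u}) : Type u
  | fvar (a : Name)
  | bvar (i : ℕ)
  | symApp (s : S.Sym) (es : Fin (S.args s).length → Expr S)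
  | metaApp (M : MVar) (n : ℕ) (ts : Fin n → Expr S)
  | starTy
  | starTm
  | abstr (e : Expr S)

variable {S : Signature.{u}}

/-! ### Substitution for bound variables -/

/-- Lifting of a renaming of de Bruijn indices under a binder. -/
def liftRen (ρ : ℕ → ℕ) : ℕ → ℕ
  | 0 => 0
  | i + 1 => ρ i + 1

def Expr.rename : (ℕ → ℕ) → Expr S → Expr S
  | _, .fvar a => .fvar a
  | ρ, .bvar i => .bvar (ρ i)
  | ρ, .symApp s es => .symApp s fun i => (es i).rename ρ
  | ρ, .metaApp M n ts => .metaApp M n fun i => (ts i).rename ρ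
  | _, .starTy => .starTy
  | _, .starTm => .starTm
  | ρ, .abstr e => .abstr (e.rename (liftRen ρ))

/-- Lifting of a substitution under a binder. -/
def liftSubst (σ : ℕ → Expr S) : ℕ → Expr S
  | 0 => .bvar 0
  | i + 1 => (σ i).rename Nat.succ

/-- Simultaneous capture-avoiding substitution for bound variables. -/
def Expr.subst : (ℕ → Expr S) → Expr S → Expr S
  | _, .fvar a => .fvar a
  | σ, .bvar i => σ i
  | σ, .symApp s es => .symApp s fun i => (es i).subst σ
  | σ, .metaApp M n ts => .metaApp M n fun i => (ts i).subst σ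
  | _, .starTy => .starTy
  | _, .starTm => .starTm
  | σ, .abstr e => .abstr (e.subst (liftSubst σ))

/-- The substitution `[t₁/x₁, …, tₙ/xₙ]`, where `x₁, …, xₙ` are the `n` innermost bound variables,
bound in this order; `xₙ` is the innermost one and has index `0`. -/
def vecSubst (n : ℕ) (ts : Fin n → Expr S) : ℕ → Expr S := fun i =>
  if h : i < n then ts (Fin.rev ⟨i, h⟩) else .bvar (i - n)

/-! ### Judgements and boundaries -/

/-- Judgement theses. The dummy heads of equations carry no information and are left implicit. -/
inductive JThesis (S : Signature.{u}) : Type u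
  | isTy (A : Expr S)
  | isTm (t A : Expr S)
  | eqTy (A B : Expr S)
  | eqTm (s t A : Expr S)

/-- Boundary theses: `□ type`, `□ : A`, `A ≡ B by □`, `s ≡ t : A by □`. -/
inductive BThesis (S : Signature.{u}) : Type u
  | ty
  | tm (A : Expr S)
  | eqTy (A B : Expr S)
  | eqTm (s t A : Expr S)

/-- Abstracted theses `{x₁ : A₁} ⋯ {xₘ : Aₘ} X`. In `abstr A J` the index `0` is bound in `J`,
but not in `A`. -/
inductive Abs (S : Signature.{u}) (X : Type u) : Type u
  | base (x : X)
  | abstr (A : Expr S) (J : Abs S X)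

/-- Abstracted judgements. -/
abbrev Judg (S : Signature.{u}) := Abs S (JThesis S)

/-- Abstracted boundaries. -/
abbrev Bdry (S : Signature.{u}) := Abs S (BThesis S)

/-- The list `[A₁, …, Aₘ]` of types of an abstracted thesis `{x₁ : A₁} ⋯ {xₘ : Aₘ} X`. -/
def Abs.tele {X : Type u} : Abs S X → List (Expr S)
  | .base _ => []
  | .abstr A J => A :: J.tele

/-- The thesis `X` of an abstracted thesis `{x₁ : A₁} ⋯ {xₘ : Aₘ} X`. -/
def Abs.body {X : Type u} : Abs S X → X
  | .base x => x
  | .abstr _ J => J.body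

def JThesis.map (f : Expr S → Expr S) : JThesis S → JThesis S
  | .isTy A => .isTy (f A)
  | .isTm t A => .isTm (f t) (f A)
  | .eqTy A B => .eqTy (f A) (f B)
  | .eqTm s t A => .eqTm (f s) (f t) (f A)

def BThesis.map (f : Expr S → Expr S) : BThesis S → BThesis S
  | .ty => .ty
  | .tm A => .tm (f A)
  | .eqTy A B => .eqTy (f A) (f B)
  | .eqTm s t A => .eqTm (f s) (f t) (f A)

/-- Substitution in abstracted judgements. -/
def substJ : (ℕ → Expr S) → Judg S → Judg S
  | σ, .base j => .base (j.map (Expr.subst σ))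
  | σ, .abstr A J => .abstr (A.subst σ) (substJ (liftSubst σ) J)

/-- Substitution in abstracted boundaries. -/
def substB : (ℕ → Expr S) → Bdry S → Bdry S
  | σ, .base b => .base (b.map (Expr.subst σ))
  | σ, .abstr A B => .abstr (A.subst σ) (substB (liftSubst σ) B)

/-- `𝒥[a/x]`, where `x` is the bound variable with dangling index `0`. -/
def openJ (a : Name) (J : Judg S) : Judg S := substJ (vecSubst 1 fun _ => .fvar a) J

/-- `ℬ[a/x]`, where `x` is the bound variable with dangling index `0`. -/
def openB (a : Name) (B : Bdry S) : Bdry S := substB (vecSubst 1 fun _ => .fvar a) B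

def BThesis.cls : BThesis S → SynClass
  | .ty => .ty
  | .tm _ => .tm
  | .eqTy _ _ => .eqTy
  | .eqTm _ _ _ => .eqTm

/-- The metavariable arity of an abstracted boundary. -/
def arityB (B : Bdry S) : SynClass × ℕ := (B.body.cls, B.tele.length)

/-- Filling a boundary thesis with a head (the head of an equation is a dummy). -/
def BThesis.plug : BThesis S → Expr S → JThesis S
  | .ty, A => .isTy A
  | .tm A, t => .isTm t A
  | .eqTy A B, _ => .eqTy A B
  | .eqTm s t A, _ => .eqTm s t A

/-- `ℬ[e]`, meant for `ℬ` and `e` of the same arity. -/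
def plug : Bdry S → Expr S → Judg S
  | .base b, e => .base (b.plug e)
  | .abstr A B, .abstr e => .abstr A (plug B e)
  | .abstr A B, e => .abstr A (plug B e)

/-- Filling an object boundary thesis with an equation (equality boundaries are never used). -/
def BThesis.plugEq : BThesis S → Expr S → Expr S → JThesis S
  | .ty, A, B => .eqTy A B
  | .tm A, s, t => .eqTm s t A
  | .eqTy A B, _, _ => .eqTy A B
  | .eqTm s t A, _, _ => .eqTm s t A

/-- `ℬ[e ≡ e']`, meant for an object boundary `ℬ` and `e`, `e'` of the same arity. -/
def plugEq : Bdry S → Expr S → Expr S → Judg S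
  | .base b, e, e' => .base (b.plugEq e e')
  | .abstr A B, .abstr e, .abstr e' => .abstr A (plugEq B e e')
  | .abstr A B, e, e' => .abstr A (plugEq B e e')

/-! ### Contexts and syntactic validity -/

/-- Metavariable contexts `[M₁ : ℬ₁, …, Mₙ : ℬₙ]`. -/
abbrev MCtx (S : Signature.{u}) := List (MVar × Bdry S)

/-- Variable contexts `[a₁ : A₁, …, aₙ : Aₙ]`. -/
abbrev VCtx (S : Signature.{u}) := List (Name × Expr S)

/-- `Expr.Valid Θ Γ k e (c, n)`: the argument `e` is syntactically valid over `Θ; Γ` and `k`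
bound variables, and its arity is `(c, n)`. -/
inductive Expr.Valid (Θ : MCtx S) (Γ : VCtx S) : ℕ → Expr S → SynClass × ℕ → Prop
  | fvar {k : ℕ} {a : Name} : a ∈ Γ.map Prod.fst → Valid Θ Γ k (.fvar a) (.tm, 0)
  | bvar {k i : ℕ} : i < k → Valid Θ Γ k (.bvar i) (.tm, 0)
  | symApp {k : ℕ} {s : S.Sym} {es : Fin (S.args s).length → Expr S} :
      (∀ i, Valid Θ Γ k (es i) ((S.args s).get i)) → Valid Θ Γ k (.symApp s es) (S.cls s, 0)
  | metaApp {k : ℕ} {M : MVar} {B : Bdry S} {n : ℕ} {ts : Fin n → Expr S} :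
      (M, B) ∈ Θ → B.body.cls.IsObject → n = B.tele.length →
      (∀ i, Valid Θ Γ k (ts i) (.tm, 0)) → Valid Θ Γ k (.metaApp M n ts) (B.body.cls, 0)
  | starTy {k : ℕ} : Valid Θ Γ k .starTy (.eqTy, 0)
  | starTm {k : ℕ} : Valid Θ Γ k .starTm (.eqTm, 0)
  | abstr {k : ℕ} {e : Expr S} {c : SynClass} {n : ℕ} :
      Valid Θ Γ (k + 1) e (c, n) → Valid Θ Γ k (.abstr e) (c, n + 1)

def JThesis.Valid (Θ : MCtx S) (Γ : VCtx S) (k : ℕ) : JThesis S → Prop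
  | .isTy A => A.Valid Θ Γ k (.ty, 0)
  | .isTm t A => t.Valid Θ Γ k (.tm, 0) ∧ A.Valid Θ Γ k (.ty, 0)
  | .eqTy A B => A.Valid Θ Γ k (.ty, 0) ∧ B.Valid Θ Γ k (.ty, 0)
  | .eqTm s t A => s.Valid Θ Γ k (.tm, 0) ∧ t.Valid Θ Γ k (.tm, 0) ∧ A.Valid Θ Γ k (.ty, 0)

def BThesis.Valid (Θ : MCtx S) (Γ : VCtx S) (k : ℕ) : BThesis S → Prop
  | .ty => True
  | .tm A => A.Valid Θ Γ k (.ty, 0)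
  | .eqTy A B => A.Valid Θ Γ k (.ty, 0) ∧ B.Valid Θ Γ k (.ty, 0)
  | .eqTm s t A => s.Valid Θ Γ k (.tm, 0) ∧ t.Valid Θ Γ k (.tm, 0) ∧ A.Valid Θ Γ k (.ty, 0)

/-- Syntactic validity of abstracted judgements under `k` bound variables. -/
def ValidJ (Θ : MCtx S) (Γ : VCtx S) : ℕ → Judg S → Prop
  | k, .base j => j.Valid Θ Γ k
  | k, .abstr A J => A.Valid Θ Γ k (.ty, 0) ∧ ValidJ Θ Γ (k + 1) J

/-- Syntactic validity of abstracted boundaries under `k` bound variables. -/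
def ValidB (Θ : MCtx S) (Γ : VCtx S) : ℕ → Bdry S → Prop
  | k, .base b => b.Valid Θ Γ k
  | k, .abstr A B => A.Valid Θ Γ k (.ty, 0) ∧ ValidB Θ Γ (k + 1) B

/-- A metavariable context is syntactically valid when its metavariables are distinct and each
boundary is closed and valid over the preceding entries. -/
def ValidMCtx (Θ : MCtx S) : Prop :=
  (Θ.map Prod.fst).Nodup ∧
    ∀ (i : ℕ) (M : MVar) (B : Bdry S), Θ[i]? = some (M, B) → ValidB (Θ.take i) [] 0 B

/-- A variable context over `Θ` is syntactically valid when its variables are distinct and each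
type is valid over `Θ` and the preceding entries. -/
def ValidVCtx (Θ : MCtx S) (Γ : VCtx S) : Prop :=
  (Γ.map Prod.fst).Nodup ∧
    ∀ (i : ℕ) (a : Name) (A : Expr S), Γ[i]? = some (a, A) → A.Valid Θ (Γ.take i) 0 (.ty, 0)

/-- What may stand to the right of the turnstile: an abstracted judgement or an abstracted
boundary. -/
inductive Stmt (S : Signature.{u}) : Type u
  | jdg (J : Judg S)
  | bdr (B : Bdry S)

/-- Syntactic validity of the hypothetical judgement or boundary `Θ; Γ ⊢ 𝒳`. -/
def ValidHyp (Θ : MCtx S) (Γ : VCtx S) (X : Stmt S) : Prop :=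
  ValidMCtx Θ ∧ ValidVCtx Θ Γ ∧
    match X with
    | .jdg J => ValidJ Θ Γ 0 J
    | .bdr B => ValidB Θ Γ 0 B

/-! ### Instantiations -/

/-- Lists `⟨M₁ ↦ e₁, …, Mₙ ↦ eₙ⟩`. -/
abbrev Inst (S : Signature.{u}) := List (MVar × Expr S)

/-- `I` is an instantiation of `Ξ` over `Θ; Γ`. -/
def Inst.IsInst (I : Inst S) (Ξ Θ : MCtx S) (Γ : VCtx S) : Prop :=
  I.map Prod.fst = Ξ.map Prod.fst ∧
    ∀ (i : ℕ) (M N : MVar) (B : Bdry S) (e : Expr S),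
      Ξ[i]? = some (M, B) → I[i]? = some (N, e) → e.Valid Θ Γ 0 (arityB B)

/-- `stripAbs n ({x₁} ⋯ {xₙ} e)` is `e`. -/
def Expr.stripAbs : ℕ → Expr S → Expr S
  | n + 1, .abstr e => e.stripAbs n
  | _, e => e

/-- The action of an instantiation on expressions. -/
def Expr.act (I : Inst S) : Expr S → Expr S
  | .fvar a => .fvar a
  | .bvar i => .bvar i
  | .symApp s es => .symApp s fun i => (es i).act I
  | .metaApp M n ts =>
      match I.lookup M with
      | some e => (e.stripAbs n).subst (vecSubst n fun i => (ts i).act I)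
      | none => .metaApp M n fun i => (ts i).act I
  | .starTy => .starTy
  | .starTm => .starTm
  | .abstr e => .abstr (e.act I)

/-- The action of an instantiation on judgement theses. -/
def JThesis.act (I : Inst S) (j : JThesis S) : JThesis S := j.map (Expr.act I)

/-- The action of an instantiation on boundary theses. -/
def BThesis.act (I : Inst S) (b : BThesis S) : BThesis S := b.map (Expr.act I)

/-- The action of an instantiation on abstracted boundaries. -/
def actB (I : Inst S) : Bdry S → Bdry S
  | .base b => .base (b.act I)
  | .abstr A B => .abstr (A.act I) (actB I B)

/-! ### Raw type theories and derivability -/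

/-- A raw rule `Ξ ⟹ b[e]`, i.e. a hypothetical judgement `Ξ; [] ⊢ b[e]` that is not abstracted. -/
structure RawRule (S : Signature.{u}) : Type u where
  mctx : MCtx S
  bdry : BThesis S
  head : Expr S
  valid_mctx : ValidMCtx mctx
  valid_bdry : bdry.Valid mctx [] 0
  valid_head : head.Valid mctx [] 0 (bdry.cls, 0)

/-- A raw type theory over `S` is a family of raw rules, its specific rules. -/
structure RawTypeTheory (S : Signature.{u}) where
  Idx : Type v
  rule : Idx → RawRule S

/-- Derivability in the deductive system associated with a raw type theory: `Derives T Θ Γ 𝒳`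
means that the hypothetical judgement or boundary `Θ; Γ ⊢ 𝒳` is derivable. The carrier consists of
the syntactically valid hypothetical judgements and boundaries, which is what the assumption
`ValidHyp` on each conclusion says (the premises are then valid, being derivable). -/
inductive Derives (T : RawTypeTheory.{u, v} S) : MCtx S → VCtx S → Stmt S → Prop
  -- variables, metavariables, abstraction
  | var {Θ : MCtx S} {Γ : VCtx S} {a : Name} {A : Expr S}
      (hv : ValidHyp Θ Γ (.jdg (.base (.isTm (.fvar a) A)))) :
      (a, A) ∈ Γ →
      Derives T Θ Γ (.jdg (.base (.isTm (.fvar a) A)))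
  | meta_ {Θ : MCtx S} {Γ : VCtx S} {M : MVar} {B : Bdry S} (ts : Fin B.tele.length → Expr S)
      (hv : ValidHyp Θ Γ (.jdg (.base
        ((B.body.map (Expr.subst (vecSubst _ ts))).plug (.metaApp M _ ts))))) :
      (M, B) ∈ Θ →
      (∀ j : Fin B.tele.length, Derives T Θ Γ (.jdg (.base (.isTm (ts j)
        ((B.tele.get j).subst (vecSubst j fun i : Fin j => ts (i.castLE j.isLt.le))))))) →
      Derives T Θ Γ (.bdr (.base (B.body.map (Expr.subst (vecSubst _ ts))))) →
      Derives T Θ Γ (.jdg (.base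
        ((B.body.map (Expr.subst (vecSubst _ ts))).plug (.metaApp M _ ts))))
  | metaCongr {Θ : MCtx S} {Γ : VCtx S} {M : MVar} {B : Bdry S}
      (ss ts : Fin B.tele.length → Expr S)
      (hv : ValidHyp Θ Γ (.jdg (.base
        ((B.body.map (Expr.subst (vecSubst _ ss))).plugEq (.metaApp M _ ss) (.metaApp M _ ts))))) :
      (M, B) ∈ Θ →
      B.body.cls.IsObject →
      (∀ j : Fin B.tele.length, Derives T Θ Γ (.jdg (.base (.isTm (ss j)
        ((B.tele.get j).subst (vecSubst j fun i : Fin j => ss (i.castLE j.isLt.le))))))) →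
      (∀ j : Fin B.tele.length, Derives T Θ Γ (.jdg (.base (.isTm (ts j)
        ((B.tele.get j).subst (vecSubst j fun i : Fin j => ts (i.castLE j.isLt.le))))))) →
      (∀ j : Fin B.tele.length, Derives T Θ Γ (.jdg (.base (.eqTm (ss j) (ts j)
        ((B.tele.get j).subst (vecSubst j fun i : Fin j => ss (i.castLE j.isLt.le))))))) →
      (∀ C : Expr S, B.body = .tm C → Derives T Θ Γ (.jdg (.base
        (.eqTy (C.subst (vecSubst _ ss)) (C.subst (vecSubst _ ts)))))) →
      Derives T Θ Γ (.jdg (.base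
        ((B.body.map (Expr.subst (vecSubst _ ss))).plugEq (.metaApp M _ ss) (.metaApp M _ ts))))
  | abstr {Θ : MCtx S} {Γ : VCtx S} {A : Expr S} {J : Judg S} (a : Name)
      (hv : ValidHyp Θ Γ (.jdg (.abstr A J))) :
      Derives T Θ Γ (.jdg (.base (.isTy A))) →
      a ∉ Γ.map Prod.fst →
      Derives T Θ (Γ ++ [(a, A)]) (.jdg (openJ a J)) →
      Derives T Θ Γ (.jdg (.abstr A J))
  -- equality
  | tyRefl {Θ : MCtx S} {Γ : VCtx S} {A : Expr S}
      (hv : ValidHyp Θ Γ (.jdg (.base (.eqTy A A)))) :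
      Derives T Θ Γ (.jdg (.base (.isTy A))) →
      Derives T Θ Γ (.jdg (.base (.eqTy A A)))
  | tySym {Θ : MCtx S} {Γ : VCtx S} {A B : Expr S}
      (hv : ValidHyp Θ Γ (.jdg (.base (.eqTy B A)))) :
      Derives T Θ Γ (.jdg (.base (.eqTy A B))) →
      Derives T Θ Γ (.jdg (.base (.eqTy B A)))
  | tyTran {Θ : MCtx S} {Γ : VCtx S} {A B C : Expr S}
      (hv : ValidHyp Θ Γ (.jdg (.base (.eqTy A C)))) :
      Derives T Θ Γ (.jdg (.base (.eqTy A B))) →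
      Derives T Θ Γ (.jdg (.base (.eqTy B C))) →
      Derives T Θ Γ (.jdg (.base (.eqTy A C)))
  | tmRefl {Θ : MCtx S} {Γ : VCtx S} {t A : Expr S}
      (hv : ValidHyp Θ Γ (.jdg (.base (.eqTm t t A)))) :
      Derives T Θ Γ (.jdg (.base (.isTm t A))) →
      Derives T Θ Γ (.jdg (.base (.eqTm t t A)))
  | tmSym {Θ : MCtx S} {Γ : VCtx S} {s t A : Expr S}
      (hv : ValidHyp Θ Γ (.jdg (.base (.eqTm t s A)))) :
      Derives T Θ Γ (.jdg (.base (.eqTm s t A))) →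
      Derives T Θ Γ (.jdg (.base (.eqTm t s A)))
  | tmTran {Θ : MCtx S} {Γ : VCtx S} {s t w A : Expr S}
      (hv : ValidHyp Θ Γ (.jdg (.base (.eqTm s w A)))) :
      Derives T Θ Γ (.jdg (.base (.eqTm s t A))) →
      Derives T Θ Γ (.jdg (.base (.eqTm t w A))) →
      Derives T Θ Γ (.jdg (.base (.eqTm s w A)))
  | convTm {Θ : MCtx S} {Γ : VCtx S} {t A B : Expr S}
      (hv : ValidHyp Θ Γ (.jdg (.base (.isTm t B)))) :
      Derives T Θ Γ (.jdg (.base (.isTm t A))) →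
      Derives T Θ Γ (.jdg (.base (.eqTy A B))) →
      Derives T Θ Γ (.jdg (.base (.isTm t B)))
  | convEq {Θ : MCtx S} {Γ : VCtx S} {s t A B : Expr S}
      (hv : ValidHyp Θ Γ (.jdg (.base (.eqTm s t B)))) :
      Derives T Θ Γ (.jdg (.base (.eqTm s t A))) →
      Derives T Θ Γ (.jdg (.base (.eqTy A B))) →
      Derives T Θ Γ (.jdg (.base (.eqTm s t B)))
  -- boundaries
  | bdryTy {Θ : MCtx S} {Γ : VCtx S}
      (hv : ValidHyp Θ Γ (.bdr (.base .ty))) :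
      Derives T Θ Γ (.bdr (.base .ty))
  | bdryTm {Θ : MCtx S} {Γ : VCtx S} {A : Expr S}
      (hv : ValidHyp Θ Γ (.bdr (.base (.tm A)))) :
      Derives T Θ Γ (.jdg (.base (.isTy A))) →
      Derives T Θ Γ (.bdr (.base (.tm A)))
  | bdryEqTy {Θ : MCtx S} {Γ : VCtx S} {A B : Expr S}
      (hv : ValidHyp Θ Γ (.bdr (.base (.eqTy A B)))) :
      Derives T Θ Γ (.jdg (.base (.isTy A))) →
      Derives T Θ Γ (.jdg (.base (.isTy B))) →
      Derives T Θ Γ (.bdr (.base (.eqTy A B)))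
  | bdryEqTm {Θ : MCtx S} {Γ : VCtx S} {s t A : Expr S}
      (hv : ValidHyp Θ Γ (.bdr (.base (.eqTm s t A)))) :
      Derives T Θ Γ (.jdg (.base (.isTy A))) →
      Derives T Θ Γ (.jdg (.base (.isTm s A))) →
      Derives T Θ Γ (.jdg (.base (.isTm t A))) →
      Derives T Θ Γ (.bdr (.base (.eqTm s t A)))
  | bdryAbstr {Θ : MCtx S} {Γ : VCtx S} {A : Expr S} {B : Bdry S} (a : Name)
      (hv : ValidHyp Θ Γ (.bdr (.abstr A B))) :
      Derives T Θ Γ (.jdg (.base (.isTy A))) →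
      a ∉ Γ.map Prod.fst →
      Derives T Θ (Γ ++ [(a, A)]) (.bdr (openB a B)) →
      Derives T Θ Γ (.bdr (.abstr A B))
  -- instantiations of the specific rules
  | specific {Θ : MCtx S} {Γ : VCtx S} (r : T.Idx) (I : Inst S)
      (hv : ValidHyp Θ Γ (.jdg (.base (((T.rule r).bdry.plug (T.rule r).head).act I)))) :
      I.IsInst (T.rule r).mctx Θ Γ →
      (∀ (i : ℕ) (M N : MVar) (B : Bdry S) (e : Expr S),
        (T.rule r).mctx[i]? = some (M, B) → I[i]? = some (N, e) →
        Derives T Θ Γ (.jdg (plug (actB (I.take i) B) e))) →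
      Derives T Θ Γ (.bdr (.base ((T.rule r).bdry.act I))) →
      Derives T Θ Γ (.jdg (.base (((T.rule r).bdry.plug (T.rule r).head).act I)))
  -- congruence rules of the specific object rules
  | congr {Θ : MCtx S} {Γ : VCtx S} (r : T.Idx) (I J : Inst S)
      (hv : ValidHyp Θ Γ (.jdg (.base (((T.rule r).bdry.act I).plugEq
        ((T.rule r).head.act I) ((T.rule r).head.act J))))) :
      (T.rule r).bdry.cls.IsObject →
      I.IsInst (T.rule r).mctx Θ Γ →
      J.IsInst (T.rule r).mctx Θ Γ →
      (∀ (i : ℕ) (M N : MVar) (B : Bdry S) (f : Expr S),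
        (T.rule r).mctx[i]? = some (M, B) → I[i]? = some (N, f) →
        Derives T Θ Γ (.jdg (plug (actB (I.take i) B) f))) →
      (∀ (i : ℕ) (M N : MVar) (B : Bdry S) (g : Expr S),
        (T.rule r).mctx[i]? = some (M, B) → J[i]? = some (N, g) →
        Derives T Θ Γ (.jdg (plug (actB (J.take i) B) g))) →
      (∀ (i : ℕ) (M N N' : MVar) (B : Bdry S) (f g : Expr S),
        (T.rule r).mctx[i]? = some (M, B) → I[i]? = some (N, f) → J[i]? = some (N', g) →
        B.body.cls.IsObject →
        Derives T Θ Γ (.jdg (plugEq (actB (I.take i) B) f g))) →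
      (∀ C : Expr S, (T.rule r).bdry = .tm C →
        Derives T Θ Γ (.jdg (.base (.eqTy (C.act I) (C.act J))))) →
      Derives T Θ Γ (.jdg (.base (((T.rule r).bdry.act I).plugEq
        ((T.rule r).head.act I) ((T.rule r).head.act J))))

/-- `⊢ Θ mctx`: well-formed metavariable contexts. -/
inductive WfMCtx (T : RawTypeTheory.{u, v} S) : MCtx S → Prop
  | empty : WfMCtx T []
  | extend {Θ : MCtx S} {M : MVar} {B : Bdry S} :
      WfMCtx T Θ → Derives T Θ [] (.bdr B) → M ∉ Θ.map Prod.fst → WfMCtx T (Θ ++ [(M, B)])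

/-- `Θ ⊢ Γ vctx`: well-formed variable contexts over a well-formed metavariable context. -/
inductive WfVCtx (T : RawTypeTheory.{u, v} S) (Θ : MCtx S) : VCtx S → Prop
  | empty : WfMCtx T Θ → WfVCtx T Θ []
  | extend {Γ : VCtx S} {a : Name} {A : Expr S} :
      WfVCtx T Θ Γ → Derives T Θ Γ (.jdg (.base (.isTy A))) → a ∉ Γ.map Prod.fst →
      WfVCtx T Θ (Γ ++ [(a, A)])

/-- A finitary type theory is a raw type theory `T` each of whose specific rules `Ξ ⟹ b[e]` is
finitary with respect to `T`: `⊢ Ξ mctx` and `Ξ; [] ⊢ b` are derivable. -/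
def RawTypeTheory.IsFinitary (T : RawTypeTheory.{u, v} S) : Prop :=
  ∀ r : T.Idx, WfMCtx T (T.rule r).mctx ∧
    Derives T (T.rule r).mctx [] (.bdr (.base (T.rule r).bdry))

/-- The instantiation `I` of `Ξ` over `Θ; Γ` is derivable. -/
def Inst.IsDerivable (I : Inst S) (T : RawTypeTheory.{u, v} S) (Ξ Θ : MCtx S) (Γ : VCtx S) :
    Prop :=
  ∀ (k : ℕ) (M N : MVar) (B : Bdry S) (e : Expr S),
    Ξ[k]? = some (M, B) → I[k]? = some (N, e) →
    Derives T Θ Γ (.jdg (plug (actB (I.take k) B) e))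

/-- The instantiations `I` and `J` of `Ξ` over `Θ; Γ` are judgementally equal. -/
def Inst.JudgEq (I J : Inst S) (T : RawTypeTheory.{u, v} S) (Ξ Θ : MCtx S) (Γ : VCtx S) : Prop :=
  ∀ (k : ℕ) (M N N' : MVar) (B : Bdry S) (e f : Expr S),
    Ξ[k]? = some (M, B) → I[k]? = some (N, e) → J[k]? = some (N', f) →
    B.body.cls.IsObject →
    Derives T Θ Γ (.jdg (plugEq (actB (I.take k) B) e f))

end FTT

namespace FTT
variable {S : Signature.{u}}

/-! ### Calculus of substitutions -/

/-! The arguments of `J` are treated in order. Suppose `J_(k)` is already derivable. Since `Ξ` is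
well formed, the boundary `ℬ_k` is derivable over the entries before it, so every type and term in
it is the subject of a derivable object judgement. Judgementally equal derivable instantiations send
such judgements to equations (`Derives.eqInstantiate`). Hence the constituents of `I_(k)* ℬ_k` and
`J_(k)* ℬ_k` are pairwise equal, and `(I_(k)* ℬ_k)[e ≡ f]` can be converted to `(J_(k)* ℬ_k)[f]`
(`Derives.plug_conv`). For `□ type` and `□ : A` the right-hand side `f` is extracted by
presuppositivity (`Derives.presup`) and converted. For an equality boundary, the equation known for
`I` is composed with the equations between the images of its two sides. Abstractions are opened at a
fresh variable.

The main work is the statement on judgementally equal instantiations. The metavariable case compares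
`e[I_* t]` with `f[J_* t]` through `e[J_* t]`. One half is substitution of equal terms into the
derivable `e`, the other is substitution into `e ≡ f`. So a substitution theory must come first, in
a forced order: renaming, which gives weakening; substitution, whose passage under binders needs
weakening; equality of substitutions; instantiation, whose metavariable congruence case needs equal
substitutions; equality of instantiations.

To avoid repeating the induction on derivations, an instantiation and a free-variable substitution
act together, as `Expr.inst I σ`. Two generic inductions, `Derives.morph` for one morphism and
`Derives.eqMorph` for a pair, delegate to a kit only what depends on the class of morphisms:
variables, metavariables and extension under a binder. Specific rules need no further input, because
instantiations compose and every object rule comes with its congruence rule. -/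

theorem liftSubst_bvar_comp (ρ : ℕ → ℕ) :
    liftSubst (fun i => (.bvar (ρ i) : Expr S)) = fun i => .bvar (liftRen ρ i) := by
  funext i; cases i <;> rfl

theorem Expr.rename_eq_subst (e : Expr S) : ∀ ρ : ℕ → ℕ,
    e.rename ρ = e.subst fun i => .bvar (ρ i) := by
  induction e with
  | abstr e ih => intro ρ; simp [rename, subst, ih, liftSubst_bvar_comp]
  | _ => intro ρ; simp_all [rename, subst]

theorem Expr.subst_bvar (e : Expr S) : e.subst Expr.bvar = e := by
  induction e with
  | abstr e ih =>
    have : liftSubst (.bvar : ℕ → Expr S) = .bvar := by funext i; cases i <;> rfl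
    simp [subst, this, ih]
  | _ => simp_all [subst]

theorem Expr.subst_rename (e : Expr S) : ∀ (ρ : ℕ → ℕ) (σ : ℕ → Expr S),
    (e.rename ρ).subst σ = e.subst fun i => σ (ρ i) := by
  induction e with
  | abstr e ih =>
    intro ρ σ
    simp only [rename, subst, ih]
    congr 2; funext i; cases i <;> rfl
  | _ => intro ρ σ; simp_all [rename, subst]

theorem Expr.rename_rename (e : Expr S) (ρ ρ' : ℕ → ℕ) :
    (e.rename ρ).rename ρ' = e.rename fun i => ρ' (ρ i) := by
  rw [rename_eq_subst, subst_rename, rename_eq_subst]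

theorem Expr.rename_subst (e : Expr S) : ∀ (σ : ℕ → Expr S) (ρ : ℕ → ℕ),
    (e.subst σ).rename ρ = e.subst fun i => (σ i).rename ρ := by
  induction e with
  | abstr e ih =>
    intro σ ρ
    simp only [rename, subst, ih]
    congr 2; funext i; cases i with
    | zero => rfl
    | succ i => simp [liftSubst, rename_rename, liftRen]
  | _ => intro ρ σ; simp_all [rename, subst]

theorem Expr.subst_subst (e : Expr S) : ∀ σ τ : ℕ → Expr S,
    (e.subst σ).subst τ = e.subst fun i => (σ i).subst τ := by
  induction e with
  | abstr e ih =>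
    intro σ τ
    simp only [subst, ih]
    congr 2; funext i; cases i with
    | zero => rfl
    | succ i => simp [liftSubst, subst_rename, rename_subst]
  | _ => intro σ τ; simp_all [subst]

/-- All free indices of the expression are below `k`. -/
def Expr.Closed : ℕ → Expr S → Prop
  | _, .fvar _ => True
  | k, .bvar i => i < k
  | k, .symApp _ es => ∀ i, (es i).Closed k
  | k, .metaApp _ _ ts => ∀ i, (ts i).Closed k
  | _, .starTy => True
  | _, .starTm => True
  | k, .abstr e => e.Closed (k + 1)

theorem Expr.closed_fvar (a : Name) : (Expr.fvar a : Expr S).Closed 0 := trivial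

theorem liftSubst_agree {k : ℕ} {σ τ : ℕ → Expr S} (h : ∀ i < k, σ i = τ i) :
    ∀ i < k + 1, liftSubst σ i = liftSubst τ i := by
  intro i hi
  cases i with
  | zero => rfl
  | succ i => simp [liftSubst, h i (by omega)]

theorem Expr.Closed.subst_congr {e : Expr S} : ∀ {k : ℕ} {σ τ : ℕ → Expr S},
    e.Closed k → (∀ i < k, σ i = τ i) → e.subst σ = e.subst τ := by
  induction e with
  | abstr e ih =>
    intro k σ τ hc h
    simp only [subst]
    rw [ih hc (liftSubst_agree h)]
  | bvar i => intro k σ τ hc h; exact h i hc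
  | _ => intro k σ τ hc h; simp_all [Closed, subst] <;> (funext i; solve_by_elim)

theorem Expr.Closed.subst_eq {e : Expr S} (h : e.Closed 0) (σ : ℕ → Expr S) :
    e.subst σ = e := by
  rw [h.subst_congr (τ := Expr.bvar) (by simp), subst_bvar]

theorem Expr.Closed.rename_eq {e : Expr S} (h : e.Closed 0) (ρ : ℕ → ℕ) :
    e.rename ρ = e := by
  rw [rename_eq_subst, h.subst_eq]

theorem Expr.stripAbs_of_ne {e : Expr S} (h : ∀ e', e ≠ .abstr e') (n : ℕ) :
    e.stripAbs n = e := by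
  cases n with
  | zero => simp [stripAbs]
  | succ n =>
    cases e with
    | abstr e => exact absurd rfl (h e)
    | _ => simp [stripAbs]

theorem Expr.Closed.mono {e : Expr S} : ∀ {k l : ℕ}, e.Closed k → k ≤ l → e.Closed l := by
  induction e with
  | abstr e ih => intro k l h hk; exact ih h (by omega)
  | bvar i => intro k l h hk; exact lt_of_lt_of_le h hk
  | _ => intro k l h hk; simp_all [Closed] <;> (intro i; solve_by_elim)

theorem Expr.Closed.stripAbs (n : ℕ) : ∀ {e : Expr S} {k : ℕ},
    e.Closed k → (e.stripAbs n).Closed (k + n) := by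
  induction n with
  | zero => intro e k h; simpa [Expr.stripAbs] using h
  | succ n ih =>
    intro e k h
    by_cases he : ∃ e', e = .abstr e'
    · obtain ⟨e, rfl⟩ := he
      have := ih (e := e) (k := k + 1) h
      simpa [Expr.stripAbs, Nat.add_assoc, Nat.add_comm 1] using this
    · push Not at he
      rw [stripAbs_of_ne he]; exact h.mono (by omega)

theorem Expr.Valid.closed {Θ : MCtx S} {Γ : VCtx S} {k : ℕ} {e : Expr S} {ar : SynClass × ℕ}
    (h : e.Valid Θ Γ k ar) : e.Closed k := by
  induction h <;> simp_all [Expr.Closed]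

theorem vecSubst_lt {n : ℕ} (ts : Fin n → Expr S) {i : ℕ} (h : i < n) :
    vecSubst n ts i = ts (Fin.rev ⟨i, h⟩) := by simp [vecSubst, h]

/-- The environment sending the `n` innermost indices to `t (n - 1), …, t 0`. -/
def env (t : ℕ → Expr S) (n : ℕ) : ℕ → Expr S := fun i =>
  if i < n then t (n - 1 - i) else .bvar (i - n)

/-- Extension of a vector to a sequence. -/
def ofVec {n : ℕ} (ts : Fin n → Expr S) : ℕ → Expr S := fun i =>
  if h : i < n then ts ⟨i, h⟩ else .bvar 0

theorem ofVec_lt {n : ℕ} (ts : Fin n → Expr S) {i : ℕ} (h : i < n) :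
    ofVec ts i = ts ⟨i, h⟩ := by simp [ofVec, h]

/-- Environments are indexed by sequences so that the prefixes of one argument list, which type the
successive entries of a telescope, need no casts between `Fin` types. -/
theorem vecSubst_eq_env {n : ℕ} (ts : Fin n → Expr S) (s : ℕ → Expr S)
    (h : ∀ i : Fin n, ts i = s i) : vecSubst n ts = env s n := by
  funext i
  unfold vecSubst env
  split_ifs with hi
  · rw [h]; congr 1; simp [Fin.rev]; omega
  · rfl

theorem vecSubst_ofVec {n : ℕ} (ts : Fin n → Expr S) : vecSubst n ts = env (ofVec ts) n :=
  vecSubst_eq_env _ _ fun i => by simp [ofVec]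

theorem vecSubst_castLE {n : ℕ} (ts : Fin n → Expr S) (j : Fin n) :
    vecSubst j (fun i : Fin j => ts (i.castLE j.isLt.le)) = env (ofVec ts) j :=
  vecSubst_eq_env _ _ fun i => by
    rw [ofVec_lt _ (i.isLt.trans j.isLt)]; rfl

theorem env_zero (t : ℕ → Expr S) : env t 0 = Expr.bvar := by
  funext i; simp [env]

theorem env_congr {t t' : ℕ → Expr S} {n : ℕ} (h : ∀ i < n, t i = t' i) : env t n = env t' n := by
  funext i; unfold env; split_ifs with hi
  · exact h _ (by omega)
  · rfl

theorem vecSubst_one_succ (t : Expr S) (i : ℕ) : vecSubst 1 (fun _ => t) (i + 1) = .bvar i := by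
  simp [vecSubst]

theorem liftSubst_open (σ : ℕ → Expr S) (t : Expr S) (i : ℕ) :
    (liftSubst σ i).subst (vecSubst 1 fun _ => t) = if i = 0 then t else σ (i - 1) := by
  cases i with
  | zero => rfl
  | succ i =>
    simp only [liftSubst, Expr.subst_rename, Nat.succ_eq_add_one, vecSubst_one_succ]
    simp [Expr.subst_bvar]

/-- This is the inductive step that turns simultaneous substitution for a telescope into
substitution for one binder at a time: the newly opened index receives `t n`, and the older ones
move up by one. -/
theorem liftSubst_env_open (t : ℕ → Expr S) (n i : ℕ) :
    (liftSubst (env t n) i).subst (vecSubst 1 fun _ => t n) = env t (n + 1) i := by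
  rw [liftSubst_open]
  cases i with
  | zero => simp [env]
  | succ i =>
    simp only [env]
    simp only [Nat.add_eq_zero_iff, one_ne_zero, and_false, if_false, Nat.add_sub_cancel,
      Nat.add_lt_add_iff_right]
    split_ifs with h
    · congr 1; omega
    · congr 1; omega

/-! ### Maps of theses, judgements and boundaries -/

/-- Apply functions to the types and the thesis of an abstracted thesis. -/
def Abs.bimap {X Y : Type u} (f : Expr S → Expr S) (g : X → Y) : Abs S X → Abs S Y
  | .base x => .base (g x)
  | .abstr A J => .abstr (f A) (J.bimap f g)

abbrev mapJ (f : Expr S → Expr S) : Judg S → Judg S := Abs.bimap f (JThesis.map f)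

abbrev mapB (f : Expr S → Expr S) : Bdry S → Bdry S := Abs.bimap f (BThesis.map f)

def Stmt.map (f : Expr S → Expr S) : Stmt S → Stmt S
  | .jdg J => .jdg (mapJ f J)
  | .bdr B => .bdr (mapB f B)

theorem Abs.tele_bimap {X Y : Type u} (f : Expr S → Expr S) (g : X → Y) (J : Abs S X) :
    (J.bimap f g).tele = J.tele.map f := by
  induction J <;> simp_all [bimap, tele]

theorem Abs.body_bimap {X Y : Type u} (f : Expr S → Expr S) (g : X → Y) (J : Abs S X) :
    (J.bimap f g).body = g J.body := by
  induction J <;> simp_all [bimap, body]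

theorem JThesis.map_map (f g : Expr S → Expr S) (j : JThesis S) :
    (j.map f).map g = j.map fun e => g (f e) := by cases j <;> rfl

theorem BThesis.map_map (f g : Expr S → Expr S) (b : BThesis S) :
    (b.map f).map g = b.map fun e => g (f e) := by cases b <;> rfl

theorem BThesis.cls_map (f : Expr S → Expr S) (b : BThesis S) : (b.map f).cls = b.cls := by
  cases b <;> rfl

theorem BThesis.map_plug (f : Expr S → Expr S) (b : BThesis S) (e : Expr S) :
    (b.plug e).map f = (b.map f).plug (f e) := by cases b <;> rfl

theorem BThesis.map_plugEq (f : Expr S → Expr S) (b : BThesis S) (e e' : Expr S) :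
    (b.plugEq e e').map f = (b.map f).plugEq (f e) (f e') := by cases b <;> rfl

theorem substJ_substJ (J : Judg S) : ∀ σ τ : ℕ → Expr S,
    substJ τ (substJ σ J) = substJ (fun i => (σ i).subst τ) J := by
  induction J with
  | base j => intro σ τ; simp [substJ, JThesis.map_map, Expr.subst_subst]
  | abstr A J ih =>
    intro σ τ
    simp only [substJ, ih, Expr.subst_subst]
    congr 2; funext i; cases i with
    | zero => rfl
    | succ i => simp [liftSubst, Expr.subst_rename, Expr.rename_subst]

theorem substJ_bvar (J : Judg S) : substJ Expr.bvar J = J := by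
  have h : liftSubst (.bvar : ℕ → Expr S) = .bvar := by funext i; cases i <;> rfl
  induction J with
  | base j => cases j <;> simp [substJ, JThesis.map, Expr.subst_bvar]
  | abstr A J ih => simp [substJ, h, ih, Expr.subst_bvar]

theorem substJ_env_open (t : ℕ → Expr S) (n : ℕ) (J : Judg S) :
    substJ (vecSubst 1 fun _ => t n) (substJ (liftSubst (env t n)) J) = substJ (env t (n + 1)) J := by
  rw [substJ_substJ]; congr 1; funext i; exact liftSubst_env_open t n i

theorem length_tele_substB (B : Bdry S) : ∀ σ : ℕ → Expr S,
    (substB σ B).tele.length = B.tele.length := by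
  induction B <;> intro σ <;> simp_all [substB, Abs.tele]

theorem tele_plug (B : Bdry S) : ∀ e : Expr S, (plug B e).tele = B.tele := by
  induction B with
  | base b => intro e; rfl
  | abstr A B ih => intro e; cases e <;> simp [plug, Abs.tele, ih]

/-- No validity is needed: on an argument with too few abstractions, both `plug` and `stripAbs`
leave the remainder untouched. -/
theorem body_plug (B : Bdry S) : ∀ e : Expr S,
    (plug B e).body = B.body.plug (e.stripAbs B.tele.length) := by
  induction B with
  | base b => intro e; simp [plug, Abs.body, Abs.tele, Expr.stripAbs]
  | abstr A B ih =>
    intro e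
    cases e with
    | abstr e => simp [plug, Abs.body, Abs.tele, ih, Expr.stripAbs]
    | _ => simp [plug, Abs.body, Abs.tele, ih, Expr.stripAbs_of_ne]

theorem tele_plugEq (B : Bdry S) : ∀ e e' : Expr S, (plugEq B e e').tele = B.tele := by
  induction B with
  | base b => intro e e'; rfl
  | abstr A B ih => intro e e'; cases e <;> cases e' <;> simp [plugEq, Abs.tele, ih]

theorem Expr.Valid.eq_abstr {Θ : MCtx S} {Γ : VCtx S} {k : ℕ} {e : Expr S} {c : SynClass} {n : ℕ}
    (h : e.Valid Θ Γ k (c, n + 1)) : ∃ e', e = .abstr e' ∧ e'.Valid Θ Γ (k + 1) (c, n) := by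
  cases h with
  | abstr h => exact ⟨_, rfl, h⟩

theorem Expr.Valid.stripAbs {Θ : MCtx S} {Γ : VCtx S} {c : SynClass} (n : ℕ) :
    ∀ {k : ℕ} {e : Expr S}, e.Valid Θ Γ k (c, n) → (e.stripAbs n).Valid Θ Γ (k + n) (c, 0) := by
  induction n with
  | zero => intro k e h; simpa [Expr.stripAbs] using h
  | succ n ih =>
    intro k e h
    obtain ⟨e, rfl, h1⟩ := h.eq_abstr
    simpa [Expr.stripAbs, Nat.add_assoc, Nat.add_comm 1] using ih h1

/-- Here validity matters. If only one of the two arguments were an abstraction, `plugEq` would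
strip neither of them, whereas `stripAbs` acts on each separately. -/
theorem body_plugEq {Θ : MCtx S} {Γ : VCtx S} {c c' : SynClass} (B : Bdry S) :
    ∀ {k : ℕ} {e e' : Expr S}, e.Valid Θ Γ k (c, B.tele.length) →
      e'.Valid Θ Γ k (c', B.tele.length) →
      (plugEq B e e').body =
        B.body.plugEq (e.stripAbs B.tele.length) (e'.stripAbs B.tele.length) := by
  induction B with
  | base b => intro k e e' _ _; simp [plugEq, Abs.body, Abs.tele, Expr.stripAbs]
  | abstr A B ih =>
    intro k e e' he he'
    obtain ⟨e, rfl, h1⟩ := he.eq_abstr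
    obtain ⟨e', rfl, h1'⟩ := he'.eq_abstr
    simp [plugEq, Abs.body, Abs.tele, ih h1 h1', Expr.stripAbs]

/-! ### Instantiation of metavariables and free variables -/

/-- Simultaneous action of an instantiation and of a substitution of free variables. -/
def Expr.inst (I : Inst S) (σ : Name → Expr S) : Expr S → Expr S
  | .fvar a => σ a
  | .bvar i => .bvar i
  | .symApp s es => .symApp s fun i => (es i).inst I σ
  | .metaApp M n ts =>
      match I.lookup M with
      | some e => (e.stripAbs n).subst (vecSubst n fun i => (ts i).inst I σ)
      | none => .metaApp M n fun i => (ts i).inst I σ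
  | .starTy => .starTy
  | .starTm => .starTm
  | .abstr e => .abstr (e.inst I σ)

theorem Expr.inst_metaApp_some {I : Inst S} {M : MVar} {e : Expr S} (h : I.lookup M = some e)
    (σ : Name → Expr S) (n : ℕ) (ts : Fin n → Expr S) :
    (Expr.metaApp M n ts).inst I σ =
      (e.stripAbs n).subst (vecSubst n fun i => (ts i).inst I σ) := by
  simp [inst, h]

theorem Expr.inst_metaApp_none {I : Inst S} {M : MVar} (h : I.lookup M = none)
    (σ : Name → Expr S) (n : ℕ) (ts : Fin n → Expr S) :
    (Expr.metaApp M n ts).inst I σ = .metaApp M n fun i => (ts i).inst I σ := by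
  simp [inst, h]

theorem Expr.act_eq_inst (I : Inst S) (e : Expr S) : e.act I = e.inst I .fvar := by
  induction e with
  | metaApp M n ts ih => cases h : I.lookup M <;> simp [act, inst, ih, h]
  | _ => simp_all [act, inst]

theorem Expr.act_eq_inst' (I : Inst S) : Expr.act I = Expr.inst I .fvar :=
  funext (act_eq_inst I)

theorem actB_eq_mapB (I : Inst S) (B : Bdry S) : actB I B = mapB (Expr.act I) B := by
  induction B with
  | base b => rfl
  | abstr A B ih => simp [actB, Abs.bimap, ih]

theorem Expr.inst_nil_fvar (e : Expr S) : e.inst [] .fvar = e := by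
  induction e <;> simp_all [inst]

/-- Values without dangling indices are what makes it correct for `Expr.inst` to pass under binders
without shifting. -/
structure ClosedMor (I : Inst S) (σ : Name → Expr S) : Prop where
  inst : ∀ M e, I.lookup M = some e → e.Closed 0
  var : ∀ a, (σ a).Closed 0

theorem ClosedMor.inst_rename {I : Inst S} {σ : Name → Expr S} (h : ClosedMor I σ) (e : Expr S) :
    ∀ ρ : ℕ → ℕ, (e.rename ρ).inst I σ = (e.inst I σ).rename ρ := by
  induction e with
  | fvar a => intro ρ; simp [Expr.rename, Expr.inst, (h.var a).rename_eq]
  | metaApp M n ts ih =>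
    intro ρ
    cases hM : I.lookup M with
    | none => simp [Expr.rename, Expr.inst_metaApp_none hM, ih]
    | some e =>
      simp only [Expr.rename, Expr.inst_metaApp_some hM, ih, Expr.rename_subst]
      refine (by simpa using (h.inst M e hM).stripAbs n : (e.stripAbs n).Closed n).subst_congr ?_
      intro i hi
      simp [vecSubst_lt _ hi]
  | _ => intro ρ; simp_all [Expr.rename, Expr.inst]

/-- Free variables and metavariables have closed values, on which `τ` does nothing; `τ` is therefore
felt only at the bound variables and in the arguments of metavariables. -/
theorem ClosedMor.inst_subst {I : Inst S} {σ : Name → Expr S} (h : ClosedMor I σ) (e : Expr S) :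
    ∀ τ : ℕ → Expr S,
      (e.subst τ).inst I σ = (e.inst I σ).subst fun i => (τ i).inst I σ := by
  induction e with
  | fvar a => intro ρ; simp [Expr.subst, Expr.inst, (h.var a).subst_eq]
  | metaApp M n ts ih =>
    intro τ
    cases hM : I.lookup M with
    | none => simp [Expr.subst, Expr.inst_metaApp_none hM, ih]
    | some e =>
      simp only [Expr.subst, Expr.inst_metaApp_some hM, ih, Expr.subst_subst]
      -- The body of a closed argument has at most `n` dangling indices. The two composite
      -- substitutions need only agree below `n`, where both give the instantiated arguments.
      refine (by simpa using (h.inst M e hM).stripAbs n : (e.stripAbs n).Closed n).subst_congr ?_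
      intro i hi
      simp [vecSubst_lt _ hi]
  | abstr e ih =>
    intro τ
    simp only [Expr.subst, Expr.inst, ih]
    congr 2; funext i; cases i with
    | zero => rfl
    | succ i => simp [liftSubst, h.inst_rename]
  | _ => intro ρ; simp_all [Expr.subst, Expr.inst]

theorem ClosedMor.inst_vecSubst {I : Inst S} {σ : Name → Expr S} (n : ℕ) (ts : Fin n → Expr S)
    (i : ℕ) : (vecSubst n ts i).inst I σ = vecSubst n (fun j => (ts j).inst I σ) i := by
  unfold vecSubst; split_ifs <;> rfl

theorem ClosedMor.inst_env {I : Inst S} {σ : Name → Expr S} (n : ℕ) (ts : ℕ → Expr S)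
    (i : ℕ) : (env ts n i).inst I σ = env (fun j => (ts j).inst I σ) n i := by
  unfold env; split_ifs <;> rfl

theorem ClosedMor.liftSubst_inst {I : Inst S} {σ : Name → Expr S} (h : ClosedMor I σ)
    (τ : ℕ → Expr S) :
    (fun i => (liftSubst τ i).inst I σ) = liftSubst fun i => (τ i).inst I σ := by
  funext i; cases i with
  | zero => rfl
  | succ i => simp [liftSubst, h.inst_rename]

theorem ClosedMor.mapJ_substJ {I : Inst S} {σ : Name → Expr S} (h : ClosedMor I σ) (J : Judg S) :
    ∀ τ : ℕ → Expr S, mapJ (Expr.inst I σ) (substJ τ J) =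
      substJ (fun i => (τ i).inst I σ) (mapJ (Expr.inst I σ) J) := by
  induction J with
  | base j => intro τ; simp [Abs.bimap, substJ, JThesis.map_map, h.inst_subst]
  | abstr A J ih => intro τ; simp_all [Abs.bimap, substJ, h.inst_subst, h.liftSubst_inst]

theorem ClosedMor.mapB_substB {I : Inst S} {σ : Name → Expr S} (h : ClosedMor I σ) (J : Bdry S) :
    ∀ τ : ℕ → Expr S, mapB (Expr.inst I σ) (substB τ J) =
      substB (fun i => (τ i).inst I σ) (mapB (Expr.inst I σ) J) := by
  induction J with
  | base j => intro τ; simp [Abs.bimap, substB, BThesis.map_map, h.inst_subst]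
  | abstr A J ih => intro τ; simp_all [Abs.bimap, substB, h.inst_subst, h.liftSubst_inst]

/-! ### Validity -/

theorem Expr.Valid.mono {Θ Θ' : MCtx S} {Γ Γ' : VCtx S} {k : ℕ} {e : Expr S} {ar : SynClass × ℕ}
    (h : e.Valid Θ Γ k ar) (hΘ : ∀ M B, (M, B) ∈ Θ → (M, B) ∈ Θ')
    (hΓ : ∀ a ∈ Γ.map Prod.fst, a ∈ Γ'.map Prod.fst) : e.Valid Θ' Γ' k ar := by
  induction h with
  | fvar h => exact .fvar (hΓ _ h)
  | bvar h => exact .bvar h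
  | symApp _ ih => exact .symApp ih
  | metaApp h ho hn _ ih => exact .metaApp (hΘ _ _ h) ho hn ih
  | starTy => exact .starTy
  | starTm => exact .starTm
  | abstr _ ih => exact .abstr ih

theorem Expr.Valid.rename {Θ : MCtx S} {Γ : VCtx S} {k : ℕ} {e : Expr S} {ar : SynClass × ℕ}
    (h : e.Valid Θ Γ k ar) : ∀ {l : ℕ} {ρ : ℕ → ℕ}, (∀ i < k, ρ i < l) →
      (e.rename ρ).Valid Θ Γ l ar := by
  induction h with
  | fvar h => intro l ρ hρ; exact .fvar h
  | bvar h => intro l ρ hρ; exact .bvar (hρ _ h)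
  | symApp _ ih => intro l ρ hρ; exact .symApp fun i => ih i hρ
  | metaApp h ho hn _ ih => intro l ρ hρ; exact .metaApp h ho hn fun i => ih i hρ
  | starTy => intro l ρ hρ; exact .starTy
  | starTm => intro l ρ hρ; exact .starTm
  | abstr _ ih =>
    intro l ρ hρ
    refine .abstr (ih fun i hi => ?_)
    cases i with
    | zero => simp [liftRen]
    | succ i => have := hρ i (by omega); simp [liftRen, this]

theorem liftSubst_valid {Θ : MCtx S} {Γ : VCtx S} {k l : ℕ} {τ : ℕ → Expr S}
    (hτ : ∀ i < k, (τ i).Valid Θ Γ l (.tm, 0)) :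
    ∀ i < k + 1, (liftSubst τ i).Valid Θ Γ (l + 1) (.tm, 0) := by
  intro i hi
  cases i with
  | zero => exact .bvar (by omega)
  | succ i => exact (hτ i (by omega)).rename (by simp)

theorem Expr.Valid.subst {Θ : MCtx S} {Γ : VCtx S} {k : ℕ} {e : Expr S} {ar : SynClass × ℕ}
    (h : e.Valid Θ Γ k ar) : ∀ {l : ℕ} {τ : ℕ → Expr S},
      (∀ i < k, (τ i).Valid Θ Γ l (.tm, 0)) → (e.subst τ).Valid Θ Γ l ar := by
  induction h with
  | fvar h => intro l ρ hρ; exact .fvar h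
  | bvar h => intro l ρ hρ; exact hρ _ h
  | symApp _ ih => intro l ρ hρ; exact .symApp fun i => ih i hρ
  | metaApp h ho hn _ ih => intro l ρ hρ; exact .metaApp h ho hn fun i => ih i hρ
  | starTy => intro l ρ hρ; exact .starTy
  | starTm => intro l ρ hρ; exact .starTm
  | abstr _ ih => intro l ρ hρ; exact .abstr (ih (liftSubst_valid hρ))

/-- Syntactic validity of the action of `I` and `σ` as a map from `Ξ; Γ` to `Θ; Δ`. -/
structure IsMor (I : Inst S) (Ξ Θ : MCtx S) (σ : Name → Expr S) (Γ Δ : VCtx S) : Prop where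
  mctx : ValidMCtx Θ
  vctx : ValidVCtx Θ Δ
  closed : ClosedMor I σ
  var : ∀ a ∈ Γ.map Prod.fst, (σ a).Valid Θ Δ 0 (.tm, 0)
  meta_ : ∀ M B, (M, B) ∈ Ξ → (I.lookup M = none ∧ (M, B) ∈ Θ) ∨
    ∃ e, I.lookup M = some e ∧ e.Valid Θ Δ 0 (arityB B)

theorem Expr.Valid.mono_depth {Θ : MCtx S} {Γ : VCtx S} {k l : ℕ} {e : Expr S} {ar : SynClass × ℕ}
    (h : e.Valid Θ Γ k ar) (hk : k ≤ l) : e.Valid Θ Γ l ar := by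
  rw [← e.subst_bvar]
  exact h.subst fun i hi => .bvar (by omega)

theorem IsMor.valid_inst {I : Inst S} {Ξ Θ : MCtx S} {σ : Name → Expr S} {Γ Δ : VCtx S}
    (h : IsMor I Ξ Θ σ Γ Δ) {k : ℕ} {e : Expr S} {ar : SynClass × ℕ} (he : e.Valid Ξ Γ k ar) :
    (e.inst I σ).Valid Θ Δ k ar := by
  induction he with
  | fvar ha => exact (h.var _ ha).mono_depth (by omega)
  | bvar h => exact .bvar h
  | symApp _ ih => exact .symApp ih
  | metaApp hM ho hn _ ih =>
    rcases h.meta_ _ _ hM with ⟨hl, hM'⟩ | ⟨e, hl, hv⟩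
    · rw [Expr.inst_metaApp_none hl]; exact .metaApp hM' ho hn ih
    · rw [Expr.inst_metaApp_some hl]
      subst hn
      have := hv.stripAbs
      simp only [Nat.zero_add] at this
      exact this.subst fun i hi => by rw [vecSubst_lt _ hi]; exact ih _
  | starTy => exact .starTy
  | starTm => exact .starTm
  | abstr _ ih => exact .abstr ih

theorem JThesis.Valid.map {f : Expr S → Expr S} {Θ Θ' : MCtx S} {Γ Γ' : VCtx S} {k k' : ℕ}
    (hf : ∀ e ar, e.Valid Θ Γ k ar → (f e).Valid Θ' Γ' k' ar) {j : JThesis S}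
    (h : j.Valid Θ Γ k) : (j.map f).Valid Θ' Γ' k' := by
  cases j <;> simp only [JThesis.Valid, JThesis.map] at * <;> grind

theorem BThesis.Valid.map {f : Expr S → Expr S} {Θ Θ' : MCtx S} {Γ Γ' : VCtx S} {k k' : ℕ}
    (hf : ∀ e ar, e.Valid Θ Γ k ar → (f e).Valid Θ' Γ' k' ar) {j : BThesis S}
    (h : j.Valid Θ Γ k) : (j.map f).Valid Θ' Γ' k' := by
  cases j <;> simp only [BThesis.Valid, BThesis.map] at * <;> grind

theorem ValidJ.map {f : Expr S → Expr S} {Θ Θ' : MCtx S} {Γ Γ' : VCtx S}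
    (hf : ∀ k e ar, e.Valid Θ Γ k ar → (f e).Valid Θ' Γ' k ar) {J : Judg S} :
    ∀ {k : ℕ}, ValidJ Θ Γ k J → ValidJ Θ' Γ' k (mapJ f J) := by
  induction J with
  | base j => intro k h; exact JThesis.Valid.map (hf k) h
  | abstr A J ih => intro k h; exact ⟨hf _ _ _ h.1, ih h.2⟩

theorem ValidB.map {f : Expr S → Expr S} {Θ Θ' : MCtx S} {Γ Γ' : VCtx S}
    (hf : ∀ k e ar, e.Valid Θ Γ k ar → (f e).Valid Θ' Γ' k ar) {J : Bdry S} :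
    ∀ {k : ℕ}, ValidB Θ Γ k J → ValidB Θ' Γ' k (mapB f J) := by
  induction J with
  | base j => intro k h; exact BThesis.Valid.map (hf k) h
  | abstr A J ih => intro k h; exact ⟨hf _ _ _ h.1, ih h.2⟩

theorem IsMor.validHyp {I : Inst S} {Ξ Θ : MCtx S} {σ : Name → Expr S} {Γ Δ : VCtx S}
    (h : IsMor I Ξ Θ σ Γ Δ) {X : Stmt S} (hX : ValidHyp Ξ Γ X) :
    ValidHyp Θ Δ (X.map (Expr.inst I σ)) := by
  refine ⟨h.mctx, h.vctx, ?_⟩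
  have := hX.2.2
  cases X with
  | jdg J => exact ValidJ.map (fun _ _ _ => h.valid_inst) this
  | bdr B => exact ValidB.map (fun _ _ _ => h.valid_inst) this

theorem JThesis.Valid.map_congr {f g : Expr S → Expr S} {Θ : MCtx S} {Γ : VCtx S} {k : ℕ}
    (hf : ∀ e ar, e.Valid Θ Γ k ar → f e = g e) {j : JThesis S}
    (h : j.Valid Θ Γ k) : j.map f = j.map g := by
  cases j <;> simp only [JThesis.Valid, JThesis.map] at * <;> grind

theorem BThesis.Valid.map_congr {f g : Expr S → Expr S} {Θ : MCtx S} {Γ : VCtx S} {k : ℕ}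
    (hf : ∀ e ar, e.Valid Θ Γ k ar → f e = g e) {j : BThesis S}
    (h : j.Valid Θ Γ k) : j.map f = j.map g := by
  cases j <;> simp only [BThesis.Valid, BThesis.map] at * <;> grind

theorem ValidJ.map_congr {f g : Expr S → Expr S} {Θ : MCtx S} {Γ : VCtx S}
    (hf : ∀ k e ar, e.Valid Θ Γ k ar → f e = g e) {J : Judg S} :
    ∀ {k : ℕ}, ValidJ Θ Γ k J → mapJ f J = mapJ g J := by
  induction J with
  | base j => intro k h; simp [Abs.bimap, JThesis.Valid.map_congr (hf k) h]
  | abstr A J ih => intro k h; simp [Abs.bimap, hf _ _ _ h.1]; exact ih h.2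

theorem ValidB.map_congr {f g : Expr S → Expr S} {Θ : MCtx S} {Γ : VCtx S}
    (hf : ∀ k e ar, e.Valid Θ Γ k ar → f e = g e) {J : Bdry S} :
    ∀ {k : ℕ}, ValidB Θ Γ k J → mapB f J = mapB g J := by
  induction J with
  | base j => intro k h; simp [Abs.bimap, BThesis.Valid.map_congr (hf k) h]
  | abstr A J ih => intro k h; simp [Abs.bimap, hf _ _ _ h.1]; exact ih h.2

theorem Expr.Valid.inst_congr {I I' : Inst S} {σ σ' : Name → Expr S} {Ξ : MCtx S} {Γ : VCtx S}
    (hσ : ∀ a ∈ Γ.map Prod.fst, σ a = σ' a)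
    (hI : ∀ M ∈ Ξ.map Prod.fst, I.lookup M = I'.lookup M) {k : ℕ} {e : Expr S}
    {ar : SynClass × ℕ} (he : e.Valid Ξ Γ k ar) : e.inst I σ = e.inst I' σ' := by
  induction he with
  | fvar ha => exact hσ _ ha
  | metaApp hM ho hn _ ih =>
    have := hI _ (List.mem_map_of_mem hM)
    simp only [Expr.inst, this, ih]
  | _ => simp_all [Expr.inst]

/-- Apply a function to the arguments of an instantiation. -/
def Inst.mapArg (f : Expr S → Expr S) (I : Inst S) : Inst S := I.map fun p => (p.1, f p.2)

theorem Inst.lookup_mapArg (f : Expr S → Expr S) (I : Inst S) (M : MVar) :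
    (I.mapArg f).lookup M = (I.lookup M).map f := by
  induction I with
  | nil => rfl
  | cons p I ih =>
    obtain ⟨N, e⟩ := p
    simp only [mapArg, List.map_cons, List.lookup_cons] at *
    split <;> simp_all

theorem Inst.take_mapArg (f : Expr S → Expr S) (I : Inst S) (i : ℕ) :
    (I.mapArg f).take i = Inst.mapArg f (I.take i) := by
  simp [mapArg]

theorem Inst.getElem?_mapArg {f : Expr S → Expr S} {I : Inst S} {i : ℕ} {N : MVar} {e : Expr S}
    (h : (I.mapArg f)[i]? = some (N, e)) : ∃ e', I[i]? = some (N, e') ∧ e = f e' := by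
  simp only [mapArg, List.getElem?_map, Option.map_eq_some_iff] at h
  obtain ⟨⟨N', e'⟩, h1, h2⟩ := h
  simp only [Prod.mk.injEq] at h2
  exact ⟨e', by rw [h1, h2.1], h2.2.symm⟩

/-! ### Positions and lookup in instantiations -/

theorem lookup_of_getElem? {α : Type*} {l : List (MVar × α)} (hl : (l.map Prod.fst).Nodup) {i : ℕ}
    {M : MVar} {e : α} (h : l[i]? = some (M, e)) : l.lookup M = some e := by
  induction l generalizing i with
  | nil => simp at h
  | cons p l ih =>
    obtain ⟨N, x⟩ := p
    cases i with
    | zero => simp at h; simp [h.1, h.2]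
    | succ i =>
      simp only [List.getElem?_cons_succ] at h
      simp only [List.map_cons, List.nodup_cons] at hl
      have : M ≠ N := by
        rintro rfl
        exact hl.1 (List.mem_map_of_mem (List.mem_of_getElem? h))
      rw [List.lookup_cons]
      have hb : (M == N) = false := by simpa using this
      rw [hb]; exact ih hl.2 h

theorem getElem?_of_lookup {α : Type*} {l : List (MVar × α)} {M : MVar} {e : α}
    (h : l.lookup M = some e) : ∃ i : ℕ, l[i]? = some (M, e) := by
  induction l with
  | nil => simp at h
  | cons p l ih =>
    obtain ⟨N, x⟩ := p
    rw [List.lookup_cons] at h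
    by_cases hb : M = N
    · subst hb; simp at h; exact ⟨0, by simp [h]⟩
    · have hb : (M == N) = false := by simpa using hb
      rw [hb] at h
      obtain ⟨i, hi⟩ := ih h
      exact ⟨i + 1, by simpa using hi⟩

theorem exists_getElem?_of_fst {α β : Type*} {l : List (MVar × α)} {l' : List (MVar × β)}
    (h : l.map Prod.fst = l'.map Prod.fst) {i : ℕ} {M : MVar} {x : α} (hi : l[i]? = some (M, x)) :
    ∃ y, l'[i]? = some (M, y) := by
  have : (l'.map Prod.fst)[i]? = some M := by rw [← h]; simp [hi]
  simp only [List.getElem?_map, Option.map_eq_some_iff] at this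
  obtain ⟨⟨N, y⟩, h1, h2⟩ := this
  simp only at h2; subst h2
  exact ⟨y, h1⟩

theorem Inst.IsInst.exists_arg {I : Inst S} {Ξ Θ : MCtx S} {Γ : VCtx S} (h : I.IsInst Ξ Θ Γ)
    (hΞ : (Ξ.map Prod.fst).Nodup) {i : ℕ} {M : MVar} {B : Bdry S} (hi : Ξ[i]? = some (M, B)) :
    ∃ e, I[i]? = some (M, e) ∧ I.lookup M = some e ∧ e.Valid Θ Γ 0 (arityB B) := by
  obtain ⟨e, he⟩ := exists_getElem?_of_fst h.1.symm hi
  exact ⟨e, he, lookup_of_getElem? (h.1 ▸ hΞ) he, h.2 _ _ _ _ _ hi he⟩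

theorem Inst.IsInst.valid_of_lookup {I : Inst S} {Ξ Θ : MCtx S} {Γ : VCtx S}
    (h : I.IsInst Ξ Θ Γ) {M : MVar} {e : Expr S} (hM : I.lookup M = some e) :
    ∃ ar, e.Valid Θ Γ 0 ar := by
  obtain ⟨i, hi⟩ := getElem?_of_lookup hM
  obtain ⟨B, hB⟩ := exists_getElem?_of_fst h.1 hi
  exact ⟨_, h.2 _ _ _ _ _ hB hi⟩

theorem Inst.IsInst.take {I : Inst S} {Ξ Θ : MCtx S} {Γ : VCtx S} (h : I.IsInst Ξ Θ Γ) (k : ℕ) :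
    Inst.IsInst (I.take k) (Ξ.take k) Θ Γ := by
  refine ⟨by rw [List.map_take, h.1, List.map_take], ?_⟩
  intro i M N B e h1 h2
  rw [List.getElem?_take] at h1 h2
  split_ifs at h1 h2
  exact h.2 _ _ _ _ _ h1 h2

theorem Inst.IsInst.mono {I : Inst S} {Ξ Θ : MCtx S} {Γ Γ' : VCtx S} (h : I.IsInst Ξ Θ Γ)
    (hΓ : ∀ a ∈ Γ.map Prod.fst, a ∈ Γ'.map Prod.fst) : I.IsInst Ξ Θ Γ' :=
  ⟨h.1, fun i M N B e h1 h2 => (h.2 i M N B e h1 h2).mono (fun _ _ h => h) hΓ⟩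

theorem Inst.IsInst.isMor {I : Inst S} {Ξ Θ : MCtx S} {Δ : VCtx S} (h : I.IsInst Ξ Θ Δ)
    (hΞ : (Ξ.map Prod.fst).Nodup) (hΘ : ValidMCtx Θ) (hΔ : ValidVCtx Θ Δ) :
    IsMor I Ξ Θ .fvar [] Δ where
  mctx := hΘ
  vctx := hΔ
  closed := ⟨fun M e hM => (h.valid_of_lookup hM).choose_spec.closed, fun a => trivial⟩
  var := by simp
  meta_ := fun M B hM => by
    obtain ⟨i, hi⟩ := List.mem_iff_getElem?.1 hM
    obtain ⟨e, -, h1, h2⟩ := h.exists_arg hΞ hi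
    exact .inr ⟨e, h1, h2⟩

theorem IsMor.isInst_mapArg {I : Inst S} {Ξ Θ : MCtx S} {σ : Name → Expr S} {Γ Δ : VCtx S}
    (h : IsMor I Ξ Θ σ Γ Δ) {K : Inst S} {Ψ : MCtx S} (hK : K.IsInst Ψ Ξ Γ) :
    (K.mapArg (Expr.inst I σ)).IsInst Ψ Θ Δ := by
  refine ⟨by rw [← hK.1]; simp [Inst.mapArg], ?_⟩
  intro i M N B e h1 h2
  obtain ⟨e', h3, rfl⟩ := Inst.getElem?_mapArg h2
  exact h.valid_inst (hK.2 _ _ _ _ _ h1 h3)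

/-- Validity ensures that the `n` abstractions are already present in `e`. Otherwise instantiating a
metavariable at the head could expose new ones. -/
theorem Expr.Valid.stripAbs_inst {Θ : MCtx S} {Γ : VCtx S} {c : SynClass} (I : Inst S)
    (σ : Name → Expr S) (n : ℕ) : ∀ {k : ℕ} {e : Expr S}, e.Valid Θ Γ k (c, n) →
      (e.inst I σ).stripAbs n = (e.stripAbs n).inst I σ := by
  induction n with
  | zero => intro k e h; simp [Expr.stripAbs]
  | succ n ih =>
    intro k e h
    obtain ⟨e, rfl, h1⟩ := h.eq_abstr
    simpa [Expr.stripAbs, Expr.inst] using ih h1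

/-- Composition of instantiations. As `e` has no free variables and all its metavariables are
replaced by `K`, the outer morphism reaches only the arguments of `K`. This makes the image of an
instance of a specific rule an instance of the same rule. -/
theorem ClosedMor.inst_act {I : Inst S} {σ : Name → Expr S} (h : ClosedMor I σ) {K : Inst S}
    {Ψ Ξ : MCtx S} {Γ : VCtx S} (hΨ : (Ψ.map Prod.fst).Nodup) (hK : K.IsInst Ψ Ξ Γ) {k : ℕ}
    {e : Expr S} {ar : SynClass × ℕ} (he : e.Valid Ψ [] k ar) :
    (e.act K).inst I σ = e.act (K.mapArg (Expr.inst I σ)) := by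
  induction he with
  | fvar ha => simp at ha
  | metaApp hM ho hn _ ih =>
    subst hn
    obtain ⟨i, hi⟩ := List.mem_iff_getElem?.1 hM
    obtain ⟨e, -, h1, h2⟩ := hK.exists_arg hΨ hi
    have h3 := Inst.lookup_mapArg (Expr.inst I σ) K
    simp only [Expr.act, h1, h3, Option.map_some, h.inst_subst, h2.stripAbs_inst, ← ih]
    congr 1; funext i; exact ClosedMor.inst_vecSubst _ _ _
  | _ => simp_all [Expr.act, Expr.inst]

theorem ClosedMor.map_act {I : Inst S} {σ : Name → Expr S} (h : ClosedMor I σ) {K : Inst S}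
    {Ψ Ξ : MCtx S} {Γ : VCtx S} (hΨ : (Ψ.map Prod.fst).Nodup) (hK : K.IsInst Ψ Ξ Γ) {k : ℕ}
    {b : BThesis S} (hb : b.Valid Ψ [] k) :
    (b.act K).map (Expr.inst I σ) = b.act (K.mapArg (Expr.inst I σ)) := by
  simp only [BThesis.act, BThesis.map_map]
  exact BThesis.Valid.map_congr (fun e ar he => h.inst_act hΨ hK he) hb

theorem ClosedMor.mapB_actB {I : Inst S} {σ : Name → Expr S} (h : ClosedMor I σ) {K : Inst S}
    {Ψ Ξ : MCtx S} {Γ : VCtx S} (hΨ : (Ψ.map Prod.fst).Nodup) (hK : K.IsInst Ψ Ξ Γ)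
    {B : Bdry S} : ∀ {k : ℕ}, ValidB Ψ [] k B →
    mapB (Expr.inst I σ) (actB K B) = actB (K.mapArg (Expr.inst I σ)) B := by
  induction B with
  | base b => intro k hb; simp [actB, Abs.bimap, h.map_act hΨ hK hb]
  | abstr A B ih =>
    intro k hB
    simp [actB, Abs.bimap, h.inst_act hΨ hK hB.1]; exact ih hB.2

theorem mapJ_plug {I : Inst S} {σ : Name → Expr S} {Θ : MCtx S} {Γ : VCtx S} {c : SynClass}
    (B : Bdry S) : ∀ {k : ℕ} {e : Expr S}, e.Valid Θ Γ k (c, B.tele.length) →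
      mapJ (Expr.inst I σ) (plug B e) = plug (mapB (Expr.inst I σ) B) (e.inst I σ) := by
  induction B with
  | base b => intro k e he; simp [plug, Abs.bimap, BThesis.map_plug]
  | abstr A B ih =>
    intro k e he
    obtain ⟨e, rfl, h1⟩ := he.eq_abstr
    simp [plug, Abs.bimap, Expr.inst]; exact ih h1

theorem mapJ_plugEq {I : Inst S} {σ : Name → Expr S} {Θ : MCtx S} {Γ : VCtx S} {c c' : SynClass}
    (B : Bdry S) : ∀ {k : ℕ} {e e' : Expr S}, e.Valid Θ Γ k (c, B.tele.length) →
      e'.Valid Θ Γ k (c', B.tele.length) →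
      mapJ (Expr.inst I σ) (plugEq B e e') =
        plugEq (mapB (Expr.inst I σ) B) (e.inst I σ) (e'.inst I σ) := by
  induction B with
  | base b => intro k e e' he he'; simp [plugEq, Abs.bimap, BThesis.map_plugEq]
  | abstr A B ih =>
    intro k e e' he he'
    obtain ⟨e, rfl, h1⟩ := he.eq_abstr
    obtain ⟨e', rfl, h1'⟩ := he'.eq_abstr
    simp [plugEq, Abs.bimap, Expr.inst]; exact ih h1 h1'

theorem tele_actB (I : Inst S) (B : Bdry S) : (actB I B).tele = B.tele.map (Expr.act I) := by
  rw [actB_eq_mapB, Abs.tele_bimap]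

theorem body_actB (I : Inst S) (B : Bdry S) : (actB I B).body = B.body.act I := by
  rw [actB_eq_mapB, Abs.body_bimap]; rfl

/-! ### Contexts and opening -/

theorem Derives.validHyp {T : RawTypeTheory.{u, v} S} {Θ : MCtx S} {Γ : VCtx S} {X : Stmt S}
    (h : Derives T Θ Γ X) : ValidHyp Θ Γ X := by
  cases h <;> assumption

theorem ValidVCtx.extend {Θ : MCtx S} {Γ : VCtx S} (h : ValidVCtx Θ Γ) {a : Name} {A : Expr S}
    (ha : a ∉ Γ.map Prod.fst) (hA : A.Valid Θ Γ 0 (.ty, 0)) : ValidVCtx Θ (Γ ++ [(a, A)]) := by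
  refine ⟨?_, ?_⟩
  · rw [List.map_append, List.nodup_append]
    refine ⟨h.1, by simp, ?_⟩
    intro x hx y hy
    simp only [List.map_cons, List.map_nil, List.mem_singleton] at hy
    subst hy; rintro rfl; exact ha hx
  · intro i b B hi
    rcases lt_trichotomy i Γ.length with hl | hl | hl
    · rw [List.getElem?_append_left hl] at hi
      rw [List.take_append_of_le_length hl.le]
      exact h.2 _ _ _ hi
    · subst hl
      simp at hi ⊢
      obtain ⟨rfl, rfl⟩ := hi
      exact hA
    · rw [List.getElem?_eq_none (by simp; omega)] at hi
      cases hi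

theorem ValidVCtx.valid_of_mem {Θ : MCtx S} {Γ : VCtx S} (h : ValidVCtx Θ Γ) {a : Name}
    {A : Expr S} (ha : (a, A) ∈ Γ) : A.Valid Θ Γ 0 (.ty, 0) := by
  obtain ⟨i, hi⟩ := List.mem_iff_getElem?.1 ha
  refine (h.2 _ _ _ hi).mono (fun _ _ h => h) fun b hb => ?_
  rw [List.map_take] at hb
  exact List.mem_of_mem_take hb

theorem mem_fst_append {Γ : VCtx S} {a c : Name} {A : Expr S}
    (h : c ∈ (Γ ++ [(a, A)]).map Prod.fst) : c ∈ Γ.map Prod.fst ∨ c = a := by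
  simpa using h

theorem exists_fresh (l : List Name) : ∃ b, b ∉ l := Infinite.exists_notMem_finset l.toFinset |>.imp
  fun _ h => by simpa using h

theorem update_agree {Γ : VCtx S} {a : Name} (ha : a ∉ Γ.map Prod.fst) (σ : Name → Expr S)
    (t : Expr S) : ∀ c ∈ Γ.map Prod.fst, Function.update σ a t c = σ c := by
  intro c hc
  exact Function.update_of_ne (by rintro rfl; exact ha hc) _ _

theorem Expr.Valid.inst_update {I : Inst S} {σ : Name → Expr S} {Ξ : MCtx S} {Γ : VCtx S}
    {k : ℕ} {e : Expr S} {ar : SynClass × ℕ} (he : e.Valid Ξ Γ k ar) {a : Name}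
    (ha : a ∉ Γ.map Prod.fst) (t : Expr S) :
    e.inst I (Function.update σ a t) = e.inst I σ :=
  he.inst_congr (update_agree ha σ t) fun _ _ => rfl

theorem ClosedMor.update {I : Inst S} {σ : Name → Expr S} (h : ClosedMor I σ) (a : Name)
    {t : Expr S} (ht : t.Closed 0) : ClosedMor I (Function.update σ a t) := by
  refine ⟨h.inst, fun c => ?_⟩
  by_cases hc : c = a
  · subst hc; simpa using ht
  · simpa [Function.update_of_ne hc] using h.var c

/-- Since `a` is fresh for `J`, the new value at `a` is seen only where opening has put `a`. With
`t` a variable this handles the passage under a binder, with general `t` the substitution for a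
bound variable. -/
theorem ClosedMor.openJ_update {I : Inst S} {σ : Name → Expr S} {Ξ : MCtx S} {Γ : VCtx S}
    {k : ℕ} {J : Judg S} (hJ : ValidJ Ξ Γ k J) {a : Name} (ha : a ∉ Γ.map Prod.fst) {t : Expr S}
    (h : ClosedMor I σ) (ht : t.Closed 0) :
    mapJ (Expr.inst I (Function.update σ a t)) (openJ a J) =
      substJ (vecSubst 1 fun _ => t) (mapJ (Expr.inst I σ) J) := by
  rw [openJ, (h.update a ht).mapJ_substJ]
  rw [ValidJ.map_congr (fun k e ar (he : e.Valid Ξ Γ k ar) => he.inst_update ha t) hJ]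
  congr 1; funext i
  rw [ClosedMor.inst_vecSubst]
  simp [Expr.inst]

theorem ClosedMor.openB_update {I : Inst S} {σ : Name → Expr S} {Ξ : MCtx S} {Γ : VCtx S}
    {k : ℕ} {J : Bdry S} (hJ : ValidB Ξ Γ k J) {a : Name} (ha : a ∉ Γ.map Prod.fst) {t : Expr S}
    (h : ClosedMor I σ) (ht : t.Closed 0) :
    mapB (Expr.inst I (Function.update σ a t)) (openB a J) =
      substB (vecSubst 1 fun _ => t) (mapB (Expr.inst I σ) J) := by
  rw [openB, (h.update a ht).mapB_substB]
  rw [ValidB.map_congr (fun k e ar (he : e.Valid Ξ Γ k ar) => he.inst_update ha t) hJ]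
  congr 1; funext i
  rw [ClosedMor.inst_vecSubst]
  simp [Expr.inst]

theorem IsMor.weaken {I : Inst S} {Ξ Θ : MCtx S} {σ : Name → Expr S} {Γ Δ Δ' : VCtx S}
    (h : IsMor I Ξ Θ σ Γ Δ) (hΔ' : ValidVCtx Θ Δ')
    (hs : ∀ a ∈ Δ.map Prod.fst, a ∈ Δ'.map Prod.fst) : IsMor I Ξ Θ σ Γ Δ' where
  mctx := h.mctx
  vctx := hΔ'
  closed := h.closed
  var a ha := (h.var a ha).mono (fun _ _ h => h) hs
  meta_ M B hM := (h.meta_ M B hM).imp id fun ⟨e, h1, h2⟩ => ⟨e, h1, h2.mono (fun _ _ h => h) hs⟩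

theorem IsMor.update {I : Inst S} {Ξ Θ : MCtx S} {σ : Name → Expr S} {Γ Δ : VCtx S}
    (h : IsMor I Ξ Θ σ Γ Δ) {a : Name} (ha : a ∉ Γ.map Prod.fst) (A : Expr S) {t : Expr S}
    (ht : t.Valid Θ Δ 0 (.tm, 0)) :
    IsMor I Ξ Θ (Function.update σ a t) (Γ ++ [(a, A)]) Δ where
  mctx := h.mctx
  vctx := h.vctx
  closed := h.closed.update a ht.closed
  var c hc := by
    rcases mem_fst_append hc with hc | rfl
    · rw [update_agree ha σ t c hc]; exact h.var c hc
    · simpa using ht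
  meta_ := h.meta_

theorem BThesis.Valid.plug {Θ : MCtx S} {Γ : VCtx S} {k : ℕ} {b : BThesis S} (hb : b.Valid Θ Γ k)
    {e : Expr S} (he : e.Valid Θ Γ k (b.cls, 0)) : (b.plug e).Valid Θ Γ k := by
  cases b <;> simp_all [BThesis.plug, JThesis.Valid, BThesis.Valid, BThesis.cls]

theorem RawRule.map_act {I : Inst S} {σ : Name → Expr S} (h : ClosedMor I σ) (R : RawRule S)
    {K : Inst S} {Ξ : MCtx S} {Γ : VCtx S} (hK : K.IsInst R.mctx Ξ Γ) :
    ((R.bdry.plug R.head).act K).map (Expr.inst I σ) =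
      (R.bdry.plug R.head).act (K.mapArg (Expr.inst I σ)) := by
  simp only [JThesis.act, JThesis.map_map]
  exact JThesis.Valid.map_congr (fun e ar he => h.inst_act R.valid_mctx.1 hK he)
    (R.valid_bdry.plug R.valid_head)

theorem ValidMCtx.nodup_take {Ψ : MCtx S} (hΨ : ValidMCtx Ψ) (i : ℕ) :
    ((Ψ.take i).map Prod.fst).Nodup := by
  rw [List.map_take]; exact hΨ.1.sublist (List.take_sublist _ _)

theorem ClosedMor.mapB_actB_take {I : Inst S} {σ : Name → Expr S} (h : ClosedMor I σ) {Ψ : MCtx S}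
    (hΨ : ValidMCtx Ψ) {K : Inst S} {Ξ : MCtx S} {Γ : VCtx S} (hK : K.IsInst Ψ Ξ Γ) {i : ℕ}
    {M : MVar} {B : Bdry S} (hi : Ψ[i]? = some (M, B)) :
    mapB (Expr.inst I σ) (actB (K.take i) B) =
      actB ((K.mapArg (Expr.inst I σ)).take i) B := by
  rw [h.mapB_actB (hΨ.nodup_take i) (hK.take i) (hΨ.2 _ _ _ hi), ← Inst.take_mapArg]

theorem ClosedMor.mapJ_plug_take {I : Inst S} {σ : Name → Expr S} (h : ClosedMor I σ) {Ψ : MCtx S}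
    (hΨ : ValidMCtx Ψ) {K : Inst S} {Ξ : MCtx S} {Γ : VCtx S} (hK : K.IsInst Ψ Ξ Γ) {i : ℕ}
    {M : MVar} {B : Bdry S} (hi : Ψ[i]? = some (M, B)) {e : Expr S}
    (he : e.Valid Ξ Γ 0 (arityB B)) :
    mapJ (Expr.inst I σ) (plug (actB (K.take i) B) e) =
      plug (actB ((K.mapArg (Expr.inst I σ)).take i) B) (e.inst I σ) := by
  rw [← h.mapB_actB_take hΨ hK hi]
  refine mapJ_plug (c := B.body.cls) _ (k := 0) (Θ := Ξ) (Γ := Γ) ?_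
  rw [tele_actB, List.length_map]
  exact he

theorem ClosedMor.mapJ_plugEq_take {I : Inst S} {σ : Name → Expr S} (h : ClosedMor I σ)
    {Ψ : MCtx S} (hΨ : ValidMCtx Ψ) {K : Inst S} {Ξ : MCtx S} {Γ : VCtx S} (hK : K.IsInst Ψ Ξ Γ)
    {i : ℕ} {M : MVar} {B : Bdry S} (hi : Ψ[i]? = some (M, B)) {e e' : Expr S}
    (he : e.Valid Ξ Γ 0 (arityB B)) (he' : e'.Valid Ξ Γ 0 (arityB B)) :
    mapJ (Expr.inst I σ) (plugEq (actB (K.take i) B) e e') =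
      plugEq (actB ((K.mapArg (Expr.inst I σ)).take i) B) (e.inst I σ) (e'.inst I σ) := by
  rw [← h.mapB_actB_take hΨ hK hi]
  refine mapJ_plugEq (c := B.body.cls) (c' := B.body.cls) _ (k := 0) (Θ := Ξ) (Γ := Γ) ?_ ?_ <;>
    rw [tele_actB, List.length_map]
  exacts [he, he']

/-! ### Derivations are preserved by morphisms of contexts -/

/-- What a class of morphisms has to satisfy in order to preserve derivability. -/
structure MorKit (T : RawTypeTheory.{u, v} S) (I : Inst S) (Ξ Θ : MCtx S)
    (Good : VCtx S → (Name → Expr S) → VCtx S → Prop) : Prop where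
  mor : ∀ {Γ σ Δ}, Good Γ σ Δ → IsMor I Ξ Θ σ Γ Δ
  ext : ∀ {Γ σ Δ}, Good Γ σ Δ → ∀ {a : Name} {A : Expr S}, a ∉ Γ.map Prod.fst →
    A.Valid Ξ Γ 0 (.ty, 0) → ValidVCtx Ξ Γ → Derives T Θ Δ (.jdg (.base (.isTy (A.inst I σ)))) →
    ∃ b, b ∉ Δ.map Prod.fst ∧
      Good (Γ ++ [(a, A)]) (Function.update σ a (.fvar b)) (Δ ++ [(b, A.inst I σ)])
  var : ∀ {Γ σ Δ}, Good Γ σ Δ → ∀ {a : Name} {A : Expr S}, (a, A) ∈ Γ → ValidVCtx Ξ Γ →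
    Derives T Θ Δ (.jdg (.base (.isTm (σ a) (A.inst I σ))))
  meta_ : ∀ {Γ σ Δ}, Good Γ σ Δ → ∀ {M : MVar} {B : Bdry S} (ts : Fin B.tele.length → Expr S),
    (M, B) ∈ Ξ → ValidHyp Ξ Γ (.jdg (.base
        ((B.body.map (Expr.subst (vecSubst _ ts))).plug (.metaApp M _ ts)))) →
    (∀ j : Fin B.tele.length, Derives T Θ Δ (Stmt.map (Expr.inst I σ) (.jdg (.base (.isTm (ts j)
        ((B.tele.get j).subst (vecSubst j fun i : Fin j => ts (i.castLE j.isLt.le)))))))) →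
    Derives T Θ Δ (Stmt.map (Expr.inst I σ)
      (.bdr (.base (B.body.map (Expr.subst (vecSubst _ ts)))))) →
    Derives T Θ Δ (Stmt.map (Expr.inst I σ) (.jdg (.base
        ((B.body.map (Expr.subst (vecSubst _ ts))).plug (.metaApp M _ ts)))))
  metaCongr : ∀ {Γ σ Δ}, Good Γ σ Δ → ∀ {M : MVar} {B : Bdry S}
    (ss ts : Fin B.tele.length → Expr S),
    (M, B) ∈ Ξ → B.body.cls.IsObject → ValidHyp Ξ Γ (.jdg (.base
        ((B.body.map (Expr.subst (vecSubst _ ss))).plugEq (.metaApp M _ ss) (.metaApp M _ ts)))) →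
    (∀ j : Fin B.tele.length, Derives T Θ Δ (Stmt.map (Expr.inst I σ) (.jdg (.base (.isTm (ss j)
        ((B.tele.get j).subst (vecSubst j fun i : Fin j => ss (i.castLE j.isLt.le)))))))) →
    (∀ j : Fin B.tele.length, Derives T Θ Δ (Stmt.map (Expr.inst I σ) (.jdg (.base (.isTm (ts j)
        ((B.tele.get j).subst (vecSubst j fun i : Fin j => ts (i.castLE j.isLt.le)))))))) →
    (∀ j : Fin B.tele.length, Derives T Θ Δ (Stmt.map (Expr.inst I σ) (.jdg (.base
      (.eqTm (ss j) (ts j)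
        ((B.tele.get j).subst (vecSubst j fun i : Fin j => ss (i.castLE j.isLt.le)))))))) →
    (∀ C : Expr S, B.body = .tm C → Derives T Θ Δ (Stmt.map (Expr.inst I σ) (.jdg (.base
        (.eqTy (C.subst (vecSubst _ ss)) (C.subst (vecSubst _ ts))))))) →
    Derives T Θ Δ (Stmt.map (Expr.inst I σ) (.jdg (.base
        ((B.body.map (Expr.subst (vecSubst _ ss))).plugEq (.metaApp M _ ss) (.metaApp M _ ts)))))

/-- The equality and boundary rules commute with any homomorphic action, and specific rules and
their congruences do so because instantiations compose. Only variables, metavariables and binders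
depend on the class `Good`, and these are answered by the kit. -/
theorem Derives.morph {T : RawTypeTheory.{u, v} S} {I : Inst S} {Ξ Θ : MCtx S}
    {Good : VCtx S → (Name → Expr S) → VCtx S → Prop} (kit : MorKit T I Ξ Θ Good)
    {Γ : VCtx S} {X : Stmt S} (h : Derives T Ξ Γ X) :
    ∀ {σ : Name → Expr S} {Δ : VCtx S}, Good Γ σ Δ →
      Derives T Θ Δ (X.map (Expr.inst I σ)) := by
  induction h with
  | var hv hm => intro σ Δ hG; exact kit.var hG hm hv.2.1
  | meta_ ts hv hm _ _ ih ihb =>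
    intro σ Δ hG; exact kit.meta_ hG ts hm hv (fun j => ih j hG) (ihb hG)
  | metaCongr ss ts hv hm ho _ _ _ _ ih1 ih2 ih3 ih4 =>
    intro σ Δ hG
    exact kit.metaCongr hG ss ts hm ho hv (fun j => ih1 j hG) (fun j => ih2 j hG)
      (fun j => ih3 j hG) (fun C hC => ih4 C hC hG)
  | abstr a hv _ ha _ ihA ihJ =>
    intro σ Δ hG
    -- The name `a` used in the source derivation may occur in `Δ`; the kit supplies a name `b`
    -- fresh for the target, and the abstraction is rebuilt at `b`.
    obtain ⟨b, hb, hG'⟩ := kit.ext hG ha hv.2.2.1 hv.2.1 (ihA hG)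
    refine .abstr b ((kit.mor hG).validHyp hv) (ihA hG) hb ?_
    have := ihJ hG'
    simp only [Stmt.map] at this
    rwa [ClosedMor.openJ_update hv.2.2.2 ha (kit.mor hG).closed (Expr.closed_fvar b)] at this
  | tyRefl hv _ ih => intro σ Δ hG; exact .tyRefl ((kit.mor hG).validHyp hv) (ih hG)
  | tySym hv _ ih => intro σ Δ hG; exact .tySym ((kit.mor hG).validHyp hv) (ih hG)
  | tyTran hv _ _ ih ih' =>
    intro σ Δ hG; exact .tyTran ((kit.mor hG).validHyp hv) (ih hG) (ih' hG)
  | tmRefl hv _ ih => intro σ Δ hG; exact .tmRefl ((kit.mor hG).validHyp hv) (ih hG)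
  | tmSym hv _ ih => intro σ Δ hG; exact .tmSym ((kit.mor hG).validHyp hv) (ih hG)
  | tmTran hv _ _ ih ih' =>
    intro σ Δ hG; exact .tmTran ((kit.mor hG).validHyp hv) (ih hG) (ih' hG)
  | convTm hv _ _ ih ih' =>
    intro σ Δ hG; exact .convTm ((kit.mor hG).validHyp hv) (ih hG) (ih' hG)
  | convEq hv _ _ ih ih' =>
    intro σ Δ hG; exact .convEq ((kit.mor hG).validHyp hv) (ih hG) (ih' hG)
  | bdryTy hv => intro σ Δ hG; exact .bdryTy ((kit.mor hG).validHyp hv)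
  | bdryTm hv _ ih => intro σ Δ hG; exact .bdryTm ((kit.mor hG).validHyp hv) (ih hG)
  | bdryEqTy hv _ _ ih ih' =>
    intro σ Δ hG; exact .bdryEqTy ((kit.mor hG).validHyp hv) (ih hG) (ih' hG)
  | bdryEqTm hv _ _ _ ih ih' ih'' =>
    intro σ Δ hG; exact .bdryEqTm ((kit.mor hG).validHyp hv) (ih hG) (ih' hG) (ih'' hG)
  | bdryAbstr a hv _ ha _ ihA ihJ =>
    intro σ Δ hG
    obtain ⟨b, hb, hG'⟩ := kit.ext hG ha hv.2.2.1 hv.2.1 (ihA hG)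
    refine .bdryAbstr b ((kit.mor hG).validHyp hv) (ihA hG) hb ?_
    have := ihJ hG'
    simp only [Stmt.map] at this
    rwa [ClosedMor.openB_update hv.2.2.2 ha (kit.mor hG).closed (Expr.closed_fvar b)] at this
  | specific r K hv hK _ _ ih ihb =>
    intro σ Δ hG
    have hc := (kit.mor hG).closed
    have hv' := (kit.mor hG).validHyp hv
    have hb := ihb hG
    simp only [Stmt.map, Abs.bimap] at hv' hb ⊢
    rw [hc.map_act (T.rule r).valid_mctx.1 hK (T.rule r).valid_bdry] at hb
    rw [RawRule.map_act hc _ hK] at hv' ⊢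
    refine .specific r _ hv' ((kit.mor hG).isInst_mapArg hK) ?_ hb
    intro i M N B e h1 h2
    obtain ⟨e, h3, rfl⟩ := Inst.getElem?_mapArg h2
    have := ih i M N B e h1 h3 hG
    simp only [Stmt.map] at this
    rwa [hc.mapJ_plug_take (T.rule r).valid_mctx hK h1 (hK.2 _ _ _ _ _ h1 h3)] at this
  | congr r K K' hv ho hK hK' _ _ _ _ ih ih' ihe ihC =>
    intro σ Δ hG
    have hc := (kit.mor hG).closed
    have hv' := (kit.mor hG).validHyp hv
    simp only [Stmt.map, Abs.bimap, BThesis.map_plugEq] at hv' ⊢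
    rw [hc.map_act (T.rule r).valid_mctx.1 hK (T.rule r).valid_bdry,
      hc.inst_act (T.rule r).valid_mctx.1 hK (T.rule r).valid_head,
      hc.inst_act (T.rule r).valid_mctx.1 hK' (T.rule r).valid_head] at hv' ⊢
    refine .congr r _ _ hv' ho ((kit.mor hG).isInst_mapArg hK) ((kit.mor hG).isInst_mapArg hK')
      ?_ ?_ ?_ ?_
    · intro i M N B e h1 h2
      obtain ⟨e, h3, rfl⟩ := Inst.getElem?_mapArg h2
      have := ih i M N B e h1 h3 hG
      simp only [Stmt.map] at this
      rwa [hc.mapJ_plug_take (T.rule r).valid_mctx hK h1 (hK.2 _ _ _ _ _ h1 h3)] at this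
    · intro i M N B e h1 h2
      obtain ⟨e, h3, rfl⟩ := Inst.getElem?_mapArg h2
      have := ih' i M N B e h1 h3 hG
      simp only [Stmt.map] at this
      rwa [hc.mapJ_plug_take (T.rule r).valid_mctx hK' h1 (hK'.2 _ _ _ _ _ h1 h3)] at this
    · intro i M N N' B f g h1 h2 h3 hB
      obtain ⟨f, h4, rfl⟩ := Inst.getElem?_mapArg h2
      obtain ⟨g, h5, rfl⟩ := Inst.getElem?_mapArg h3
      have := ihe i M N N' B f g h1 h4 h5 hB hG
      simp only [Stmt.map] at this
      rwa [hc.mapJ_plugEq_take (T.rule r).valid_mctx hK h1 (hK.2 _ _ _ _ _ h1 h4)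
        (hK'.2 _ _ _ _ _ h1 h5)] at this
    · intro C hC
      have := ihC C hC hG
      have hC' := (T.rule r).valid_bdry
      rw [hC] at hC'
      simp only [Stmt.map, Abs.bimap, JThesis.map] at this
      rwa [hc.inst_act (T.rule r).valid_mctx.1 hK hC',
        hc.inst_act (T.rule r).valid_mctx.1 hK' hC'] at this

/-! ### Weakening -/

theorem ValidB.body_valid {Θ : MCtx S} {Γ : VCtx S} {B : Bdry S} :
    ∀ {k : ℕ}, ValidB Θ Γ k B → B.body.Valid Θ Γ (k + B.tele.length) := by
  induction B with
  | base b => intro k h; exact h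
  | abstr A B ih =>
    intro k h
    have := ih h.2
    simpa [Abs.body, Abs.tele, Nat.add_assoc, Nat.add_comm 1] using this

theorem ValidB.tele_valid {Θ : MCtx S} {Γ : VCtx S} {B : Bdry S} :
    ∀ {k j : ℕ} {A : Expr S}, ValidB Θ Γ k B → B.tele[j]? = some A →
      A.Valid Θ Γ (k + j) (.ty, 0) := by
  induction B with
  | base b => intro k j A h hj; simp [Abs.tele] at hj
  | abstr A B ih =>
    intro k j A' h hj
    cases j with
    | zero => simp [Abs.tele] at hj; subst hj; exact h.1
    | succ j =>
      have := ih h.2 (by simpa [Abs.tele] using hj)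
      simpa [Nat.add_assoc, Nat.add_comm 1] using this

theorem mapB_id (B : Bdry S) : mapB id B = B := by
  induction B with
  | base b => cases b <;> rfl
  | abstr A B ih => exact congrArg (Abs.abstr A) ih

theorem ValidMCtx.valid_of_mem {Θ : MCtx S} (h : ValidMCtx Θ) {M : MVar} {B : Bdry S}
    (hM : (M, B) ∈ Θ) : ValidB Θ [] 0 B := by
  obtain ⟨i, hi⟩ := List.mem_iff_getElem?.1 hM
  have := h.2 _ _ _ hi
  have := ValidB.map (f := id) (Θ' := Θ) (Γ' := []) (fun k e ar he =>
    he.mono (fun M B h => List.mem_of_mem_take h) fun _ h => h) this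
  rwa [mapB_id] at this

theorem Expr.Valid.inst_nil {σ : Name → Expr S} {Ξ : MCtx S} {Γ : VCtx S}
    (hσ : ∀ a ∈ Γ.map Prod.fst, σ a = .fvar a) {k : ℕ} {e : Expr S} {ar : SynClass × ℕ}
    (he : e.Valid Ξ Γ k ar) : e.inst [] σ = e := by
  rw [he.inst_congr (I' := []) hσ fun _ _ => rfl, Expr.inst_nil_fvar]

theorem ClosedMor.inst_nil_subst {σ : Name → Expr S} (h : ClosedMor [] σ) {Θ : MCtx S} {k : ℕ}
    {e : Expr S} {ar : SynClass × ℕ} (he : e.Valid Θ [] k ar) (n : ℕ) (ts : Fin n → Expr S) :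
    (e.subst (vecSubst n ts)).inst [] σ = e.subst (vecSubst n fun i => (ts i).inst [] σ) := by
  rw [h.inst_subst, he.inst_nil (by simp)]
  congr 1; funext i; exact ClosedMor.inst_vecSubst _ _ _

theorem ClosedMor.map_nil_subst {σ : Name → Expr S} (h : ClosedMor [] σ) {Θ : MCtx S} {k : ℕ}
    {b : BThesis S} (hb : b.Valid Θ [] k) (n : ℕ) (ts : Fin n → Expr S) :
    (b.map (Expr.subst (vecSubst n ts))).map (Expr.inst [] σ) =
      b.map (Expr.subst (vecSubst n fun i => (ts i).inst [] σ)) := by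
  rw [BThesis.map_map]
  exact BThesis.Valid.map_congr (fun e ar he => h.inst_nil_subst he n ts) hb

/-- With the empty instantiation `M` stays in place. Its declared boundary is closed, so `σ` changes
only the arguments, and the metavariable rule applies again. -/
theorem IsMor.derives_meta {T : RawTypeTheory.{u, v} S} {Θ : MCtx S} {σ : Name → Expr S}
    {Γ Δ : VCtx S} (h : IsMor [] Θ Θ σ Γ Δ) {M : MVar} {B : Bdry S}
    (ts : Fin B.tele.length → Expr S) (hM : (M, B) ∈ Θ) (hv : ValidHyp Θ Γ (.jdg (.base
        ((B.body.map (Expr.subst (vecSubst _ ts))).plug (.metaApp M _ ts)))))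
    (ht : ∀ j : Fin B.tele.length, Derives T Θ Δ (Stmt.map (Expr.inst [] σ) (.jdg (.base (.isTm
      (ts j) ((B.tele.get j).subst (vecSubst j fun i : Fin j => ts (i.castLE j.isLt.le))))))))
    (hb : Derives T Θ Δ (Stmt.map (Expr.inst [] σ)
      (.bdr (.base (B.body.map (Expr.subst (vecSubst _ ts))))))) :
    Derives T Θ Δ (Stmt.map (Expr.inst [] σ) (.jdg (.base
        ((B.body.map (Expr.subst (vecSubst _ ts))).plug (.metaApp M _ ts))))) := by
  have hv' := h.validHyp hv
  have hB := h.mctx.valid_of_mem hM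
  simp only [Stmt.map, Abs.bimap, BThesis.map_plug, h.closed.map_nil_subst hB.body_valid] at hv' hb ⊢
  refine .meta_ (fun j => (ts j).inst [] σ) hv' hM (fun j => ?_) hb
  have := ht j
  simp only [Stmt.map, Abs.bimap, JThesis.map] at this
  rwa [h.closed.inst_nil_subst (hB.tele_valid (j := j) (by simp))] at this

/-- Two substitutions are allowed because the lemma has two uses: with `σ = σ'` it shows that the
congruence rule is stable under substitution, and with `ss = ts` it equates the images of one
application under equal substitutions. -/
theorem IsMor.derives_metaCongr {T : RawTypeTheory.{u, v} S} {Θ : MCtx S} {σ σ' : Name → Expr S}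
    {Γ Δ : VCtx S} (h : IsMor [] Θ Θ σ Γ Δ) (h' : IsMor [] Θ Θ σ' Γ Δ) {M : MVar} {B : Bdry S}
    (ss ts : Fin B.tele.length → Expr S) (hM : (M, B) ∈ Θ) (ho : B.body.cls.IsObject)
    (hv : ValidHyp Θ Δ (.jdg (.base
        ((B.body.map (Expr.subst (vecSubst _ fun i => (ss i).inst [] σ))).plugEq
          (.metaApp M _ fun i => (ss i).inst [] σ) (.metaApp M _ fun i => (ts i).inst [] σ')))))
    (hs : ∀ j : Fin B.tele.length, Derives T Θ Δ (Stmt.map (Expr.inst [] σ) (.jdg (.base (.isTm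
      (ss j) ((B.tele.get j).subst (vecSubst j fun i : Fin j => ss (i.castLE j.isLt.le))))))))
    (ht : ∀ j : Fin B.tele.length, Derives T Θ Δ (Stmt.map (Expr.inst [] σ') (.jdg (.base (.isTm
      (ts j) ((B.tele.get j).subst (vecSubst j fun i : Fin j => ts (i.castLE j.isLt.le))))))))
    (he : ∀ j : Fin B.tele.length, Derives T Θ Δ (.jdg (.base
      (.eqTm ((ss j).inst [] σ) ((ts j).inst [] σ') (((B.tele.get j).subst
        (vecSubst j fun i : Fin j => ss (i.castLE j.isLt.le))).inst [] σ)))))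
    (hC : ∀ C : Expr S, B.body = .tm C → Derives T Θ Δ (.jdg (.base
        (.eqTy ((C.subst (vecSubst _ ss)).inst [] σ) ((C.subst (vecSubst _ ts)).inst [] σ'))))) :
    Derives T Θ Δ (.jdg (.base
        ((B.body.map (Expr.subst (vecSubst _ fun i => (ss i).inst [] σ))).plugEq
          (.metaApp M _ fun i => (ss i).inst [] σ)
          (.metaApp M _ fun i => (ts i).inst [] σ')))) := by
  have hB := h.mctx.valid_of_mem hM
  refine .metaCongr (fun j => (ss j).inst [] σ) (fun j => (ts j).inst [] σ') hv hM ho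
    (fun j => ?_) (fun j => ?_) (fun j => ?_) (fun C hC' => ?_)
  · have := hs j
    simp only [Stmt.map, Abs.bimap, JThesis.map] at this
    rwa [h.closed.inst_nil_subst (hB.tele_valid (j := j) (by simp))] at this
  · have := ht j
    simp only [Stmt.map, Abs.bimap, JThesis.map] at this
    rwa [h'.closed.inst_nil_subst (hB.tele_valid (j := j) (by simp))] at this
  · have := he j
    rwa [h.closed.inst_nil_subst (hB.tele_valid (j := j) (by simp))] at this
  · have := hC C hC'
    have hv := hB.body_valid
    rw [hC'] at hv
    rwa [h.closed.inst_nil_subst hv, h'.closed.inst_nil_subst hv] at this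

/-- For pure substitutions the metavariable clauses hold automatically, so only binders and
variables have to be checked. -/
theorem MorKit.nil {T : RawTypeTheory.{u, v} S} {Θ : MCtx S}
    {Good : VCtx S → (Name → Expr S) → VCtx S → Prop}
    (mor : ∀ {Γ σ Δ}, Good Γ σ Δ → IsMor [] Θ Θ σ Γ Δ)
    (ext : ∀ {Γ σ Δ}, Good Γ σ Δ → ∀ {a : Name} {A : Expr S}, a ∉ Γ.map Prod.fst →
      A.Valid Θ Γ 0 (.ty, 0) → ValidVCtx Θ Γ →
      Derives T Θ Δ (.jdg (.base (.isTy (A.inst [] σ)))) → ∃ b, b ∉ Δ.map Prod.fst ∧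
      Good (Γ ++ [(a, A)]) (Function.update σ a (.fvar b)) (Δ ++ [(b, A.inst [] σ)]))
    (var : ∀ {Γ σ Δ}, Good Γ σ Δ → ∀ {a : Name} {A : Expr S}, (a, A) ∈ Γ → ValidVCtx Θ Γ →
      Derives T Θ Δ (.jdg (.base (.isTm (σ a) (A.inst [] σ))))) :
    MorKit T [] Θ Θ Good where
  mor := mor
  ext := ext
  var := var
  meta_ hG _ _ ts hM hv ht hb := (mor hG).derives_meta ts hM hv ht hb
  metaCongr hG M B ss ts hM ho hv hs ht he hC := by
    have hB := (mor hG).mctx.valid_of_mem hM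
    have hv' := (mor hG).validHyp hv
    have e := (mor hG).closed.map_nil_subst hB.body_valid _ ss
    simp only [Stmt.map, Abs.bimap, BThesis.map_plugEq] at hv' ⊢
    rw [e] at hv' ⊢
    exact (mor hG).derives_metaCongr (mor hG) ss ts hM ho hv' hs ht he hC

theorem Stmt.map_inst_nil (X : Stmt S) : X.map (Expr.inst [] .fvar) = X := by
  cases X with
  | jdg J =>
    simp only [Stmt.map, Stmt.jdg.injEq]
    induction J with
    | base j => cases j <;> simp [Abs.bimap, JThesis.map, Expr.inst_nil_fvar]
    | abstr A J ih => exact congrArg₂ Abs.abstr (Expr.inst_nil_fvar A) ih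
  | bdr J =>
    simp only [Stmt.map, Stmt.bdr.injEq]
    induction J with
    | base j => cases j <;> simp [Abs.bimap, BThesis.map, Expr.inst_nil_fvar]
    | abstr A J ih => exact congrArg₂ Abs.abstr (Expr.inst_nil_fvar A) ih

theorem ClosedMor.nil_fvar : ClosedMor ([] : Inst S) .fvar :=
  ⟨by simp, fun _ => trivial⟩

theorem IsMor.id {Θ : MCtx S} {Γ Δ : VCtx S} (hΘ : ValidMCtx Θ) (hΔ : ValidVCtx Θ Δ)
    (hs : ∀ a ∈ Γ.map Prod.fst, a ∈ Δ.map Prod.fst) : IsMor [] Θ Θ .fvar Γ Δ where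
  mctx := hΘ
  vctx := hΔ
  closed := .nil_fvar
  var a ha := .fvar (hs a ha)
  meta_ _ _ hM := .inl ⟨rfl, hM⟩

theorem fst_subset {Γ Δ : VCtx S} (h : ∀ p ∈ Γ, p ∈ Δ) :
    ∀ a ∈ Γ.map Prod.fst, a ∈ Δ.map Prod.fst := by
  intro a ha
  obtain ⟨p, hp, rfl⟩ := List.mem_map.1 ha
  exact List.mem_map_of_mem (h p hp)

/-- Renamings of variables. -/
structure IsRenaming (Θ : MCtx S) (Γ : VCtx S) (σ : Name → Expr S) (Δ : VCtx S) : Prop where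
  mor : IsMor [] Θ Θ σ Γ Δ
  mem : ∀ a A, (a, A) ∈ Γ → ∃ b, σ a = .fvar b ∧ (b, A.inst [] σ) ∈ Δ

/-- Renamings come first because their extension under a binder presupposes no weakening: the values
are variables, and membership in a context survives enlarging it. For term-valued substitutions the
extension already requires weakening the values. -/
theorem renaming_kit (T : RawTypeTheory.{u, v} S) (Θ : MCtx S) :
    MorKit T [] Θ Θ (IsRenaming Θ) := by
  refine .nil (fun h => h.mor) ?_ ?_
  · intro Γ σ Δ h a A ha hA hΓ hd
    obtain ⟨b, hb⟩ := exists_fresh (Δ.map Prod.fst)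
    have hΔ := h.mor.vctx.extend hb hd.validHyp.2.2
    refine ⟨b, hb, ?_, ?_⟩
    · exact (h.mor.weaken hΔ (fst_subset fun p hp => List.mem_append_left _ hp)).update ha A
        (.fvar (by simp))
    · intro c C hc
      rw [List.mem_append, List.mem_singleton] at hc
      rcases hc with hc | hc
      · obtain ⟨d, h1, h2⟩ := h.mem c C hc
        refine ⟨d, ?_, ?_⟩
        · rw [update_agree ha _ _ c (List.mem_map_of_mem hc), h1]
        · rw [(hΓ.valid_of_mem hc).inst_update ha]; exact List.mem_append_left _ h2
      · obtain ⟨rfl, rfl⟩ := Prod.mk.inj hc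
        refine ⟨b, by simp, ?_⟩
        rw [hA.inst_update ha]; simp
  · intro Γ σ Δ h a A ha hΓ
    obtain ⟨b, h1, h2⟩ := h.mem a A ha
    rw [h1]
    exact .var ⟨h.mor.mctx, h.mor.vctx, .fvar (List.mem_map_of_mem h2), h.mor.vctx.valid_of_mem h2⟩ h2

theorem Derives.weaken {T : RawTypeTheory.{u, v} S} {Θ : MCtx S} {Γ Δ : VCtx S} {X : Stmt S}
    (h : Derives T Θ Γ X) (hΔ : ValidVCtx Θ Δ) (hs : ∀ p ∈ Γ, p ∈ Δ) : Derives T Θ Δ X := by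
  have : IsRenaming Θ Γ .fvar Δ :=
    ⟨.id h.validHyp.1 hΔ (fst_subset hs), fun a A ha => ⟨a, rfl, by
      rw [Expr.inst_nil_fvar]; exact hs _ ha⟩⟩
  simpa only [Stmt.map_inst_nil] using h.morph (renaming_kit T Θ) this

theorem Derives.weaken_one {T : RawTypeTheory.{u, v} S} {Θ : MCtx S} {Γ : VCtx S} {X : Stmt S}
    (h : Derives T Θ Γ X) {b : Name} {A : Expr S} (hΔ : ValidVCtx Θ (Γ ++ [(b, A)])) :
    Derives T Θ (Γ ++ [(b, A)]) X :=
  h.weaken hΔ fun _ hp => List.mem_append_left _ hp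

theorem derives_var_last {T : RawTypeTheory.{u, v} S} {Θ : MCtx S} {Γ : VCtx S} (hΘ : ValidMCtx Θ)
    {b : Name} {A : Expr S} (hΔ : ValidVCtx Θ (Γ ++ [(b, A)])) :
    Derives T Θ (Γ ++ [(b, A)]) (.jdg (.base (.isTm (.fvar b) A))) :=
  .var ⟨hΘ, hΔ, .fvar (by simp), hΔ.valid_of_mem (a := b) (by simp)⟩ (by simp)

/-! ### Derivable morphisms -/

/-- The map given by `I` and `σ` sends the variables of `Γ` to derivable terms. -/
structure Mor (T : RawTypeTheory.{u, v} S) (I : Inst S) (Ξ Θ : MCtx S) (Γ : VCtx S)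
    (σ : Name → Expr S) (Δ : VCtx S) : Prop where
  mor : IsMor I Ξ Θ σ Γ Δ
  tm : ∀ a A, (a, A) ∈ Γ → Derives T Θ Δ (.jdg (.base (.isTm (σ a) (A.inst I σ))))

theorem Mor.weaken {T : RawTypeTheory.{u, v} S} {I : Inst S} {Ξ Θ : MCtx S} {Γ : VCtx S}
    {σ : Name → Expr S} {Δ Δ' : VCtx S} (h : Mor T I Ξ Θ Γ σ Δ) (hΔ : ValidVCtx Θ Δ')
    (hs : ∀ p ∈ Δ, p ∈ Δ') : Mor T I Ξ Θ Γ σ Δ' :=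
  ⟨h.mor.weaken hΔ (fst_subset hs), fun a A ha => (h.tm a A ha).weaken hΔ hs⟩

theorem Mor.update {T : RawTypeTheory.{u, v} S} {I : Inst S} {Ξ Θ : MCtx S} {Γ : VCtx S}
    {σ : Name → Expr S} {Δ : VCtx S} (h : Mor T I Ξ Θ Γ σ Δ) (hΓ : ValidVCtx Ξ Γ) {a : Name}
    (ha : a ∉ Γ.map Prod.fst) {A t : Expr S} (hA : A.Valid Ξ Γ 0 (.ty, 0))
    (ht : Derives T Θ Δ (.jdg (.base (.isTm t (A.inst I σ))))) :
    Mor T I Ξ Θ (Γ ++ [(a, A)]) (Function.update σ a t) Δ := by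
  refine ⟨h.mor.update ha A ht.validHyp.2.2.1, ?_⟩
  intro c C hc
  rw [List.mem_append, List.mem_singleton] at hc
  rcases hc with hc | hc
  · rw [update_agree ha _ _ c (List.mem_map_of_mem hc), (hΓ.valid_of_mem hc).inst_update ha]
    exact h.tm c C hc
  · obtain ⟨rfl, rfl⟩ := Prod.mk.inj hc
    rw [hA.inst_update ha]
    simpa using ht

theorem Mor.id {T : RawTypeTheory.{u, v} S} {Θ : MCtx S} {Γ : VCtx S} (hΘ : ValidMCtx Θ)
    (hΓ : ValidVCtx Θ Γ) : Mor T [] Θ Θ Γ .fvar Γ := by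
  refine ⟨.id hΘ hΓ fun _ h => h, fun a A ha => ?_⟩
  rw [Expr.inst_nil_fvar]
  exact .var ⟨hΘ, hΓ, .fvar (List.mem_map_of_mem ha), hΓ.valid_of_mem ha⟩ ha

theorem Mor.extend {T : RawTypeTheory.{u, v} S} {I : Inst S} {Ξ Θ : MCtx S} {Γ : VCtx S}
    {σ : Name → Expr S} {Δ : VCtx S} (h : Mor T I Ξ Θ Γ σ Δ) (hΓ : ValidVCtx Ξ Γ) {a b : Name}
    (ha : a ∉ Γ.map Prod.fst) {A : Expr S} (hA : A.Valid Ξ Γ 0 (.ty, 0))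
    (hb : b ∉ Δ.map Prod.fst) :
    Mor T I Ξ Θ (Γ ++ [(a, A)]) (Function.update σ a (.fvar b)) (Δ ++ [(b, A.inst I σ)]) := by
  have hΔ := h.mor.vctx.extend hb (h.mor.valid_inst hA)
  exact (h.weaken hΔ fun p hp => List.mem_append_left _ hp).update hΓ ha hA
    (derives_var_last h.mor.mctx hΔ)

/-- Simultaneous substitution of free variables preserves derivability. -/
theorem Derives.subst_fvar {T : RawTypeTheory.{u, v} S} {Θ : MCtx S} {Γ : VCtx S} {X : Stmt S}
    (h : Derives T Θ Γ X) {σ : Name → Expr S} {Δ : VCtx S} (hσ : Mor T [] Θ Θ Γ σ Δ) :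
    Derives T Θ Δ (X.map (Expr.inst [] σ)) := by
  refine h.morph (Good := Mor T [] Θ Θ) (.nil (fun h => h.mor) ?_ ?_) hσ
  · intro Γ σ Δ h a A ha hA hΓ _
    obtain ⟨b, hb⟩ := exists_fresh (Δ.map Prod.fst)
    exact ⟨b, hb, h.extend hΓ ha hA hb⟩
  · intro Γ σ Δ h a A ha _
    exact h.tm a A ha

/-! ### Substitution for bound variables -/

theorem Derives.abstr_inv {T : RawTypeTheory.{u, v} S} {Θ : MCtx S} {Γ : VCtx S} {A : Expr S}
    {J : Judg S} (h : Derives T Θ Γ (.jdg (.abstr A J))) :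
    Derives T Θ Γ (.jdg (.base (.isTy A))) ∧ ∃ a, a ∉ Γ.map Prod.fst ∧
      Derives T Θ (Γ ++ [(a, A)]) (.jdg (openJ a J)) := by
  cases h with
  | abstr a hv hA ha hJ => exact ⟨hA, a, ha, hJ⟩

theorem ValidJ.mapJ_inst_nil {Θ : MCtx S} {Γ : VCtx S} {k : ℕ} {J : Judg S} (h : ValidJ Θ Γ k J)
    {σ : Name → Expr S} (hσ : ∀ a ∈ Γ.map Prod.fst, σ a = .fvar a) :
    mapJ (Expr.inst [] σ) J = J := by
  rw [h.map_congr (g := Expr.inst [] .fvar) fun k e ar he => he.inst_congr hσ fun _ _ => rfl]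
  simpa [Stmt.map] using Stmt.map_inst_nil (.jdg J)

/-- Substitution of a term for the outermost bound variable. -/
theorem Derives.subst_abstr {T : RawTypeTheory.{u, v} S} {Θ : MCtx S} {Γ : VCtx S} {A t : Expr S}
    {J : Judg S} (h : Derives T Θ Γ (.jdg (.abstr A J)))
    (ht : Derives T Θ Γ (.jdg (.base (.isTm t A)))) :
    Derives T Θ Γ (.jdg (substJ (vecSubst 1 fun _ => t) J)) := by
  obtain ⟨hΘ, hΓ, hA, hJ⟩ := h.validHyp
  obtain ⟨-, a, ha, h⟩ := h.abstr_inv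
  -- The bound variable has become the fresh name `a`; the identity on `Γ` modified to send `a` to
  -- `t` performs the substitution.
  have hm : Mor T [] Θ Θ (Γ ++ [(a, A)]) (Function.update .fvar a t) Γ :=
    (Mor.id hΘ hΓ).update hΓ ha hA (by rwa [Expr.inst_nil_fvar])
  have := h.subst_fvar hm
  simp only [Stmt.map] at this
  rwa [ClosedMor.openJ_update hJ ha .nil_fvar ht.validHyp.2.2.1.closed,
    hJ.mapJ_inst_nil fun _ _ => rfl] at this

/-- Substitution of terms for all bound variables. -/
theorem Derives.subst_tele {T : RawTypeTheory.{u, v} S} {Θ : MCtx S} {Γ : VCtx S}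
    {t : ℕ → Expr S} {J : Judg S} : ∀ {n : ℕ}, Derives T Θ Γ (.jdg (substJ (env t n) J)) →
    (∀ j A, J.tele[j]? = some A →
      Derives T Θ Γ (.jdg (.base (.isTm (t (n + j)) (A.subst (env t (n + j))))))) →
    Derives T Θ Γ (.jdg (.base (J.body.map (Expr.subst (env t (n + J.tele.length)))))) := by
  induction J with
  | base j => intro n h _; exact h
  | abstr A J ih =>
    intro n h ht
    have h1 := h.subst_abstr (ht 0 A rfl)
    simp only [Nat.add_zero] at h1
    rw [substJ_env_open] at h1
    have := ih h1 fun j A' hj => by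
      have := ht (j + 1) A' (by simpa [Abs.tele] using hj)
      simpa only [Nat.add_assoc, Nat.add_comm 1 j] using this
    simpa only [Abs.body, Abs.tele, List.length_cons, Nat.add_assoc, Nat.add_comm 1] using this

/-! ### Admissible forms of the equality rules, with validity inferred -/

section
variable {T : RawTypeTheory.{u, v} S} {Θ : MCtx S} {Γ : VCtx S} {s t w A B C : Expr S}

theorem Derives.ty_symm (h : Derives T Θ Γ (.jdg (.base (.eqTy A B)))) :
    Derives T Θ Γ (.jdg (.base (.eqTy B A))) :=
  .tySym ⟨h.validHyp.1, h.validHyp.2.1, h.validHyp.2.2.2, h.validHyp.2.2.1⟩ h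

theorem Derives.ty_trans (h : Derives T Θ Γ (.jdg (.base (.eqTy A B))))
    (h' : Derives T Θ Γ (.jdg (.base (.eqTy B C)))) : Derives T Θ Γ (.jdg (.base (.eqTy A C))) :=
  .tyTran ⟨h.validHyp.1, h.validHyp.2.1, h.validHyp.2.2.1, h'.validHyp.2.2.2⟩ h h'

theorem Derives.tm_refl (h : Derives T Θ Γ (.jdg (.base (.isTm t A)))) :
    Derives T Θ Γ (.jdg (.base (.eqTm t t A))) :=
  .tmRefl ⟨h.validHyp.1, h.validHyp.2.1, h.validHyp.2.2.1, h.validHyp.2.2⟩ h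

theorem Derives.tm_symm (h : Derives T Θ Γ (.jdg (.base (.eqTm s t A)))) :
    Derives T Θ Γ (.jdg (.base (.eqTm t s A))) :=
  .tmSym ⟨h.validHyp.1, h.validHyp.2.1, h.validHyp.2.2.2.1, h.validHyp.2.2.1,
    h.validHyp.2.2.2.2⟩ h

theorem Derives.tm_trans (h : Derives T Θ Γ (.jdg (.base (.eqTm s t A))))
    (h' : Derives T Θ Γ (.jdg (.base (.eqTm t w A)))) :
    Derives T Θ Γ (.jdg (.base (.eqTm s w A))) :=
  .tmTran ⟨h.validHyp.1, h.validHyp.2.1, h.validHyp.2.2.1, h'.validHyp.2.2.2⟩ h h'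

theorem Derives.conv_tm (h : Derives T Θ Γ (.jdg (.base (.isTm t A))))
    (h' : Derives T Θ Γ (.jdg (.base (.eqTy A B)))) : Derives T Θ Γ (.jdg (.base (.isTm t B))) :=
  .convTm ⟨h.validHyp.1, h.validHyp.2.1, h.validHyp.2.2.1, h'.validHyp.2.2.2⟩ h h'

theorem Derives.conv_eq (h : Derives T Θ Γ (.jdg (.base (.eqTm s t A))))
    (h' : Derives T Θ Γ (.jdg (.base (.eqTy A B)))) :
    Derives T Θ Γ (.jdg (.base (.eqTm s t B))) :=
  .convEq ⟨h.validHyp.1, h.validHyp.2.1, h.validHyp.2.2.1, h.validHyp.2.2.2.1,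
    h'.validHyp.2.2.2⟩ h h'

end

/-! ### Presuppositions -/

/-- The types of the context are derivable. -/
def CtxDerivable (T : RawTypeTheory.{u, v} S) (Θ : MCtx S) (Γ : VCtx S) : Prop :=
  ∀ a A, (a, A) ∈ Γ → Derives T Θ Γ (.jdg (.base (.isTy A)))

/-- The constituents of the boundary of a judgement are derivable. -/
def JThesis.Presup (T : RawTypeTheory.{u, v} S) (Θ : MCtx S) (Γ : VCtx S) : JThesis S → Prop
  | .isTy _ => True
  | .isTm _ A => Derives T Θ Γ (.jdg (.base (.isTy A)))
  | .eqTy A B => Derives T Θ Γ (.jdg (.base (.isTy A))) ∧ Derives T Θ Γ (.jdg (.base (.isTy B)))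
  | .eqTm s t A => Derives T Θ Γ (.jdg (.base (.isTy A))) ∧
      Derives T Θ Γ (.jdg (.base (.isTm s A))) ∧ Derives T Θ Γ (.jdg (.base (.isTm t A)))

def Stmt.Presup (T : RawTypeTheory.{u, v} S) (Θ : MCtx S) (Γ : VCtx S) : Stmt S → Prop
  | .jdg (.base j) => j.Presup T Θ Γ
  | _ => True

section
variable {T : RawTypeTheory.{u, v} S} {Θ : MCtx S} {Γ : VCtx S}

theorem Derives.presup_plug {b : BThesis S} (h : Derives T Θ Γ (.bdr (.base b))) (e : Expr S) :
    (b.plug e).Presup T Θ Γ := by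
  cases h with
  | bdryTy hv => trivial
  | bdryTm hv h => exact h
  | bdryEqTy hv h h' => exact ⟨h, h'⟩
  | bdryEqTm hv h h' h'' => exact ⟨h, h', h''⟩

theorem Derives.bdry_tm {A : Expr S} (h : Derives T Θ Γ (.jdg (.base (.isTy A)))) :
    Derives T Θ Γ (.bdr (.base (.tm A))) := .bdryTm h.validHyp h

theorem presup_plugEq {b : BThesis S} {e e' : Expr S} (hb : b.cls.IsObject)
    (h : b = .ty → Derives T Θ Γ (.jdg (.base (.isTy e))) ∧ Derives T Θ Γ (.jdg (.base (.isTy e'))))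
    (h' : ∀ C, b = .tm C → Derives T Θ Γ (.jdg (.base (.isTy C))) ∧
      Derives T Θ Γ (.jdg (.base (.isTm e C))) ∧ Derives T Θ Γ (.jdg (.base (.isTm e' C)))) :
    (b.plugEq e e').Presup T Θ Γ := by
  cases b with
  | ty => exact h rfl
  | tm C => exact h' C rfl
  | eqTy A B => exact hb.elim
  | eqTm s t A => exact hb.elim

/-- Recovers, from a congruence conclusion, the side conditions needed to rederive its two sides
separately. The type of the right-hand side is not visible there; its validity is taken from the
type equation among the premises. -/
theorem ValidHyp.of_plugEq {b : BThesis S} {e e' : Expr S} (hb : b.cls.IsObject)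
    (h : ValidHyp Θ Γ (.jdg (.base (b.plugEq e e')))) :
    ValidHyp Θ Γ (.jdg (.base (b.plug e))) ∧ e'.Valid Θ Γ 0 (b.cls, 0) := by
  obtain ⟨h1, h2, h3⟩ := h
  cases b with
  | ty => exact ⟨⟨h1, h2, h3.1⟩, h3.2⟩
  | tm C => exact ⟨⟨h1, h2, h3.1, h3.2.2⟩, h3.2.1⟩
  | eqTy A B => exact hb.elim
  | eqTm s t A => exact hb.elim

/-- The metavariable and specific rules have their boundary as a premise, so only variables rely on
the context. For a congruence rule, each side is rederived by the underlying object rule. The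
right-hand side then has its own type `C[t]`, or `J_* C`, and is brought back along the type
equation among the premises. -/
theorem Derives.presup {X : Stmt S} (h : Derives T Θ Γ X) (hΓ : CtxDerivable T Θ Γ) :
    X.Presup T Θ Γ := by
  induction h with
  | var hv hm => exact hΓ _ _ hm
  | meta_ ts hv hm _ hb _ _ => exact hb.presup_plug _
  | @metaCongr Γ M B ss ts hv hm ho hs ht he hC _ _ _ ihC =>
    have hv1 := ValidHyp.of_plugEq (by rwa [BThesis.cls_map]) hv
    refine presup_plugEq (by rwa [BThesis.cls_map]) ?_ ?_
    · intro hb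
      have hms := Derives.meta_ (T := T) ss hv1.1 hm hs
      have hmt := Derives.meta_ (T := T) ts (Γ := Γ) (Θ := Θ) (M := M)
      generalize hbb : B.body = b at *
      cases b with
      | ty =>
        exact ⟨hms (.bdryTy ⟨hv.1, hv.2.1, trivial⟩),
          hmt ⟨hv.1, hv.2.1, hv1.2⟩ hm ht (.bdryTy ⟨hv.1, hv.2.1, trivial⟩)⟩
      | _ => cases hb
    · intro C' hb
      have hms := Derives.meta_ (T := T) ss hv1.1 hm hs
      have hmt := Derives.meta_ (T := T) ts (Γ := Γ) (Θ := Θ) (M := M)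
      generalize hbb : B.body = b at *
      cases b with
      | tm C =>
        cases hb
        obtain ⟨hCs, hCt⟩ := ihC C rfl hΓ
        exact ⟨hCs, hms hCs.bdry_tm,
          (hmt ⟨hv.1, hv.2.1, hv1.2, hCt.validHyp.2.2⟩ hm ht hCt.bdry_tm).conv_tm
            (hC C rfl).ty_symm⟩
      | _ => cases hb
  | abstr => trivial
  | tyRefl hv h _ => exact ⟨h, h⟩
  | tySym hv _ ih => exact ⟨(ih hΓ).2, (ih hΓ).1⟩
  | tyTran hv _ _ ih ih' => exact ⟨(ih hΓ).1, (ih' hΓ).2⟩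
  | tmRefl hv h ih => exact ⟨ih hΓ, h, h⟩
  | tmSym hv _ ih => exact ⟨(ih hΓ).1, (ih hΓ).2.2, (ih hΓ).2.1⟩
  | tmTran hv _ _ ih ih' => exact ⟨(ih hΓ).1, (ih hΓ).2.1, (ih' hΓ).2.2⟩
  | convTm hv _ _ ih ih' => exact (ih' hΓ).2
  | convEq hv _ h' ih ih' => exact ⟨(ih' hΓ).2, (ih hΓ).2.1.conv_tm h', (ih hΓ).2.2.conv_tm h'⟩
  | bdryTy => trivial
  | bdryTm => trivial
  | bdryEqTy => trivial
  | bdryEqTm => trivial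
  | bdryAbstr => trivial
  | specific r K hv hK hp hb _ _ =>
    have := hb.presup_plug ((T.rule r).head.act K)
    rwa [BThesis.act, ← BThesis.map_plug] at this
  | @congr Γ r K K' hv ho hK hK' hp hp' he hC _ _ _ ihC =>
    have ho' : ((T.rule r).bdry.act K).cls.IsObject := by rwa [BThesis.act, BThesis.cls_map]
    have hv1 := ValidHyp.of_plugEq ho' hv
    refine presup_plugEq ho' ?_ ?_
    · intro hb
      have hms := Derives.specific (T := T) (Θ := Θ) (Γ := Γ) r K
      have hmt := Derives.specific (T := T) (Θ := Θ) (Γ := Γ) r K'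
      generalize hbb : (T.rule r).bdry = b at *
      cases b with
      | ty =>
        exact ⟨hms hv1.1 hK hp (.bdryTy ⟨hv.1, hv.2.1, trivial⟩),
          hmt ⟨hv.1, hv.2.1, hv1.2⟩ hK' hp' (.bdryTy ⟨hv.1, hv.2.1, trivial⟩)⟩
      | _ => cases hb
    · intro C' hb
      have hms := Derives.specific (T := T) (Θ := Θ) (Γ := Γ) r K
      have hmt := Derives.specific (T := T) (Θ := Θ) (Γ := Γ) r K'
      generalize hbb : (T.rule r).bdry = b at *
      cases b with
      | tm C =>
        cases hb
        obtain ⟨hCs, hCt⟩ := ihC C rfl hΓ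
        exact ⟨hCs, hms hv1.1 hK hp hCs.bdry_tm,
          (hmt ⟨hv.1, hv.2.1, hv1.2, hCt.validHyp.2.2⟩ hK' hp' hCt.bdry_tm).conv_tm
            (hC C rfl).ty_symm⟩
      | _ => cases hb

end

/-! ### The equation between the images of a judgement under two morphisms -/

/-- The equation between the images of an object judgement under `f` and `g`; an equation is sent
to its image under `f`. -/
def JThesis.eqn (f g : Expr S → Expr S) : JThesis S → JThesis S
  | .isTy A => .eqTy (f A) (g A)
  | .isTm t A => .eqTm (f t) (g t) (f A)
  | .eqTy A B => .eqTy (f A) (f B)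
  | .eqTm s t A => .eqTm (f s) (f t) (f A)

abbrev eqnJ (f g : Expr S → Expr S) : Judg S → Judg S := Abs.bimap f (JThesis.eqn f g)

theorem BThesis.eqn_plug {b : BThesis S} (hb : b.cls.IsObject) (f g : Expr S → Expr S)
    (e : Expr S) : (b.plug e).eqn f g = (b.map f).plugEq (f e) (g e) := by
  cases b with
  | eqTy => exact hb.elim
  | eqTm => exact hb.elim
  | _ => rfl

theorem BThesis.eqn_plug_of_not {b : BThesis S} (hb : ¬ b.cls.IsObject) (f g : Expr S → Expr S)
    (e : Expr S) : (b.plug e).eqn f g = (b.plug e).map f := by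
  cases b with
  | ty => exact (hb trivial).elim
  | tm => exact (hb trivial).elim
  | _ => rfl

theorem BThesis.eqn_plugEq (b : BThesis S) (f g : Expr S → Expr S) (e e' : Expr S) :
    (b.plugEq e e').eqn f g = (b.plugEq e e').map f := by
  cases b <;> rfl

theorem eqnJ_plug {I I' : Inst S} {σ σ' : Name → Expr S} {Θ : MCtx S} {Γ : VCtx S} {c : SynClass}
    (B : Bdry S) : ∀ {k : ℕ} {e : Expr S}, B.body.cls.IsObject →
      e.Valid Θ Γ k (c, B.tele.length) →
      eqnJ (Expr.inst I σ) (Expr.inst I' σ') (plug B e) =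
        plugEq (mapB (Expr.inst I σ) B) (e.inst I σ) (e.inst I' σ') := by
  induction B with
  | base b => intro k e hb he; simp [plug, plugEq, Abs.bimap, BThesis.eqn_plug (b := b) hb]
  | abstr A B ih =>
    intro k e hb he
    obtain ⟨e, rfl, h1⟩ := he.eq_abstr
    simp [plug, plugEq, Abs.bimap, Expr.inst]; exact ih hb h1

theorem JThesis.Valid.eqn {f g : Expr S → Expr S} {Θ Θ' : MCtx S} {Γ Γ' : VCtx S} {k k' : ℕ}
    (hf : ∀ e ar, e.Valid Θ Γ k ar → (f e).Valid Θ' Γ' k' ar)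
    (hg : ∀ e ar, e.Valid Θ Γ k ar → (g e).Valid Θ' Γ' k' ar) {j : JThesis S}
    (h : j.Valid Θ Γ k) : (j.eqn f g).Valid Θ' Γ' k' := by
  cases j <;> simp only [JThesis.Valid, JThesis.eqn] at * <;> grind

theorem ValidJ.eqn {f g : Expr S → Expr S} {Θ Θ' : MCtx S} {Γ Γ' : VCtx S}
    (hf : ∀ k e ar, e.Valid Θ Γ k ar → (f e).Valid Θ' Γ' k ar)
    (hg : ∀ k e ar, e.Valid Θ Γ k ar → (g e).Valid Θ' Γ' k ar) {J : Judg S} :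
    ∀ {k : ℕ}, ValidJ Θ Γ k J → ValidJ Θ' Γ' k (eqnJ f g J) := by
  induction J with
  | base j => intro k h; exact JThesis.Valid.eqn (hf k) (hg k) h
  | abstr A J ih => intro k h; exact ⟨hf _ _ _ h.1, ih h.2⟩

theorem IsMor.validHyp_eqn {I I' : Inst S} {Ξ Θ : MCtx S} {σ σ' : Name → Expr S} {Γ Δ : VCtx S}
    (h : IsMor I Ξ Θ σ Γ Δ) (h' : IsMor I' Ξ Θ σ' Γ Δ) {J : Judg S}
    (hJ : ValidHyp Ξ Γ (.jdg J)) :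
    ValidHyp Θ Δ (.jdg (eqnJ (Expr.inst I σ) (Expr.inst I' σ') J)) :=
  ⟨h.mctx, h.vctx, ValidJ.eqn (fun _ _ _ => h.valid_inst) (fun _ _ _ => h'.valid_inst) hJ.2.2⟩

theorem JThesis.Valid.eqn_congr {f g f' g' : Expr S → Expr S} {Θ : MCtx S} {Γ : VCtx S} {k : ℕ}
    (hf : ∀ e ar, e.Valid Θ Γ k ar → f e = f' e) (hg : ∀ e ar, e.Valid Θ Γ k ar → g e = g' e)
    {j : JThesis S} (h : j.Valid Θ Γ k) : j.eqn f g = j.eqn f' g' := by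
  cases j <;> simp only [JThesis.Valid, JThesis.eqn] at * <;> grind

theorem ValidJ.eqn_congr {f g f' g' : Expr S → Expr S} {Θ : MCtx S} {Γ : VCtx S}
    (hf : ∀ k e ar, e.Valid Θ Γ k ar → f e = f' e) (hg : ∀ k e ar, e.Valid Θ Γ k ar → g e = g' e)
    {J : Judg S} : ∀ {k : ℕ}, ValidJ Θ Γ k J → eqnJ f g J = eqnJ f' g' J := by
  induction J with
  | base j => intro k h; simp [Abs.bimap, JThesis.Valid.eqn_congr (hf k) (hg k) h]
  | abstr A J ih => intro k h; simp [Abs.bimap, hf _ _ _ h.1]; exact ih h.2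

/-- A single `τ'` can serve both sides of the resulting equation only if the two morphisms agree on
the values of `τ`. In the application `τ` opens a binder at a variable that both send to the same
fresh variable. -/
theorem ClosedMor.eqnJ_substJ {I I' : Inst S} {σ σ' : Name → Expr S} (h : ClosedMor I σ)
    (h' : ClosedMor I' σ') (J : Judg S) : ∀ τ τ' : ℕ → Expr S,
    (∀ i, (τ i).inst I σ = τ' i) → (∀ i, (τ i).inst I' σ' = τ' i) →
    eqnJ (Expr.inst I σ) (Expr.inst I' σ') (substJ τ J) =
      substJ τ' (eqnJ (Expr.inst I σ) (Expr.inst I' σ') J) := by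
  induction J with
  | base j =>
    intro τ τ' h1 h2
    cases j <;> simp [Abs.bimap, substJ, JThesis.map, JThesis.eqn, h.inst_subst, h'.inst_subst,
      h1, h2]
  | abstr A J ih =>
    intro τ τ' h1 h2
    simp only [Abs.bimap, substJ, h.inst_subst, h1, Abs.abstr.injEq, true_and]
    refine ih _ _ ?_ ?_
    · intro i; cases i with
      | zero => rfl
      | succ i => simp [liftSubst, h.inst_rename, h1]
    · intro i; cases i with
      | zero => rfl
      | succ i => simp [liftSubst, h'.inst_rename, h2]

theorem ClosedMor.eqnJ_openJ_update {I I' : Inst S} {σ σ' : Name → Expr S} {Ξ : MCtx S}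
    {Γ : VCtx S} {k : ℕ} {J : Judg S} (hJ : ValidJ Ξ Γ k J) {a : Name} (ha : a ∉ Γ.map Prod.fst)
    (h : ClosedMor I σ) (h' : ClosedMor I' σ') (b : Name) :
    eqnJ (Expr.inst I (Function.update σ a (.fvar b)))
      (Expr.inst I' (Function.update σ' a (.fvar b))) (openJ a J) =
      openJ b (eqnJ (Expr.inst I σ) (Expr.inst I' σ') J) := by
  rw [openJ, (h.update a (Expr.closed_fvar b)).eqnJ_substJ (h'.update a (Expr.closed_fvar b)) J _
    (vecSubst 1 fun _ => .fvar b)]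
  · rw [ValidJ.eqn_congr (fun k e ar (he : e.Valid Ξ Γ k ar) => he.inst_update ha _)
      (fun k e ar (he : e.Valid Ξ Γ k ar) => he.inst_update ha _) hJ]
    rfl
  · intro i; rw [ClosedMor.inst_vecSubst]; simp [Expr.inst]
  · intro i; rw [ClosedMor.inst_vecSubst]; simp [Expr.inst]

/-- The induction needs something from a boundary only in the case `□ : A`: the metavariable and
specific rules have their boundary as a premise, and the corresponding congruence rules demand the
equation between the two images of `A`. -/
def EqClaim (T : RawTypeTheory.{u, v} S) (Θ : MCtx S) (Δ : VCtx S) (f g : Expr S → Expr S) :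
    Stmt S → Prop
  | .jdg J => Derives T Θ Δ (.jdg (eqnJ f g J))
  | .bdr (.base (.tm A)) => Derives T Θ Δ (.jdg (.base (.eqTy (f A) (g A))))
  | .bdr _ => True

/-- What a class of pairs of morphisms has to satisfy in order to send derivable object judgements
to derivable equations. -/
structure EqKit (T : RawTypeTheory.{u, v} S) (I I' : Inst S) (Ξ Θ : MCtx S)
    (Good : VCtx S → (Name → Expr S) → (Name → Expr S) → VCtx S → Prop) : Prop where
  left : ∀ {Γ σ σ' Δ}, Good Γ σ σ' Δ → IsMor I Ξ Θ σ Γ Δ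
  right : ∀ {Γ σ σ' Δ}, Good Γ σ σ' Δ → IsMor I' Ξ Θ σ' Γ Δ
  derives_left : ∀ {Γ σ σ' Δ}, Good Γ σ σ' Δ → ∀ {X}, Derives T Ξ Γ X →
    Derives T Θ Δ (X.map (Expr.inst I σ))
  derives_right : ∀ {Γ σ σ' Δ}, Good Γ σ σ' Δ → ∀ {X}, Derives T Ξ Γ X →
    Derives T Θ Δ (X.map (Expr.inst I' σ'))
  ext : ∀ {Γ σ σ' Δ}, Good Γ σ σ' Δ → ∀ {a : Name} {A : Expr S}, a ∉ Γ.map Prod.fst →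
    Derives T Ξ Γ (.jdg (.base (.isTy A))) →
    Derives T Θ Δ (.jdg (.base (.eqTy (A.inst I σ) (A.inst I' σ')))) →
    ∃ b, b ∉ Δ.map Prod.fst ∧ Good (Γ ++ [(a, A)]) (Function.update σ a (.fvar b))
      (Function.update σ' a (.fvar b)) (Δ ++ [(b, A.inst I σ)])
  var : ∀ {Γ σ σ' Δ}, Good Γ σ σ' Δ → ∀ {a : Name} {A : Expr S}, (a, A) ∈ Γ →
    Derives T Θ Δ (.jdg (.base (.eqTm (σ a) (σ' a) (A.inst I σ))))
  meta_ : ∀ {Γ σ σ' Δ}, Good Γ σ σ' Δ → ∀ {M : MVar} {B : Bdry S}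
    (ts : Fin B.tele.length → Expr S), (M, B) ∈ Ξ → B.body.cls.IsObject →
    ValidHyp Ξ Γ (.jdg (.base
        ((B.body.map (Expr.subst (vecSubst _ ts))).plug (.metaApp M _ ts)))) →
    (∀ j : Fin B.tele.length, Derives T Ξ Γ (.jdg (.base (.isTm (ts j)
        ((B.tele.get j).subst (vecSubst j fun i : Fin j => ts (i.castLE j.isLt.le))))))) →
    (∀ j : Fin B.tele.length, Derives T Θ Δ (.jdg (.base (.eqTm
      ((ts j).inst I σ) ((ts j).inst I' σ') (((B.tele.get j).subst
        (vecSubst j fun i : Fin j => ts (i.castLE j.isLt.le))).inst I σ))))) →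
    (∀ C : Expr S, B.body = .tm C → Derives T Θ Δ (.jdg (.base (.eqTy
      ((C.subst (vecSubst _ ts)).inst I σ) ((C.subst (vecSubst _ ts)).inst I' σ'))))) →
    Derives T Θ Δ (.jdg (.base (JThesis.eqn (Expr.inst I σ) (Expr.inst I' σ')
        ((B.body.map (Expr.subst (vecSubst _ ts))).plug (.metaApp M _ ts)))))

/-- Each object rule is answered by its congruence rule: the typing premises are the images of the
original premises under the left and the right morphism, and the equational premises are the
induction hypotheses. Judgements that are already equations are just transported along the left
morphism. -/
theorem Derives.eqMorph {T : RawTypeTheory.{u, v} S} {I I' : Inst S} {Ξ Θ : MCtx S}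
    {Good : VCtx S → (Name → Expr S) → (Name → Expr S) → VCtx S → Prop}
    (kit : EqKit T I I' Ξ Θ Good) {Γ : VCtx S} {X : Stmt S} (h : Derives T Ξ Γ X) :
    ∀ {σ σ' : Name → Expr S} {Δ : VCtx S}, Good Γ σ σ' Δ →
      EqClaim T Θ Δ (Expr.inst I σ) (Expr.inst I' σ') X := by
  induction h with
  | var hv hm => intro σ σ' Δ hG; exact kit.var hG hm
  | @meta_ Γ M B ts hv hm ht hb ih ihb =>
    intro σ σ' Δ hG
    by_cases ho : B.body.cls.IsObject
    · refine kit.meta_ hG ts hm ho hv ht (fun j => ih j hG) fun C hC => ?_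
      have := ihb hG
      rw [hC] at this
      exact this
    · have := kit.derives_left hG (.meta_ ts hv hm ht hb)
      simp only [Stmt.map, Abs.bimap] at this
      rw [← BThesis.eqn_plug_of_not (by rwa [BThesis.cls_map])] at this
      exact this
  | metaCongr ss ts hv hm ho hs ht he hC _ _ _ _ =>
    intro σ σ' Δ hG
    have := kit.derives_left hG (.metaCongr ss ts hv hm ho hs ht he hC)
    simp only [Stmt.map, Abs.bimap] at this
    rwa [← BThesis.eqn_plugEq] at this
  | abstr a hv hA ha _ ihA ihJ =>
    intro σ σ' Δ hG
    obtain ⟨b, hb, hG'⟩ := kit.ext hG ha hA (ihA hG)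
    refine .abstr b ((kit.left hG).validHyp_eqn (kit.right hG) hv) (kit.derives_left hG hA) hb ?_
    have := ihJ hG'
    simp only [EqClaim] at this
    rwa [ClosedMor.eqnJ_openJ_update hv.2.2.2 ha (kit.left hG).closed (kit.right hG).closed] at this
  | tyRefl hv h _ => intro σ σ' Δ hG; exact kit.derives_left hG (.tyRefl hv h)
  | tySym hv h _ => intro σ σ' Δ hG; exact kit.derives_left hG (.tySym hv h)
  | tyTran hv h h' _ _ => intro σ σ' Δ hG; exact kit.derives_left hG (.tyTran hv h h')
  | tmRefl hv h _ => intro σ σ' Δ hG; exact kit.derives_left hG (.tmRefl hv h)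
  | tmSym hv h _ => intro σ σ' Δ hG; exact kit.derives_left hG (.tmSym hv h)
  | tmTran hv h h' _ _ => intro σ σ' Δ hG; exact kit.derives_left hG (.tmTran hv h h')
  | convTm hv _ h' ih _ =>
    intro σ σ' Δ hG
    exact Derives.conv_eq (ih hG) (kit.derives_left hG h')
  | convEq hv h h' _ _ => intro σ σ' Δ hG; exact kit.derives_left hG (.convEq hv h h')
  | bdryTm hv _ ih => intro σ σ' Δ hG; exact ih hG
  | bdryTy => intro σ σ' Δ hG; trivial
  | bdryEqTy => intro σ σ' Δ hG; trivial
  | bdryEqTm => intro σ σ' Δ hG; trivial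
  | bdryAbstr => intro σ σ' Δ hG; trivial
  | @specific Γ r K hv hK hp hb ih ihb =>
    intro σ σ' Δ hG
    by_cases ho : (T.rule r).bdry.cls.IsObject
    · have hc := (kit.left hG).closed
      have hc' := (kit.right hG).closed
      have hv' := (kit.left hG).validHyp_eqn (kit.right hG) hv
      have el : ∀ (i : ℕ) (M N : MVar) (B : Bdry S) (e : Expr S),
          (T.rule r).mctx[i]? = some (M, B) → (K.mapArg (Expr.inst I σ))[i]? = some (N, e) →
          Derives T Θ Δ (.jdg (plug (actB ((K.mapArg (Expr.inst I σ)).take i) B) e)) := by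
        intro i M N B e h1 h2
        obtain ⟨e, h3, rfl⟩ := Inst.getElem?_mapArg h2
        have := kit.derives_left hG (hp i M N B e h1 h3)
        simp only [Stmt.map] at this
        rwa [hc.mapJ_plug_take (T.rule r).valid_mctx hK h1 (hK.2 _ _ _ _ _ h1 h3)] at this
      have er : ∀ (i : ℕ) (M N : MVar) (B : Bdry S) (e : Expr S),
          (T.rule r).mctx[i]? = some (M, B) → (K.mapArg (Expr.inst I' σ'))[i]? = some (N, e) →
          Derives T Θ Δ (.jdg (plug (actB ((K.mapArg (Expr.inst I' σ')).take i) B) e)) := by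
        intro i M N B e h1 h2
        obtain ⟨e, h3, rfl⟩ := Inst.getElem?_mapArg h2
        have := kit.derives_right hG (hp i M N B e h1 h3)
        simp only [Stmt.map] at this
        rwa [hc'.mapJ_plug_take (T.rule r).valid_mctx hK h1 (hK.2 _ _ _ _ _ h1 h3)] at this
      have e1 : JThesis.eqn (Expr.inst I σ) (Expr.inst I' σ')
          (((T.rule r).bdry.plug (T.rule r).head).act K) =
          ((T.rule r).bdry.act (K.mapArg (Expr.inst I σ))).plugEq
            ((T.rule r).head.act (K.mapArg (Expr.inst I σ)))
            ((T.rule r).head.act (K.mapArg (Expr.inst I' σ'))) := by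
        rw [JThesis.act, BThesis.map_plug, BThesis.eqn_plug (by rwa [BThesis.cls_map])]
        rw [← BThesis.act, hc.map_act (T.rule r).valid_mctx.1 hK (T.rule r).valid_bdry,
          hc.inst_act (T.rule r).valid_mctx.1 hK (T.rule r).valid_head,
          hc'.inst_act (T.rule r).valid_mctx.1 hK (T.rule r).valid_head]
      simp only [EqClaim, Abs.bimap] at hv' ⊢
      rw [e1] at hv' ⊢
      refine .congr r _ _ hv' ho ((kit.left hG).isInst_mapArg hK)
        ((kit.right hG).isInst_mapArg hK) el er ?_ ?_
      · intro i M N N' B f g h1 h2 h3 hB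
        obtain ⟨f, h4, rfl⟩ := Inst.getElem?_mapArg h2
        obtain ⟨g, h5, rfl⟩ := Inst.getElem?_mapArg h3
        -- Both arguments are images of the same argument of `K`, so the required equation is the
        -- induction hypothesis for that premise.
        rw [h4] at h5
        cases h5
        have := ih i M N B f h1 h4 hG
        simp only [EqClaim] at this
        have hf := hK.2 _ _ _ _ _ h1 h4
        rwa [eqnJ_plug (c := B.body.cls) (k := 0) (Θ := Ξ) (Γ := Γ) _
          (by rwa [body_actB, BThesis.act, BThesis.cls_map])
          (by rw [tele_actB, List.length_map]; exact hf),
          hc.mapB_actB_take (T.rule r).valid_mctx hK h1] at this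
      · intro C hC
        have := ihb hG
        have hC' := (T.rule r).valid_bdry
        rw [hC] at this hC'
        simp only [BThesis.act, BThesis.map, EqClaim] at this
        rwa [hc.inst_act (T.rule r).valid_mctx.1 hK hC',
          hc'.inst_act (T.rule r).valid_mctx.1 hK hC'] at this
    · have := kit.derives_left hG (.specific r K hv hK hp hb)
      simp only [Stmt.map, Abs.bimap] at this
      simp only [EqClaim, Abs.bimap]
      rw [JThesis.act, BThesis.map_plug] at this ⊢
      rwa [BThesis.eqn_plug_of_not (by rwa [BThesis.cls_map])]
  | congr r K K' hv ho hK hK' hp hp' he hC _ _ _ _ =>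
    intro σ σ' Δ hG
    have := kit.derives_left hG (.congr r K K' hv ho hK hK' hp hp' he hC)
    simp only [Stmt.map, Abs.bimap] at this
    rwa [← BThesis.eqn_plugEq] at this

/-! ### Judgementally equal substitutions -/

/-- A pair of derivable morphisms with judgementally equal values on variables. -/
structure EqMor (T : RawTypeTheory.{u, v} S) (I I' : Inst S) (Ξ Θ : MCtx S) (Γ : VCtx S)
    (σ σ' : Name → Expr S) (Δ : VCtx S) : Prop where
  left : Mor T I Ξ Θ Γ σ Δ
  right : Mor T I' Ξ Θ Γ σ' Δ
  eq : ∀ a A, (a, A) ∈ Γ → Derives T Θ Δ (.jdg (.base (.eqTm (σ a) (σ' a) (A.inst I σ))))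

section
variable {T : RawTypeTheory.{u, v} S} {I I' : Inst S} {Ξ Θ : MCtx S} {Γ Δ Δ' : VCtx S}
  {σ σ' : Name → Expr S}

theorem EqMor.weaken (h : EqMor T I I' Ξ Θ Γ σ σ' Δ) (hΔ : ValidVCtx Θ Δ')
    (hs : ∀ p ∈ Δ, p ∈ Δ') : EqMor T I I' Ξ Θ Γ σ σ' Δ' :=
  ⟨h.left.weaken hΔ hs, h.right.weaken hΔ hs, fun a A ha => (h.eq a A ha).weaken hΔ hs⟩

theorem EqMor.update (h : EqMor T I I' Ξ Θ Γ σ σ' Δ) (hΓ : ValidVCtx Ξ Γ) {a : Name}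
    (ha : a ∉ Γ.map Prod.fst) {A t t' : Expr S} (hA : A.Valid Ξ Γ 0 (.ty, 0))
    (ht : Derives T Θ Δ (.jdg (.base (.isTm t (A.inst I σ)))))
    (ht' : Derives T Θ Δ (.jdg (.base (.isTm t' (A.inst I' σ')))))
    (he : Derives T Θ Δ (.jdg (.base (.eqTm t t' (A.inst I σ))))) :
    EqMor T I I' Ξ Θ (Γ ++ [(a, A)]) (Function.update σ a t) (Function.update σ' a t') Δ := by
  refine ⟨h.left.update hΓ ha hA ht, h.right.update hΓ ha hA ht', ?_⟩
  intro c C hc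
  rw [List.mem_append, List.mem_singleton] at hc
  rcases hc with hc | hc
  · rw [update_agree ha _ _ c (List.mem_map_of_mem hc), update_agree ha _ _ c
      (List.mem_map_of_mem hc), (hΓ.valid_of_mem hc).inst_update ha]
    exact h.eq c C hc
  · obtain ⟨rfl, rfl⟩ := Prod.mk.inj hc
    rw [hA.inst_update ha]
    simpa using he

/-- The new variable is declared at the left image of `A`. For the right morphism it must have the
right image as its type, hence the hypothesis that the two images are equal. -/
theorem EqMor.extend (h : EqMor T I I' Ξ Θ Γ σ σ' Δ) (hΓ : ValidVCtx Ξ Γ) {a b : Name}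
    (ha : a ∉ Γ.map Prod.fst) {A : Expr S} (hA : A.Valid Ξ Γ 0 (.ty, 0))
    (he : Derives T Θ Δ (.jdg (.base (.eqTy (A.inst I σ) (A.inst I' σ')))))
    (hb : b ∉ Δ.map Prod.fst) :
    EqMor T I I' Ξ Θ (Γ ++ [(a, A)]) (Function.update σ a (.fvar b))
      (Function.update σ' a (.fvar b)) (Δ ++ [(b, A.inst I σ)]) := by
  have hΔ := h.left.mor.vctx.extend hb (h.left.mor.valid_inst hA)
  have hv := derives_var_last (T := T) h.left.mor.mctx hΔ
  exact (h.weaken hΔ fun p hp => List.mem_append_left _ hp).update hΓ ha hA hv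
    (hv.conv_tm (he.weaken_one hΔ)) hv.tm_refl

theorem EqMor.id (hΘ : ValidMCtx Θ) (hΓ : ValidVCtx Θ Γ) : EqMor T [] [] Θ Θ Γ .fvar .fvar Γ :=
  ⟨.id hΘ hΓ, .id hΘ hΓ, fun a A ha => ((Mor.id hΘ hΓ).tm a A ha).tm_refl⟩

end

theorem eqMor_nil_kit (T : RawTypeTheory.{u, v} S) (Θ : MCtx S) :
    EqKit T [] [] Θ Θ (EqMor T [] [] Θ Θ) where
  left h := h.left.mor
  right h := h.right.mor
  derives_left h _ hX := hX.subst_fvar h.left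
  derives_right h _ hX := hX.subst_fvar h.right
  ext := by
    intro Γ σ σ' Δ h a A ha hA he
    obtain ⟨b, hb⟩ := exists_fresh (Δ.map Prod.fst)
    exact ⟨b, hb, h.extend hA.validHyp.2.1 ha hA.validHyp.2.2 he hb⟩
  var h a A ha := h.eq a A ha
  meta_ := by
    intro Γ σ σ' Δ h M B ts hM ho hv ht he hC
    have hB := h.left.mor.mctx.valid_of_mem hM
    have hv' := h.left.mor.validHyp_eqn h.right.mor hv
    simp only [Abs.bimap] at hv'
    have ho' : (B.body.map (Expr.subst (vecSubst _ ts))).cls.IsObject := by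
      rwa [BThesis.cls_map]
    rw [BThesis.eqn_plug ho', h.left.mor.closed.map_nil_subst hB.body_valid] at hv' ⊢
    exact h.left.mor.derives_metaCongr h.right.mor ts ts hM ho hv'
      (fun j => (ht j).subst_fvar h.left) (fun j => (ht j).subst_fvar h.right) he hC

/-- Judgementally equal substitutions send object judgements to equations. -/
theorem Derives.eqSubst {T : RawTypeTheory.{u, v} S} {Θ : MCtx S} {Γ Δ : VCtx S} {X : Stmt S}
    {σ σ' : Name → Expr S} (h : Derives T Θ Γ X) (hσ : EqMor T [] [] Θ Θ Γ σ σ' Δ) :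
    EqClaim T Θ Δ (Expr.inst [] σ) (Expr.inst [] σ') X :=
  h.eqMorph (eqMor_nil_kit T Θ) hσ

/-! ### Judgementally equal substitution for bound variables -/

theorem CtxDerivable.extend {T : RawTypeTheory.{u, v} S} {Θ : MCtx S} {Γ : VCtx S}
    (h : CtxDerivable T Θ Γ) {a : Name} {A : Expr S} (hA : Derives T Θ Γ (.jdg (.base (.isTy A))))
    (hv : ValidVCtx Θ (Γ ++ [(a, A)])) : CtxDerivable T Θ (Γ ++ [(a, A)]) := by
  intro c C hc
  rw [List.mem_append, List.mem_singleton] at hc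
  rcases hc with hc | hc
  · exact (h c C hc).weaken_one hv
  · obtain ⟨rfl, rfl⟩ := Prod.mk.inj hc
    exact hA.weaken_one hv

theorem JThesis.eqn_map (f g s : Expr S → Expr S) (j : JThesis S) :
    (j.map s).eqn f g = j.eqn (fun e => f (s e)) fun e => g (s e) := by
  cases j <;> rfl

theorem Expr.Valid.inst_env {Θ : MCtx S} {Δ : VCtx S} {k : ℕ} {e : Expr S} {ar : SynClass × ℕ}
    (he : e.Valid Θ Δ k ar) {σ : Name → Expr S} (hσ : ClosedMor [] σ)
    (hΔ : ∀ a ∈ Δ.map Prod.fst, σ a = .fvar a) {as : ℕ → Name} {ss : ℕ → Expr S} {n : ℕ}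
    (has : ∀ i < n, σ (as i) = ss i) :
    (e.subst (env (fun i => .fvar (as i)) n)).inst [] σ = e.subst (env ss n) := by
  rw [hσ.inst_subst, he.inst_nil hΔ]
  congr 1
  funext i
  rw [ClosedMor.inst_env]
  exact congrFun (env_congr has) i

theorem ValidJ.of_abstr {Θ : MCtx S} {Δ : VCtx S} {k : ℕ} {A : Expr S} {J : Judg S}
    (h : ValidJ Θ Δ k (.abstr A J)) : A.Valid Θ Δ k (.ty, 0) ∧ ValidJ Θ Δ (k + 1) J := h

/-- Filling a binder at once would lose the common judgement that the two substitutions are compared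
on. Instead all binders are opened at fresh names `as i`, while the pair `σ`, `σ'` from the growing
context `Γ` back to `Δ` is the identity on `Δ` and records `ss` and `ts` on these names. Once the
telescope is exhausted, `Derives.eqSubst` applies. The disjunction lets the right-hand terms be
given at the left types only. The type equation needed to convert them appears as the telescope is
opened, and the second conclusion returns the converted typings. The third conclusion, for term
judgements, uses presuppositivity over `Γ`. -/
theorem Derives.eq_tele_aux {T : RawTypeTheory.{u, v} S} {Θ : MCtx S} {Δ : VCtx S}
    {ss ts : ℕ → Expr S} {J : Judg S} : ∀ {n : ℕ} {as : ℕ → Name} {Γ : VCtx S}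
    {σ σ' : Name → Expr S}, ValidJ Θ Δ n J →
    Derives T Θ Γ (.jdg (substJ (env (fun i => .fvar (as i)) n) J)) →
    EqMor T [] [] Θ Θ Γ σ σ' Δ →
    (∀ a ∈ Δ.map Prod.fst, a ∈ Γ.map Prod.fst ∧ σ a = .fvar a ∧ σ' a = .fvar a) →
    (∀ i < n, as i ∈ Γ.map Prod.fst ∧ σ (as i) = ss i ∧ σ' (as i) = ts i) →
    (∀ j A, J.tele[j]? = some A →
      Derives T Θ Δ (.jdg (.base (.isTm (ss (n + j)) (A.subst (env ss (n + j)))))) ∧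
      (Derives T Θ Δ (.jdg (.base (.isTm (ts (n + j)) (A.subst (env ts (n + j)))))) ∨
        Derives T Θ Δ (.jdg (.base (.isTm (ts (n + j)) (A.subst (env ss (n + j))))))) ∧
      Derives T Θ Δ (.jdg (.base (.eqTm (ss (n + j)) (ts (n + j))
        (A.subst (env ss (n + j))))))) →
    Derives T Θ Δ (.jdg (.base (J.body.eqn (Expr.subst (env ss (n + J.tele.length)))
      (Expr.subst (env ts (n + J.tele.length)))))) ∧
    (∀ j A, J.tele[j]? = some A →
      Derives T Θ Δ (.jdg (.base (.isTm (ts (n + j)) (A.subst (env ts (n + j))))))) ∧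
    (CtxDerivable T Θ Γ → ∀ t C, J.body = .isTm t C →
      Derives T Θ Δ (.jdg (.base (.eqTy (C.subst (env ss (n + J.tele.length)))
        (C.subst (env ts (n + J.tele.length))))))) := by
  induction J with
  | base j =>
    intro n as Γ σ σ' hJ h hσ hΔ has _
    have hj : j.Valid Θ Δ n := hJ
    have e1 : ∀ (e : Expr S) (ar : SynClass × ℕ), e.Valid Θ Δ n ar →
        (e.subst (env (fun i => .fvar (as i)) n)).inst [] σ = e.subst (env ss n) :=
      fun e ar he => he.inst_env hσ.left.mor.closed (fun a ha => (hΔ a ha).2.1)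
        fun i hi => (has i hi).2.1
    have e2 : ∀ (e : Expr S) (ar : SynClass × ℕ), e.Valid Θ Δ n ar →
        (e.subst (env (fun i => .fvar (as i)) n)).inst [] σ' = e.subst (env ts n) :=
      fun e ar he => he.inst_env hσ.right.mor.closed (fun a ha => (hΔ a ha).2.2)
        fun i hi => (has i hi).2.2
    refine ⟨?_, fun j A hA => by simp [Abs.tele] at hA, ?_⟩
    · have := h.eqSubst hσ
      simp only [substJ, EqClaim, Abs.bimap] at this
      rwa [JThesis.eqn_map, JThesis.Valid.eqn_congr e1 e2 hj] at this
    · intro hΓ t C hb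
      have hb : j = .isTm t C := hb
      subst hb
      have : Derives T Θ Γ (.jdg (.base (.isTy (C.subst (env (fun i => .fvar (as i)) n))))) :=
        h.presup hΓ
      have := this.eqSubst hσ
      simp only [EqClaim, Abs.bimap, JThesis.eqn] at this
      rwa [e1 _ _ hj.2, e2 _ _ hj.2] at this
  | abstr A J ih =>
    intro n as Γ σ σ' hJ h hσ hΔ has ht
    obtain ⟨hA, hJ⟩ := hJ.of_abstr
    obtain ⟨hAd, a, ha, hJd⟩ := h.abstr_inv
    have e1 := hA.inst_env hσ.left.mor.closed (fun a ha => (hΔ a ha).2.1)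
        fun i hi => (has i hi).2.1
    have e2 := hA.inst_env hσ.right.mor.closed (fun a ha => (hΔ a ha).2.2)
        fun i hi => (has i hi).2.2
    have heq := hAd.eqSubst hσ
    simp only [EqClaim, Abs.bimap, JThesis.eqn] at heq
    rw [e1, e2] at heq
    obtain ⟨hs0, ht0, he0⟩ := ht 0 A rfl
    simp only [Nat.add_zero] at hs0 ht0 he0
    -- If the right-hand term is known at the left type, the equation between the two substituted
    -- copies of `A` moves it to the right type.
    have ht0 := ht0.elim (fun h => h) fun h => h.conv_tm heq
    have hσ1 := hσ.update h.validHyp.2.1 ha hAd.validHyp.2.2 (by rwa [e1]) (by rwa [e2])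
      (by rwa [e1])
    -- The earlier names lie in `Γ` and `a` does not, so updating at `a` preserves the recorded
    -- values.
    have hne : ∀ i < n, as i ≠ a := by
      rintro i hi rfl
      exact ha (has i hi).1
    have hJd' : Derives T Θ (Γ ++ [(a, A.subst (env (fun i => .fvar (as i)) n))])
        (.jdg (substJ (env (fun i => .fvar (Function.update as n a i)) (n + 1)) J)) := by
      rw [← substJ_env_open]
      have : env (fun i => (.fvar (Function.update as n a i) : Expr S)) n =
          env (fun i => .fvar (as i)) n :=
        env_congr fun i hi => by rw [Function.update_of_ne (by omega)]
      rw [this, Function.update_self]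
      exact hJd
    obtain ⟨c1, c2, c3⟩ := ih (n := n + 1) hJ hJd' hσ1
      (fun c hc => by
        have hca : c ≠ a := by rintro rfl; exact ha (hΔ c hc).1
        rw [Function.update_of_ne hca, Function.update_of_ne hca]
        exact ⟨by simpa using .inl (by simpa using (hΔ c hc).1), (hΔ c hc).2⟩)
      (fun i hi => by
        by_cases hin : i = n
        · subst hin; simp
        · have := has i (by omega)
          rw [Function.update_of_ne hin, Function.update_of_ne (hne i (by omega)),
            Function.update_of_ne (hne i (by omega))]
          exact ⟨by simpa using .inl (by simpa using this.1), this.2⟩)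
      (fun j A' hj => by
        have := ht (j + 1) A' (by simpa [Abs.tele] using hj)
        simpa only [Nat.add_assoc, Nat.add_comm 1 j] using this)
    simp only [Nat.add_assoc, Nat.add_comm 1] at c1 c2 c3
    refine ⟨c1, ?_, fun hΓ => c3 (hΓ.extend hAd hJd.validHyp.2.1)⟩
    intro j A' hj
    cases j with
    | zero =>
      simp only [Abs.tele, List.getElem?_cons_zero, Option.some.injEq] at hj
      subst hj; exact ht0
    | succ j => exact c2 j A' (by simpa [Abs.tele] using hj)

/-- Judgementally equal substitution for all bound variables. -/
theorem Derives.eq_tele {T : RawTypeTheory.{u, v} S} {Θ : MCtx S} {Δ : VCtx S}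
    {ss ts : ℕ → Expr S} {J : Judg S} (h : Derives T Θ Δ (.jdg J))
    (ht : ∀ j A, J.tele[j]? = some A →
      Derives T Θ Δ (.jdg (.base (.isTm (ss j) (A.subst (env ss j))))) ∧
      (Derives T Θ Δ (.jdg (.base (.isTm (ts j) (A.subst (env ts j))))) ∨
        Derives T Θ Δ (.jdg (.base (.isTm (ts j) (A.subst (env ss j)))))) ∧
      Derives T Θ Δ (.jdg (.base (.eqTm (ss j) (ts j) (A.subst (env ss j)))))) :
    Derives T Θ Δ (.jdg (.base (J.body.eqn (Expr.subst (env ss J.tele.length))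
      (Expr.subst (env ts J.tele.length))))) ∧
    (∀ j A, J.tele[j]? = some A →
      Derives T Θ Δ (.jdg (.base (.isTm (ts j) (A.subst (env ts j)))))) ∧
    (CtxDerivable T Θ Δ → ∀ t C, J.body = .isTm t C →
      Derives T Θ Δ (.jdg (.base (.eqTy (C.subst (env ss J.tele.length))
        (C.subst (env ts J.tele.length)))))) := by
  -- Initially no binder is open: both morphisms are the identity of `Δ`, and the choice of `as` is
  -- immaterial since `n = 0`.
  have := eq_tele_aux (T := T) (Θ := Θ) (Δ := Δ) (ss := ss) (ts := ts) (J := J) (n := 0)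
    (as := fun _ => 0) (Γ := Δ) (σ := .fvar) (σ' := .fvar) h.validHyp.2.2
    (by rwa [env_zero, substJ_bvar]) (EqMor.id h.validHyp.1 h.validHyp.2.1)
    (fun a ha => ⟨ha, rfl, rfl⟩) (by simp) (by simpa only [Nat.zero_add] using ht)
  simpa only [Nat.zero_add] using this

theorem Derives.subst_tele_zero {T : RawTypeTheory.{u, v} S} {Θ : MCtx S} {Γ : VCtx S}
    {t : ℕ → Expr S} {J : Judg S} (h : Derives T Θ Γ (.jdg J))
    (ht : ∀ j A, J.tele[j]? = some A →
      Derives T Θ Γ (.jdg (.base (.isTm (t j) (A.subst (env t j)))))) :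
    Derives T Θ Γ (.jdg (.base (J.body.map (Expr.subst (env t J.tele.length))))) := by
  have := Derives.subst_tele (T := T) (Θ := Θ) (Γ := Γ) (t := t) (J := J) (n := 0)
    (by rwa [env_zero, substJ_bvar]) (by simpa only [Nat.zero_add] using ht)
  simpa only [Nat.zero_add] using this

/-! ### Derivable instantiations -/

/-- A valid derivable instantiation. -/
structure InstDer (T : RawTypeTheory.{u, v} S) (I : Inst S) (Ξ Θ : MCtx S) (Δ : VCtx S) : Prop where
  valid : ValidMCtx Ξ
  isInst : I.IsInst Ξ Θ Δ
  der : I.IsDerivable T Ξ Θ Δ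

/-- Distinctness of names makes truncation harmless on the earlier metavariables. Hence `I` and
`I_(i)` act alike on the boundary of the `i`-th entry, which is what reconciles `I_*` with the
`I_(i)*` in the definition of derivability. -/
theorem lookup_take {I : Inst S} {Ξ Θ : MCtx S} {Δ : VCtx S} (hΞ : ValidMCtx Ξ)
    (hI : I.IsInst Ξ Θ Δ) (i : ℕ) {M : MVar} (hM : M ∈ (Ξ.take i).map Prod.fst) :
    I.lookup M = List.lookup M (I.take i) := by
  obtain ⟨⟨N, B⟩, hB, rfl⟩ := List.mem_map.1 hM
  obtain ⟨j, hj⟩ := List.mem_iff_getElem?.1 hB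
  obtain ⟨e, he, h1, -⟩ := (hI.take i).exists_arg (hΞ.nodup_take i) hj
  rw [h1]
  rw [List.getElem?_take] at he
  split_ifs at he
  exact lookup_of_getElem? (hI.1 ▸ hΞ.1) he

theorem Expr.Valid.inst_take {I : Inst S} {Ξ Θ : MCtx S} {Δ : VCtx S} (hΞ : ValidMCtx Ξ)
    (hI : I.IsInst Ξ Θ Δ) (i : ℕ) {k : ℕ} {e : Expr S} {ar : SynClass × ℕ}
    (he : e.Valid (Ξ.take i) [] k ar) (σ : Name → Expr S) : e.inst I σ = e.act (I.take i) := by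
  rw [Expr.act_eq_inst]
  exact he.inst_congr (by simp) fun M hM => lookup_take hΞ hI i hM

theorem inst_ofVec {I : Inst S} {σ : Name → Expr S} {n : ℕ} (ts : Fin n → Expr S) (i : ℕ) :
    (ofVec ts i).inst I σ = ofVec (fun j => (ts j).inst I σ) i := by
  unfold ofVec; split_ifs <;> rfl

theorem ClosedMor.inst_env_ofVec {I : Inst S} {σ : Name → Expr S} {n : ℕ} (ts : Fin n → Expr S)
    (m i : ℕ) : (env (ofVec ts) m i).inst I σ = env (ofVec fun j => (ts j).inst I σ) m i := by
  rw [ClosedMor.inst_env]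
  exact congrFun (env_congr fun j _ => inst_ofVec ts j) i

section
variable {T : RawTypeTheory.{u, v} S} {I : Inst S} {Ξ Θ : MCtx S} {Γ Δ Δ' : VCtx S}
  {σ : Name → Expr S}

theorem InstDer.weaken (h : InstDer T I Ξ Θ Δ) (hΔ : ValidVCtx Θ Δ') (hs : ∀ p ∈ Δ, p ∈ Δ') :
    InstDer T I Ξ Θ Δ' :=
  ⟨h.valid, h.isInst.mono (fst_subset hs),
    fun k M N B e h1 h2 => (h.der k M N B e h1 h2).weaken hΔ hs⟩

theorem ClosedMor.inst_subst_ofVec (hσ : ClosedMor I σ) (hΞ : ValidMCtx Ξ) (hI : I.IsInst Ξ Θ Δ)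
    {i k : ℕ} {e : Expr S} {ar : SynClass × ℕ} (he : e.Valid (Ξ.take i) [] k ar) {n : ℕ}
    (ts : Fin n → Expr S) (m : ℕ) : (e.subst (env (ofVec ts) m)).inst I σ =
      (e.act (I.take i)).subst (env (ofVec fun j => (ts j).inst I σ) m) := by
  rw [hσ.inst_subst, he.inst_take hΞ hI]
  congr 1; funext i; exact inst_env_ofVec ts m i

theorem ClosedMor.map_subst_ofVec (hσ : ClosedMor I σ) (hΞ : ValidMCtx Ξ) (hI : I.IsInst Ξ Θ Δ)
    {i k : ℕ} {b : BThesis S} (hb : b.Valid (Ξ.take i) [] k) {n : ℕ}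
    (ts : Fin n → Expr S) (m : ℕ) : (b.map (Expr.subst (env (ofVec ts) m))).map (Expr.inst I σ) =
      (b.act (I.take i)).map (Expr.subst (env (ofVec fun j => (ts j).inst I σ) m)) := by
  rw [BThesis.map_map, BThesis.act, BThesis.map_map]
  exact BThesis.Valid.map_congr (fun e ar he => hσ.inst_subst_ofVec hΞ hI he ts m) hb

theorem Expr.inst_metaApp_ofVec {M : MVar} {e : Expr S} (hM : I.lookup M = some e) {n : ℕ}
    (ts : Fin n → Expr S) : (Expr.metaApp M n ts).inst I σ =
      (e.stripAbs n).subst (env (ofVec fun j => (ts j).inst I σ) n) := by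
  rw [Expr.inst_metaApp_some hM, vecSubst_ofVec]

/-- The premises of a metavariable rule, after instantiation. -/
theorem tele_inst_premises (hσ : ClosedMor I σ) (hΞ : ValidMCtx Ξ) (hI : I.IsInst Ξ Θ Δ)
    {i : ℕ} {M : MVar} {B : Bdry S} (hi : Ξ[i]? = some (M, B))
    (ts : Fin B.tele.length → Expr S) {P : ℕ → Expr S → Prop}
    (h : ∀ j : Fin B.tele.length, P j (((B.tele.get j).subst
      (vecSubst j fun i : Fin j => ts (i.castLE j.isLt.le))).inst I σ)) :
    ∀ j A, (actB (I.take i) B).tele[j]? = some A →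
      P j (A.subst (env (ofVec fun j => (ts j).inst I σ) j)) := by
  intro j A hA
  rw [tele_actB, List.getElem?_map, Option.map_eq_some_iff] at hA
  obtain ⟨A, hA, rfl⟩ := hA
  obtain ⟨hj, hA'⟩ := List.getElem?_eq_some_iff.1 hA
  have := h ⟨j, hj⟩
  have hv := (hΞ.2 _ _ _ hi).tele_valid hA
  rw [vecSubst_castLE ts ⟨j, hj⟩] at this
  simp only [List.get_eq_getElem, hA'] at this
  rwa [hσ.inst_subst_ofVec hΞ hI hv] at this

/-- An application `M(t)` becomes `e[I_* t]`. The metavariable rule thus turns into substitution in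
the derivable judgement filled with `e`, and metavariable congruence into substitution of equal
terms in it. The derivability of `I` is part of the class because the target context grows under
binders. -/
theorem inst_kit (T : RawTypeTheory.{u, v} S) (I : Inst S) (Ξ Θ : MCtx S) :
    MorKit T I Ξ Θ fun Γ σ Δ => Mor T I Ξ Θ Γ σ Δ ∧ InstDer T I Ξ Θ Δ where
  mor h := h.1.mor
  ext := by
    intro Γ σ Δ h a A ha hA hΓ hd
    obtain ⟨b, hb⟩ := exists_fresh (Δ.map Prod.fst)
    have hΔ := h.1.mor.vctx.extend hb hd.validHyp.2.2
    exact ⟨b, hb, h.1.extend hΓ ha hA hb, h.2.weaken hΔ fun p hp => List.mem_append_left _ hp⟩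
  var h a A ha _ := h.1.tm a A ha
  meta_ := by
    intro Γ σ Δ ⟨h, hI⟩ M B ts hM hv ht hb
    have hc := h.mor.closed
    obtain ⟨i, hi⟩ := List.mem_iff_getElem?.1 hM
    obtain ⟨e, he, hl, hve⟩ := hI.isInst.exists_arg hI.valid.1 hi
    have hvb : B.body.Valid (Ξ.take i) [] _ := (hI.valid.2 _ _ _ hi).body_valid
    have h1 := (hI.der _ _ _ _ _ hi he).subst_tele_zero
      (t := ofVec fun j => (ts j).inst I σ) (by
        rw [tele_plug]
        intro j A hA
        exact tele_inst_premises hc hI.valid hI.isInst hi ts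
          (P := fun j A => Derives T Θ Δ (.jdg (.base (.isTm
            (ofVec (fun j => (ts j).inst I σ) j) A)))) (fun j => by
              have := ht j
              rwa [ofVec_lt _ j.isLt]) j A hA)
    rw [body_plug, tele_plug, tele_actB, List.length_map, body_actB, BThesis.map_plug] at h1
    simp only [Stmt.map, Abs.bimap, BThesis.map_plug]
    rwa [vecSubst_ofVec, hc.map_subst_ofVec hI.valid hI.isInst hvb, Expr.inst_metaApp_ofVec hl]
  metaCongr := by
    intro Γ σ Δ ⟨h, hI⟩ M B ss ts hM ho hv hs ht he hC
    have hc := h.mor.closed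
    obtain ⟨i, hi⟩ := List.mem_iff_getElem?.1 hM
    obtain ⟨e, hie, hl, hve⟩ := hI.isInst.exists_arg hI.valid.1 hi
    have hvb : B.body.Valid (Ξ.take i) [] _ := (hI.valid.2 _ _ _ hi).body_valid
    have hd := hI.der _ _ _ _ _ hi hie
    have h1 := (hd.eq_tele (ss := ofVec fun j => (ss j).inst I σ)
      (ts := ofVec fun j => (ts j).inst I σ) (by
        rw [tele_plug]
        intro j A hA
        refine ⟨?_, .inl ?_, ?_⟩
        · exact tele_inst_premises hc hI.valid hI.isInst hi ss
            (P := fun j A => Derives T Θ Δ (.jdg (.base (.isTm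
              (ofVec (fun j => (ss j).inst I σ) j) A)))) (fun j => by
                have := hs j
                rwa [ofVec_lt _ j.isLt]) j A hA
        · exact tele_inst_premises hc hI.valid hI.isInst hi ts
            (P := fun j A => Derives T Θ Δ (.jdg (.base (.isTm
              (ofVec (fun j => (ts j).inst I σ) j) A)))) (fun j => by
                have := ht j
                rwa [ofVec_lt _ j.isLt]) j A hA
        · exact tele_inst_premises hc hI.valid hI.isInst hi ss
            (P := fun j A => Derives T Θ Δ (.jdg (.base (.eqTm
              (ofVec (fun j => (ss j).inst I σ) j)
              (ofVec (fun j => (ts j).inst I σ) j) A)))) (fun j => by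
                have := he j
                rwa [ofVec_lt _ j.isLt, ofVec_lt _ j.isLt]) j A hA)).1
    rw [body_plug, tele_plug, tele_actB, List.length_map, body_actB,
      BThesis.eqn_plug (by rwa [BThesis.act, BThesis.cls_map])] at h1
    simp only [Stmt.map, Abs.bimap, BThesis.map_plugEq]
    rwa [vecSubst_ofVec, hc.map_subst_ofVec hI.valid hI.isInst hvb, Expr.inst_metaApp_ofVec hl,
      Expr.inst_metaApp_ofVec hl]

/-- Derivable instantiations preserve derivability. -/
theorem Derives.instantiate {X : Stmt S} (h : Derives T Ξ Γ X) (hσ : Mor T I Ξ Θ Γ σ Δ)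
    (hI : InstDer T I Ξ Θ Δ) : Derives T Θ Δ (X.map (Expr.inst I σ)) :=
  h.morph (inst_kit T I Ξ Θ) ⟨hσ, hI⟩

end

/-! ### Judgementally equal instantiations -/

/-- Judgementally equal derivable morphisms over judgementally equal derivable instantiations. -/
structure EqInstMor (T : RawTypeTheory.{u, v} S) (I I' : Inst S) (Ξ Θ : MCtx S) (Γ : VCtx S)
    (σ σ' : Name → Expr S) (Δ : VCtx S) : Prop where
  mor : EqMor T I I' Ξ Θ Γ σ σ' Δ
  left : InstDer T I Ξ Θ Δ
  right : InstDer T I' Ξ Θ Δ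
  eq : I.JudgEq I' T Ξ Θ Δ
  ctx : CtxDerivable T Θ Δ

theorem EqInstMor.weaken_one {T : RawTypeTheory.{u, v} S} {I I' : Inst S} {Ξ Θ : MCtx S}
    {Γ Δ : VCtx S} {σ σ' : Name → Expr S} (h : EqInstMor T I I' Ξ Θ Γ σ σ' Δ) {b : Name}
    {A : Expr S} (hb : b ∉ Δ.map Prod.fst) (hA : Derives T Θ Δ (.jdg (.base (.isTy A)))) :
    EqInstMor T I I' Ξ Θ Γ σ σ' (Δ ++ [(b, A)]) := by
  have hΔ := h.mor.left.mor.vctx.extend hb hA.validHyp.2.2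
  have hs : ∀ p ∈ Δ, p ∈ Δ ++ [(b, A)] := fun p hp => List.mem_append_left _ hp
  exact ⟨h.mor.weaken hΔ hs, h.left.weaken hΔ hs, h.right.weaken hΔ hs,
    fun k M N N' B e f h1 h2 h3 h4 => (h.eq k M N N' B e f h1 h2 h3 h4).weaken hΔ hs,
    h.ctx.extend hA hΔ⟩

/-- For a metavariable with arguments `e` and `f`, the equation is obtained as `e[I_* t] ≡ e[J_* t]
≡ f[J_* t]`, writing `J` for `I'`. The first half substitutes equal terms in the derivable `e`, the
second substitutes `J_* t` in the given `e ≡ f`. -/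
theorem eqInst_kit (T : RawTypeTheory.{u, v} S) (I I' : Inst S) (Ξ Θ : MCtx S) :
    EqKit T I I' Ξ Θ (EqInstMor T I I' Ξ Θ) where
  left h := h.mor.left.mor
  right h := h.mor.right.mor
  derives_left h _ hX := hX.instantiate h.mor.left h.left
  derives_right h _ hX := hX.instantiate h.mor.right h.right
  ext := by
    intro Γ σ σ' Δ h a A ha hA he
    obtain ⟨b, hb⟩ := exists_fresh (Δ.map Prod.fst)
    have h1 := h.weaken_one hb (hA.instantiate h.mor.left h.left)
    exact ⟨b, hb, h.mor.extend hA.validHyp.2.1 ha hA.validHyp.2.2 he hb, h1.left, h1.right,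
      h1.eq, h1.ctx⟩
  var h a A ha := h.mor.eq a A ha
  meta_ := by
    intro Γ σ σ' Δ h M B ts hM ho hv ht he _
    have hI := h.left
    have hI' := h.right
    have hc := h.mor.left.mor.closed
    obtain ⟨i, hi⟩ := List.mem_iff_getElem?.1 hM
    obtain ⟨e, hie, hl, hve⟩ := hI.isInst.exists_arg hI.valid.1 hi
    obtain ⟨f, hif, hlf, hvf⟩ := hI'.isInst.exists_arg hI.valid.1 hi
    have hvb : B.body.Valid (Ξ.take i) [] _ := (hI.valid.2 _ _ _ hi).body_valid
    obtain ⟨h1, h2, h3⟩ := (hI.der _ _ _ _ _ hi hie).eq_tele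
      (ss := ofVec fun j => (ts j).inst I σ) (ts := ofVec fun j => (ts j).inst I' σ') (by
        rw [tele_plug]
        intro j A hA
        have := tele_inst_premises hc hI.valid hI.isInst hi ts
            (P := fun j A => Derives T Θ Δ (.jdg (.base (.eqTm
              (ofVec (fun j => (ts j).inst I σ) j)
              (ofVec (fun j => (ts j).inst I' σ') j) A)))) (fun j => by
                have := he j
                rwa [ofVec_lt _ j.isLt, ofVec_lt _ j.isLt]) j A hA
        -- The presuppositions of the equation give the terms `I'_* t` at the types built from `I`.
        -- This is the second alternative accepted by `eq_tele`, and its conclusion `h2` then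
        -- provides the typings needed to substitute in `e ≡ f`.
        obtain ⟨-, p1, p2⟩ := this.presup h.ctx
        exact ⟨p1, .inr p2, this⟩)
    have h4 := (h.eq _ _ _ _ _ _ _ hi hie hif ho).subst_tele_zero
      (t := ofVec fun j => (ts j).inst I' σ') (by
        rw [tele_plugEq]
        rwa [tele_plug] at h2)
    have hlen : (actB (I.take i) B).tele.length = B.tele.length := by
      rw [tele_actB, List.length_map]
    rw [body_plugEq (c := B.body.cls) (c' := B.body.cls) (k := 0) (Θ := Θ) (Γ := Δ) _
      (by rw [hlen]; exact hve) (by rw [hlen]; exact hvf), tele_plugEq, hlen, body_actB,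
      BThesis.map_plugEq] at h4
    have h3 := h3 h.ctx
    rw [body_plug, tele_plug, hlen, body_actB] at h3
    rw [body_plug, tele_plug, hlen, body_actB,
      BThesis.eqn_plug (by rwa [BThesis.act, BThesis.cls_map])] at h1
    rw [BThesis.eqn_plug (by rwa [BThesis.cls_map]), vecSubst_ofVec,
      hc.map_subst_ofVec hI.valid hI.isInst hvb, Expr.inst_metaApp_ofVec hl,
      Expr.inst_metaApp_ofVec hlf]
    generalize B.body.act (I.take i) = b at *
    cases b with
    | ty => exact h1.ty_trans h4
    -- The second equation lives over the type with the right-hand arguments substituted; `h3`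
    -- brings it to the type of the first.
    | tm C => exact h1.tm_trans (h4.conv_eq (h3 _ _ rfl).ty_symm)
    | eqTy A C => exact h1
    | eqTm s t A => exact h1

theorem Derives.eqInstantiate {T : RawTypeTheory.{u, v} S} {I I' : Inst S} {Ξ Θ : MCtx S}
    {Γ Δ : VCtx S} {σ σ' : Name → Expr S} {X : Stmt S} (h : Derives T Ξ Γ X)
    (hσ : EqInstMor T I I' Ξ Θ Γ σ σ' Δ) :
    EqClaim T Θ Δ (Expr.inst I σ) (Expr.inst I' σ') X :=
  h.eqMorph (eqInst_kit T I I' Ξ Θ) hσ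

/-! ### Transport of a filled boundary between equal instantiations -/

theorem substJ_plugEq {Θ : MCtx S} {Γ : VCtx S} {c c' : SynClass} (B : Bdry S) :
    ∀ {k : ℕ} {e e' : Expr S} (τ : ℕ → Expr S), e.Valid Θ Γ k (c, B.tele.length) →
      e'.Valid Θ Γ k (c', B.tele.length) →
      substJ τ (plugEq B e e') = plugEq (substB τ B) (e.subst τ) (e'.subst τ) := by
  induction B with
  | base b => intro k e e' τ he he'; simp [plugEq, substB, substJ, BThesis.map_plugEq]
  | abstr A B ih =>
    intro k e e' τ he he'
    obtain ⟨e, rfl, h1⟩ := he.eq_abstr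
    obtain ⟨e', rfl, h1'⟩ := he'.eq_abstr
    simp [plugEq, substB, substJ, Expr.subst]; exact ih _ h1 h1'

theorem substJ_plug {Θ : MCtx S} {Γ : VCtx S} {c : SynClass} (B : Bdry S) :
    ∀ {k : ℕ} {e : Expr S} (τ : ℕ → Expr S), e.Valid Θ Γ k (c, B.tele.length) →
      substJ τ (plug B e) = plug (substB τ B) (e.subst τ) := by
  induction B with
  | base b => intro k e τ he; simp [plug, substB, substJ, BThesis.map_plug]
  | abstr A B ih =>
    intro k e τ he
    obtain ⟨e, rfl, h1⟩ := he.eq_abstr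
    simp [plug, substB, substJ, Expr.subst]; exact ih _ h1

theorem ValidB.plug {Θ : MCtx S} {Γ : VCtx S} {B : Bdry S} :
    ∀ {k : ℕ} {e : Expr S}, ValidB Θ Γ k B → e.Valid Θ Γ k (arityB B) →
      ValidJ Θ Γ k (FTT.plug B e) := by
  induction B with
  | base b => intro k e hB he; exact BThesis.Valid.plug hB he
  | abstr A B ih =>
    intro k e hB he
    obtain ⟨e, rfl, h1⟩ := Expr.Valid.eq_abstr he
    exact ⟨hB.1, ih hB.2 h1⟩

theorem arityB_mapB (f : Expr S → Expr S) (B : Bdry S) : arityB (mapB f B) = arityB B := by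
  simp [arityB, Abs.body_bimap, Abs.tele_bimap, BThesis.cls_map]

theorem arityB_substB (B : Bdry S) : ∀ τ : ℕ → Expr S, arityB (substB τ B) = arityB B := by
  induction B with
  | base b => intro τ; simp [arityB, substB, Abs.body, Abs.tele, BThesis.cls_map]
  | abstr A B ih =>
    intro τ
    have := ih (liftSubst τ)
    simp_all [arityB, substB, Abs.body, Abs.tele]

theorem Derives.bdryAbstr_inv {T : RawTypeTheory.{u, v} S} {Θ : MCtx S} {Γ : VCtx S} {A : Expr S}
    {B : Bdry S} (h : Derives T Θ Γ (.bdr (.abstr A B))) :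
    Derives T Θ Γ (.jdg (.base (.isTy A))) ∧ ∃ a, a ∉ Γ.map Prod.fst ∧
      Derives T Θ (Γ ++ [(a, A)]) (.bdr (openB a B)) := by
  cases h with
  | bdryAbstr a hv hA ha hJ => exact ⟨hA, a, ha, hJ⟩

theorem Expr.Valid.open_fvar {Θ : MCtx S} {Δ : VCtx S} {b : Name} {A e : Expr S}
    {ar : SynClass × ℕ} (he : e.Valid Θ Δ 1 ar) :
    (e.subst (vecSubst 1 fun _ => .fvar b)).Valid Θ (Δ ++ [(b, A)]) 0 ar := by
  refine (he.mono (fun _ _ h => h) ?_).subst ?_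
  · exact fst_subset fun p hp => List.mem_append_left _ hp
  · intro i hi
    obtain rfl : i = 0 := by omega
    exact .fvar (by simp)

/-- Object boundaries: `f` is a presupposition of the equation, converted when it is a term.
Equality boundaries: the equation between the left images is flanked by the equations from each side
to its right image, and for terms converted to the right type. -/
theorem Derives.plug_conv_base {T : RawTypeTheory.{u, v} S} {I I' : Inst S} {Ξ Θ : MCtx S}
    {Γ Δ : VCtx S} {σ σ' : Name → Expr S} {b : BThesis S} (hb : Derives T Ξ Γ (.bdr (.base b)))
    (hσ : EqInstMor T I I' Ξ Θ Γ σ σ' Δ) {e f : Expr S}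
    (h : Derives T Θ Δ (.jdg (.base ((b.map (Expr.inst I σ)).plugEq e f)))) :
    Derives T Θ Δ (.jdg (.base ((b.map (Expr.inst I' σ')).plug f))) := by
  have hp := h.presup hσ.ctx
  cases hb with
  | bdryTy hv => exact hp.2
  | bdryTm hv hA => exact hp.2.2.conv_tm (hA.eqInstantiate hσ)
  | bdryEqTy hv hA hB =>
    exact ((hA.eqInstantiate hσ).ty_symm.ty_trans h).ty_trans (hB.eqInstantiate hσ)
  | bdryEqTm hv hA hs ht =>
    exact (((hs.eqInstantiate hσ).tm_symm.tm_trans h).tm_trans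
      (ht.eqInstantiate hσ)).conv_eq (hA.eqInstantiate hσ)

/-- Conversion of the right-hand side of an equation between arguments to the boundary obtained
from the second of two judgementally equal instantiations. -/
theorem Derives.plug_conv {T : RawTypeTheory.{u, v} S} {I I' : Inst S} {Ξ Θ : MCtx S} (n : ℕ) :
    ∀ {B : Bdry S} {Γ Δ : VCtx S} {σ σ' : Name → Expr S} {e f : Expr S}, B.tele.length = n →
    Derives T Ξ Γ (.bdr B) → EqInstMor T I I' Ξ Θ Γ σ σ' Δ →
    e.Valid Θ Δ 0 (arityB B) → f.Valid Θ Δ 0 (arityB B) →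
    Derives T Θ Δ (.jdg (plugEq (mapB (Expr.inst I σ) B) e f)) →
    Derives T Θ Δ (.jdg (plug (mapB (Expr.inst I' σ') B) f)) := by
  -- The induction is on the number of binders, because the opened boundary `openB a B` is not a
  -- subterm of the original one.
  induction n with
  | zero =>
    intro B Γ Δ σ σ' e f hn hB hσ he hf h
    cases B with
    | base b => exact hB.plug_conv_base hσ h
    | abstr A B => simp [Abs.tele] at hn
  | succ n ih =>
    intro B Γ Δ σ σ' e f hn hB hσ he hf h
    cases B with
    | base b => simp [Abs.tele] at hn
    | abstr A B =>
      obtain ⟨e, rfl, he1⟩ := Expr.Valid.eq_abstr he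
      obtain ⟨f, rfl, hf1⟩ := Expr.Valid.eq_abstr hf
      obtain ⟨hΓv, hAv, hBv⟩ := hB.validHyp.2
      obtain ⟨hA, a, ha, hBd⟩ := hB.bdryAbstr_inv
      obtain ⟨b, hb⟩ := exists_fresh (Δ.map Prod.fst)
      have hAe : Derives T Θ Δ (.jdg (.base (.eqTy (A.inst I σ) (A.inst I' σ')))) :=
        hA.eqInstantiate hσ
      have hA' : Derives T Θ Δ (.jdg (.base (.isTy (A.inst I' σ')))) :=
        hA.instantiate hσ.mor.right hσ.right
      -- The goal abstracts over the right image of `A`, so the fresh variable is declared at that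
      -- type. The given equation abstracts over the left image, and the variable is converted to it
      -- before being substituted.
      have hσ1 := hσ.weaken_one hb hA'
      have hΔ1 := hσ1.mor.left.mor.vctx
      have hΘ := hσ1.mor.left.mor.mctx
      have hv' := derives_var_last (T := T) hΘ hΔ1
      have hv := hv'.conv_tm (hAe.ty_symm.weaken_one hΔ1)
      have hσ2 : EqInstMor T I I' Ξ Θ (Γ ++ [(a, A)]) (Function.update σ a (.fvar b))
          (Function.update σ' a (.fvar b)) (Δ ++ [(b, A.inst I' σ')]) :=
        ⟨hσ1.mor.update hΓv ha hAv hv hv' hv.tm_refl, hσ1.left, hσ1.right, hσ1.eq, hσ1.ctx⟩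
      have hlen : (mapB (Expr.inst I σ) B).tele.length = B.tele.length := by
        rw [Abs.tele_bimap, List.length_map]
      have hlen' : (mapB (Expr.inst I' σ') B).tele.length = B.tele.length := by
        rw [Abs.tele_bimap, List.length_map]
      have har : arityB (openB a B) = (B.body.cls, B.tele.length) := arityB_substB _ _
      have h1 := (h.weaken_one hΔ1).subst_abstr hv
      rw [substJ_plugEq (c := B.body.cls) (c' := B.body.cls) (Θ := Θ) (Γ := Δ) _ _
        (by rw [hlen]; exact he1) (by rw [hlen]; exact hf1),
        ← ClosedMor.openB_update hBv ha hσ.mor.left.mor.closed (Expr.closed_fvar b)] at h1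
      have h2 := ih (by rw [openB, length_tele_substB]; simpa [Abs.tele] using hn) hBd hσ2
        (by rw [har]; exact Expr.Valid.open_fvar he1) (by rw [har]; exact Expr.Valid.open_fvar hf1) h1
      rw [ClosedMor.openB_update hBv ha hσ.mor.right.mor.closed (Expr.closed_fvar b),
        ← substJ_plug (c := B.body.cls) (Θ := Θ) (Γ := Δ) (k := 1) _ _
          (by rw [hlen']; exact hf1)] at h2
      refine .abstr b ⟨hΘ, hσ.mor.left.mor.vctx, hA'.validHyp.2.2, ?_⟩ hA' hb h2
      refine ValidB.plug (ValidB.map (fun _ _ _ => hσ.mor.right.mor.valid_inst) hBv) ?_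
      rw [arityB_mapB]; exact hf1

/-! ### Well-formed contexts -/

theorem ValidMCtx.extend {Θ : MCtx S} (h : ValidMCtx Θ) {M : MVar} {B : Bdry S}
    (hM : M ∉ Θ.map Prod.fst) (hB : ValidB Θ [] 0 B) : ValidMCtx (Θ ++ [(M, B)]) := by
  refine ⟨?_, ?_⟩
  · rw [List.map_append, List.nodup_append]
    refine ⟨h.1, by simp, ?_⟩
    intro x hx y hy
    simp only [List.map_cons, List.map_nil, List.mem_singleton] at hy
    subst hy; rintro rfl; exact hM hx
  · intro i N C hi
    rcases lt_trichotomy i Θ.length with hl | hl | hl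
    · rw [List.getElem?_append_left hl] at hi
      rw [List.take_append_of_le_length hl.le]
      exact h.2 _ _ _ hi
    · subst hl
      simp at hi ⊢
      obtain ⟨rfl, rfl⟩ := hi
      exact hB
    · rw [List.getElem?_eq_none (by simp; omega)] at hi
      cases hi

theorem WfMCtx.valid {T : RawTypeTheory.{u, v} S} {Θ : MCtx S} (h : WfMCtx T Θ) :
    ValidMCtx Θ := by
  induction h with
  | empty => exact ⟨by simp, by simp⟩
  | extend _ hB hM ih => exact ih.extend hM hB.validHyp.2.2

theorem WfMCtx.derives {T : RawTypeTheory.{u, v} S} {Θ : MCtx S} (h : WfMCtx T Θ) :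
    ∀ {i : ℕ} {M : MVar} {B : Bdry S}, Θ[i]? = some (M, B) →
      Derives T (Θ.take i) [] (.bdr B) := by
  induction h with
  | empty => intro i M B hi; simp at hi
  | @extend Θ N C _ hC _ ih =>
    intro i M B hi
    rcases lt_trichotomy i Θ.length with hl | hl | hl
    · rw [List.getElem?_append_left hl] at hi
      rw [List.take_append_of_le_length hl.le]
      exact ih hi
    · subst hl
      simp at hi ⊢
      obtain ⟨rfl, rfl⟩ := hi
      exact hC
    · rw [List.getElem?_eq_none (by simp; omega)] at hi
      cases hi

theorem WfVCtx.mctx {T : RawTypeTheory.{u, v} S} {Θ : MCtx S} {Γ : VCtx S}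
    (h : WfVCtx T Θ Γ) : WfMCtx T Θ := by
  induction h with
  | empty h => exact h
  | extend _ _ _ ih => exact ih

theorem WfVCtx.valid {T : RawTypeTheory.{u, v} S} {Θ : MCtx S} {Γ : VCtx S}
    (h : WfVCtx T Θ Γ) : ValidVCtx Θ Γ := by
  induction h with
  | empty _ => exact ⟨by simp, by simp⟩
  | extend _ hA ha ih => exact ih.extend ha hA.validHyp.2.2

theorem WfVCtx.ctxDerivable {T : RawTypeTheory.{u, v} S} {Θ : MCtx S} {Γ : VCtx S}
    (h : WfVCtx T Θ Γ) : CtxDerivable T Θ Γ := by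
  induction h with
  | empty _ => intro a A ha; simp at ha
  | extend h hA ha ih => exact ih.extend hA (h.valid.extend ha hA.validHyp.2.2)

/-! ### Truncated instantiations and the inductive step -/

theorem ValidMCtx.take {Ξ : MCtx S} (h : ValidMCtx Ξ) (k : ℕ) : ValidMCtx (Ξ.take k) := by
  refine ⟨h.nodup_take k, fun i M B hi => ?_⟩
  rw [List.getElem?_take] at hi
  split_ifs at hi with hk
  rw [List.take_take, min_eq_left hk.le]
  exact h.2 _ _ _ hi

theorem InstDer.of_take {T : RawTypeTheory.{u, v} S} {I : Inst S} {Ξ Θ : MCtx S} {Γ : VCtx S}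
    (hΞ : ValidMCtx Ξ) (hI : I.IsInst Ξ Θ Γ) {k : ℕ}
    (h : ∀ i < k, ∀ (M N : MVar) (B : Bdry S) (e : Expr S), Ξ[i]? = some (M, B) →
      I[i]? = some (N, e) → Derives T Θ Γ (.jdg (plug (actB (I.take i) B) e))) :
    InstDer T (I.take k) (Ξ.take k) Θ Γ := by
  refine ⟨hΞ.take k, hI.take k, fun i M N B e h1 h2 => ?_⟩
  rw [List.getElem?_take] at h1 h2
  split_ifs at h1 h2 with hk
  rw [List.take_take, min_eq_left hk.le]
  exact h i hk _ _ _ _ h1 h2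

theorem Inst.JudgEq.take {T : RawTypeTheory.{u, v} S} {I J : Inst S} {Ξ Θ : MCtx S} {Γ : VCtx S}
    (h : I.JudgEq J T Ξ Θ Γ) (k : ℕ) :
    Inst.JudgEq (I.take k) (J.take k) T (Ξ.take k) Θ Γ := by
  intro i M N N' B e f h1 h2 h3 hB
  rw [List.getElem?_take] at h1 h2 h3
  split_ifs at h1 h2 h3 with hk
  rw [List.take_take, min_eq_left hk.le]
  exact h _ _ _ _ _ _ _ h1 h2 h3 hB

/-- Judgemental equality says nothing at an equation entry. There the derivability of `I` already
supplies the judgement wanted, since heads of equations carry no information; both kinds of entries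
can then be handled uniformly. -/
theorem plugEq_eq_plug {Θ : MCtx S} {Γ : VCtx S} {c c' : SynClass} (B : Bdry S) :
    ∀ {k : ℕ} {e e' : Expr S}, ¬ B.body.cls.IsObject → e.Valid Θ Γ k (c, B.tele.length) →
      e'.Valid Θ Γ k (c', B.tele.length) → plugEq B e e' = plug B e := by
  induction B with
  | base b =>
    intro k e e' hb _ _
    cases b with
    | ty => exact (hb trivial).elim
    | tm => exact (hb trivial).elim
    | _ => rfl
  | abstr A B ih =>
    intro k e e' hb he he'
    obtain ⟨e, rfl, h1⟩ := he.eq_abstr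
    obtain ⟨e', rfl, h1'⟩ := he'.eq_abstr
    simp only [plugEq, plug, ih hb h1 h1']

/-- The `k`-th argument of an instantiation that is judgementally equal to a derivable one is
derivable if the preceding arguments are. -/
theorem Derives.of_judgEq {T : RawTypeTheory.{u, v} S} {I J : Inst S} {Ξ Θ : MCtx S} {Γ : VCtx S}
    (hI : I.IsInst Ξ Θ Γ) (hJ : J.IsInst Ξ Θ Γ) (hΞ : WfMCtx T Ξ) (hΓ : WfVCtx T Θ Γ)
    (hId : I.IsDerivable T Ξ Θ Γ) (hIJ : I.JudgEq J T Ξ Θ Γ) {k : ℕ}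
    (ih : ∀ i < k, ∀ (M N : MVar) (B : Bdry S) (e : Expr S), Ξ[i]? = some (M, B) →
      J[i]? = some (N, e) → Derives T Θ Γ (.jdg (plug (actB (J.take i) B) e)))
    {M N : MVar} {B : Bdry S} {f : Expr S} (hB : Ξ[k]? = some (M, B))
    (hf : J[k]? = some (N, f)) : Derives T Θ Γ (.jdg (plug (actB (J.take k) B) f)) := by
  have hΞv := hΞ.valid
  have hIk : InstDer T (I.take k) (Ξ.take k) Θ Γ :=
    .of_take hΞv hI fun i _ M N B e h1 h2 => hId i M N B e h1 h2
  have hJk : InstDer T (J.take k) (Ξ.take k) Θ Γ := .of_take hΞv hJ ih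
  -- Boundaries in `Ξ` are closed, so the source variable context is empty and the conditions on
  -- free variables are vacuous.
  have hmor : ∀ {K : Inst S}, InstDer T K (Ξ.take k) Θ Γ → Mor T K (Ξ.take k) Θ [] .fvar Γ :=
    fun h => ⟨h.isInst.isMor h.valid.1 hΓ.mctx.valid hΓ.valid, by simp⟩
  have hσ : EqInstMor T (I.take k) (J.take k) (Ξ.take k) Θ [] .fvar .fvar Γ :=
    ⟨⟨hmor hIk, hmor hJk, by simp⟩, hIk, hJk, hIJ.take k, hΓ.ctxDerivable⟩
  obtain ⟨e, he⟩ := exists_getElem?_of_fst hI.1.symm hB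
  have hev := hI.2 _ _ _ _ _ hB he
  have hfv := hJ.2 _ _ _ _ _ hB hf
  have hlen : (actB (I.take k) B).tele.length = B.tele.length := by
    rw [tele_actB, List.length_map]
  -- At an object entry this is the assumed equality of `I` and `J`; at an equation entry it is the
  -- derivability of `I`.
  have heq : Derives T Θ Γ (.jdg (plugEq (actB (I.take k) B) e f)) := by
    by_cases ho : B.body.cls.IsObject
    · exact hIJ _ _ _ _ _ _ _ hB he hf ho
    · rw [plugEq_eq_plug (c := B.body.cls) (c' := B.body.cls) (Θ := Θ) (Γ := Γ) (k := 0) _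
        (by rwa [body_actB, BThesis.act, BThesis.cls_map]) (by rw [hlen]; exact hev)
        (by rw [hlen]; exact hfv)]
      exact hId _ _ _ _ _ hB he
  rw [actB_eq_mapB, Expr.act_eq_inst'] at heq ⊢
  exact Derives.plug_conv _ rfl (hΞ.derives hB) hσ hev hfv heq

end FTT

theorem mainTheorem7 {S : FTT.Signature.{u}} (T : FTT.RawTypeTheory.{u, v} S)
    (hT : T.IsFinitary) (Ξ Θ : FTT.MCtx S) (Γ : FTT.VCtx S) (I J : FTT.Inst S)
    (hI : I.IsInst Ξ Θ Γ) (hJ : J.IsInst Ξ Θ Γ)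
    (hΞ : FTT.WfMCtx T Ξ) (hΓ : FTT.WfVCtx T Θ Γ)
    (hId : I.IsDerivable T Ξ Θ Γ) (hIJ : I.JudgEq J T Ξ Θ Γ) :
    J.IsDerivable T Ξ Θ Γ := by
  intro k
  -- All earlier arguments of `J` are needed at once: `J_(k)` must be derivable before it can be
  -- compared with `I_(k)` on `ℬ_k`.
  induction k using Nat.strong_induction_on with
  | _ k ih =>
    intro M N B f hB hf
    exact FTT.Derives.of_judgEq hI hJ hΞ hΓ hId hIJ ih hB hf
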